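/- Let $0<k<1$ and $T>\dfrac{e^{2k(1+k)/(1-k)^3}-1}{k}$. Put $\Omega_t=(0,1+kt)$, $\widehat Q=\{(x,t):0<t<T,\ 0<x<1+kt\}$, $\widehat\Sigma_0=\{0\}\times(0,T)$, $\widehat\Sigma_0^*=\{(1+kt,t):0<t<T\}$ and $\widehat\Sigma=\widehat\Sigma_0\cup\widehat\Sigma_0^*$. Let $\widetilde\sigma,\rho_0,\rho_1>0$, $\widetilde u_2\in L^2(\widehat Q)$, $u^0\in L^2(\Omega_T)$ and $u^1\in H^{-1}(\Omega_T)$. We write $|\cdot|$ for the norm and $(\cdot,\cdot)$ for the inner product of $L^2(\Omega_T)$, $\|f\|=|f_x|$ for the norm of $H^1_0(\Omega_T)$, and give $H^{-1}(\Omega_T)$ the dual norm. On $\widehat\Sigma_0$ let $\partial_\nu$ be the outward normal derivative, $\partial_\nu\varphi(t)=-\frac{\partial\varphi}{\partial x}(0,t)$. The leader control $w_1$ and the follower control $w_2$, both in $L^2(0,T)$, act together at $x=0$. The state $u=u(w_1,w_2)\in C([0,T];L^2(\Omega_t))\cap C^1([0,T];H^{-1}(\Omega_t))$ is the solution by transposition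 of $$u''-u_{xx}=0\ \text{in }\widehat Q,\qquad u=w_1+w_2\ \text{on }\widehat\Sigma_0,\qquad u=0\ \text{on }\widehat\Sigma_0^*,\qquad u(0)=u'(0)=0 .$$ A follower control $w_2$ is a Nash equilibrium for $w_1$ if it minimizes $\frac12\iint_{\widehat Q}(u(w_1,\cdot)-\widetilde u_2)^2\,dx\,dt+\frac{\widetilde\sigma}2\int_0^T(\cdot)^2\,dt$ over $L^2(0,T)$. A leader control $w_1$ is admissible if, with $w_2$ a Nash equilibrium for $w_1$, the state satisfies $|u(T)-u^0|\le\rho_0$ and $\|u'(T)-u^1\|_{H^{-1}(\Omega_T)}\le\rho_1$. It is optimal if it minimizes $\frac12\int_0^Tw_1^2\,dt$ among the admissible leader controls. **Theorem.** (i) For every $f=\{f^0,f^1\}\in H^1_0(\Omega_T)\times L^2(\Omega_T)$ there is exactly one $\{\varphi,\psi,u,p\}$, with $\varphi,p\in C([0,T];H^1_0(\Omega_t))\cap C^1([0,T];L^2(\Omega_t))$ having normal derivatives $\partial_\nu\varphi,\partial_\nu p\in L^2(0,T)$ on $\widehat\Sigma_0$, and with $\psi,u\in C([0,T];L^2(\Omega_t))\cap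 C^1([0,T];H^{-1}(\Omega_t))$ being solutions by transposition, such that $$\begin{aligned}&\varphi''-\varphi_{xx}=\psi,\quad \psi''-\psi_{xx}=0,\quad u''-u_{xx}=0,\quad p''-p_{xx}=u-\widetilde u_2 &&\text{in }\widehat Q,\\ &\varphi=p=0\ \text{ on }\widehat\Sigma,\qquad \psi=u=0\ \text{ on }\widehat\Sigma_0^*,\\ &\psi=\tfrac1{\widetilde\sigma}\,\partial_\nu\varphi,\qquad u=-\partial_\nu\varphi+\tfrac1{\widetilde\sigma}\,\partial_\nu p &&\text{on }\widehat\Sigma_0,\\ &\varphi(T)=f^0,\quad \varphi'(T)=f^1,\quad p(T)=p'(T)=0,\\ &\psi(0)=\psi'(0)=u(0)=u'(0)=0.\end{aligned}$$ (ii) There is exactly one $f=\{f^0,f^1\}\in H^1_0(\Omega_T)\times L^2(\Omega_T)$ such that, with $u=u(\cdot,f)$ the third component of the solution in (i), for all $\{\widehat f^0,\widehat f^1\}\in H^1_0(\Omega_T)\times L^2(\Omega_T)$ $$\langle u'(T,f)-u^1,\widehat f^0-f^0\rangle_{H^{-1},H^1_0}-\big(u(T,f)-u^0,\widehat f^1-f^1\big)+\rho_1\big(\|\widehat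 f^0\|-\|f^0\|\big)+\rho_0\big(|\widehat f^1|-|f^1|\big)\ge0 .$$ (iii) For this $f$ and the corresponding $\varphi$, there is exactly one optimal leader control, namely $\widetilde w_1=-\partial_\nu\varphi$ on $\widehat\Sigma_0$. -/

import Mathlib

open MeasureTheory Set Filter Topology
open scoped ContDiff ENNReal

noncomputable section

namespace MovingWave

/-- The position `1 + k t` of the moving endpoint; the string occupies `(0, 1 + k t)` at time `t`. -/
def endpt (k t : ℝ) : ℝ := 1 + k * t

/-- The non-cylindrical domain `{(t, x) : 0 < t < T, 0 < x < 1 + k t}` (time is the first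
coordinate). -/
def domainQ (k T : ℝ) : Set (ℝ × ℝ) := {z | z.1 ∈ Ioo 0 T ∧ z.2 ∈ Ioo 0 (endpt k z.1)}

/-- The real Hilbert space `L²(0, L)`. -/
abbrev L2 (L : ℝ) : Type := Lp ℝ 2 (volume.restrict (Ioo (0 : ℝ) L))

/-- Extension by zero, `L²(0, L) → L²(ℝ)`. -/
def extZero {L : ℝ} (f : L2 L) : Lp ℝ 2 (volume : Measure ℝ) :=
  ((memLp_indicator_iff_restrict (s := Ioo (0 : ℝ) L) (f := (f : ℝ → ℝ)) (p := 2)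
    measurableSet_Ioo).2 (Lp.memLp f)).toLp

/-! ### The space `H¹₀(0, L)` and its dual -/

theorem AC.ae_deriv {f : ℝ → ℝ} {L : ℝ} (hf : AbsolutelyContinuousOnInterval f 0 L) :
    ∀ᵐ x ∂(volume.restrict (Ioo (0 : ℝ) L)), DifferentiableAt ℝ f x := by
  rw [ae_restrict_iff' measurableSet_Ioo]
  filter_upwards [hf.ae_differentiableAt] with x hx hxL
  exact hx (Icc_subset_uIcc (Ioo_subset_Icc_self hxL))

/-- The functions of `H¹₀(0, L)`, each given by its continuous representative, set to zero off
`(0, L)`: the function is absolutely continuous on `[0, L]`, vanishes at both endpoints, and its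
derivative is square integrable on `(0, L)`. -/
def H01Submodule (L : ℝ) : Submodule ℝ (ℝ → ℝ) where
  carrier := {f | (∀ x, x ∉ Ioo 0 L → f x = 0) ∧ AbsolutelyContinuousOnInterval f 0 L ∧
    MemLp (deriv f) 2 (volume.restrict (Ioo (0 : ℝ) L))}
  zero_mem' := by
    refine ⟨fun _ _ => rfl, ?_, ?_⟩
    · have h := (LipschitzWith.const (0 : ℝ) (α := ℝ)).lipschitzOnWith (s := uIcc 0 L)
      exact h.absolutelyContinuousOnInterval
    · have : deriv (0 : ℝ → ℝ) = 0 := by ext x; simp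
      rw [this]; exact MemLp.zero
  add_mem' := by
    rintro f g ⟨hf0, hf1, hf2⟩ ⟨hg0, hg1, hg2⟩
    refine ⟨fun x hx => by simp [hf0 x hx, hg0 x hx], hf1.add hg1, (hf2.add hg2).ae_eq ?_⟩
    filter_upwards [AC.ae_deriv hf1, AC.ae_deriv hg1] with x h1 h2
    exact (deriv_add h1 h2).symm
  smul_mem' := by
    rintro c f ⟨hf0, hf1, hf2⟩
    refine ⟨fun x hx => by simp [hf0 x hx], hf1.const_mul c, (hf2.const_smul c).ae_eq ?_⟩
    filter_upwards [AC.ae_deriv hf1] with x h1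
    exact (deriv_const_smul c h1).symm

/-- The space `H¹₀(0, L)`. -/
def H01 (L : ℝ) : Type := ↥(H01Submodule L)

instance (L : ℝ) : AddCommGroup (H01 L) := inferInstanceAs (AddCommGroup ↥(H01Submodule L))

instance (L : ℝ) : Module ℝ (H01 L) := inferInstanceAs (Module ℝ ↥(H01Submodule L))

instance (L : ℝ) : CoeFun (H01 L) (fun _ => ℝ → ℝ) := ⟨fun f => f.1⟩

/-- The derivative `H¹₀(0, L) → L²(0, L)`. -/
def H01.grad (L : ℝ) : H01 L →ₗ[ℝ] L2 L where
  toFun f := f.2.2.2.toLp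
  map_add' f g := by
    rw [← MemLp.toLp_add, MemLp.toLp_eq_toLp_iff]
    filter_upwards [AC.ae_deriv f.2.2.1, AC.ae_deriv g.2.2.1] with x h1 h2
    exact deriv_add h1 h2
  map_smul' c f := by
    rw [RingHom.id_apply, ← MemLp.toLp_const_smul, MemLp.toLp_eq_toLp_iff]
    filter_upwards [AC.ae_deriv f.2.2.1] with x h1
    exact deriv_const_smul c h1

theorem H01.grad_injective (L : ℝ) : Function.Injective (H01.grad L) := by
  rw [injective_iff_map_eq_zero]
  intro f hf
  have h0 : deriv (f : ℝ → ℝ) =ᵐ[volume.restrict (Ioo (0 : ℝ) L)] 0 :=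
    (MemLp.toLp_eq_toLp_iff f.2.2.2 MemLp.zero).1 hf
  apply Subtype.ext
  funext x
  by_cases hx : x ∈ Ioo 0 L
  · have hL : (0 : ℝ) ≤ L := (hx.1.trans hx.2).le
    have hac := f.2.2.1.mono (c := 0) (d := x)
      (by rw [uIcc_of_le hL, uIcc_of_le hx.1.le]; exact Icc_subset_Icc_right hx.2.le)
    have hftc := hac.integral_deriv_eq_sub
    have hz : ∫ y in (0 : ℝ)..x, deriv (f : ℝ → ℝ) y = 0 := by
      rw [intervalIntegral.integral_of_le hx.1.le]
      refine integral_eq_zero_of_ae (ae_mono (Measure.restrict_mono ?_ le_rfl) h0)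
      exact fun y hy => ⟨hy.1, hy.2.trans_lt hx.2⟩
    have h00 : f.1 0 = 0 := f.2.1 0 (by simp)
    have := hz.symm.trans hftc
    show f.1 x = 0
    linarith
  · exact f.2.1 x hx

/-- `H¹₀(0, L)` carries the norm `‖f‖ = (∫₀ᴸ |f'|²)^(1/2)`. -/
instance (L : ℝ) : NormedAddCommGroup (H01 L) :=
  NormedAddCommGroup.induced (H01 L) (L2 L) (H01.grad L) (H01.grad_injective L)

instance (L : ℝ) : NormedSpace ℝ (H01 L) := NormedSpace.induced ℝ (H01 L) (L2 L) (H01.grad L)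

/-- `H⁻¹(0, L)`, the dual of `H¹₀(0, L)` with the dual norm. -/
abbrev Hm1 (L : ℝ) : Type := StrongDual ℝ (H01 L)

theorem H01.memLp {L : ℝ} (f : H01 L) :
    MemLp (f : ℝ → ℝ) 2 (volume.restrict (Ioo (0 : ℝ) L)) := by
  rcases le_or_gt L 0 with hL | hL
  · rw [Ioo_eq_empty (not_lt.2 hL), Measure.restrict_empty]
    simp
  · obtain ⟨C, hC⟩ := f.2.2.1.exists_bound
    have hc : ContinuousOn (f : ℝ → ℝ) (Ioo 0 L) :=
      f.2.2.1.continuousOn.mono (by rw [uIcc_of_le hL.le]; exact Ioo_subset_Icc_self)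
    refine MemLp.of_bound (hc.aestronglyMeasurable measurableSet_Ioo) C ?_
    rw [ae_restrict_iff' measurableSet_Ioo]
    exact Eventually.of_forall fun x hx =>
      hC x (by rw [uIcc_of_le hL.le]; exact Ioo_subset_Icc_self hx)

/-- The inclusion `H¹₀(0, L) → L²(0, L)`. -/
def H01.toL2 {L : ℝ} (f : H01 L) : L2 L := f.memLp.toLp

/-! ### Finite energy solutions of the wave equation with homogeneous boundary values -/

/-- A path `t ↦ (φ(t), φ'(t))` in `H¹₀(0, 1 + k t) × L²(0, 1 + k t)`. Only the times in `[0, T]`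
matter. -/
structure EnergyPath (k : ℝ) where
  pos : ∀ t : ℝ, H01 (endpt k t)
  vel : ∀ t : ℝ, L2 (endpt k t)

/-- Two paths coincide on `[0, T]`. -/
def EnergyPath.AgreeOn {k : ℝ} (T : ℝ) (φ χ : EnergyPath k) : Prop :=
  ∀ t ∈ Icc 0 T, φ.pos t = χ.pos t ∧ φ.vel t = χ.vel t

/-- Finite energy solutions of `φ'' - φ_xx = h` in the non-cylindrical domain, `φ = 0` on the
lateral boundary: `φ ∈ C([0,T]; H¹₀(Ω_t)) ∩ C¹([0,T]; L²(Ω_t))`, where `Ω_t = (0, 1 + k t)` and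
functions on `Ω_t` are extended by zero, and the equation holds in the sense of distributions. -/
structure IsEnergySolution (k T : ℝ) (h : ℝ → ℝ → ℝ) (φ : EnergyPath k) : Prop where
  continuousOn_grad :
    ContinuousOn (fun t => extZero (H01.grad (endpt k t) (φ.pos t))) (Icc 0 T)
  continuousOn_vel : ContinuousOn (fun t => extZero (φ.vel t)) (Icc 0 T)
  hasDeriv : ∀ t ∈ Icc 0 T,
    HasDerivWithinAt (fun s => extZero (φ.pos s).toL2) (extZero (φ.vel t)) (Icc 0 T) t
  equation : ∀ η : ℝ → ℝ → ℝ, ContDiff ℝ ∞ (Function.uncurry η) →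
    HasCompactSupport (Function.uncurry η) → tsupport (Function.uncurry η) ⊆ domainQ k T →
    ∫ t in Ioo 0 T, ∫ x in Ioo 0 (endpt k t),
        φ.pos t x * (iteratedDeriv 2 (fun s => η s x) t - iteratedDeriv 2 (η t) x) =
      ∫ t in Ioo 0 T, ∫ x in Ioo 0 (endpt k t), h t x * η t x

/-- `g ∈ L²(0, T)` is the outward normal derivative at the fixed endpoint `x = 0`:
`(φ(t, 0) - φ(t, x)) / x → g` in `L²(0, T)` as `x → 0+`. The outward normal at `x = 0` is `-1`, so
`g(t) = - ∂φ/∂x (t, 0)`. -/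
def HasNormalDeriv (k T : ℝ) (φ : EnergyPath k) (g : L2 T) : Prop :=
  Tendsto (fun x : ℝ =>
      eLpNorm (fun t => (φ.pos t 0 - φ.pos t x) / x - g t) 2 (volume.restrict (Ioo (0 : ℝ) T)))
    (𝓝[>] 0) (𝓝 0)

/-! ### Solutions by transposition of the wave equation with a boundary datum in `L²` -/

/-- A path `t ↦ (u(t), u'(t))` in `L²(0, 1 + k t) × H⁻¹(0, 1 + k t)`. Only the times in `[0, T]`
matter. -/
structure TranspPath (k : ℝ) where
  pos : ∀ t : ℝ, L2 (endpt k t)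
  vel : ∀ t : ℝ, Hm1 (endpt k t)

/-- Two paths coincide on `[0, T]`. -/
def TranspPath.AgreeOn {k : ℝ} (T : ℝ) (u v : TranspPath k) : Prop :=
  ∀ t ∈ Icc 0 T, u.pos t = v.pos t ∧ u.vel t = v.vel t

/-- Solutions by transposition of `u'' - u_xx = 0` in the non-cylindrical domain with `u = w` at
`x = 0`, `u = 0` at the moving endpoint, `u(0) = u'(0) = 0`, in the class
`u ∈ C([0,T]; L²(Ω_t)) ∩ C¹([0,T]; H⁻¹(Ω_t))`. -/
structure IsTranspSolution (k T : ℝ) (w : L2 T) (u : TranspPath k) : Prop where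
  continuousOn_pos : ContinuousOn (fun t => extZero (u.pos t)) (Icc 0 T)
  /-- `u'(t)` is the time derivative of `u` at time `t`, tested on `C_c^∞(Ω_t)`. -/
  hasDeriv : ∀ t ∈ Icc 0 T, ∀ f : H01 (endpt k t), ContDiff ℝ ∞ (f : ℝ → ℝ) →
    tsupport (f : ℝ → ℝ) ⊆ Ioo 0 (endpt k t) →
    HasDerivWithinAt (fun r => ∫ x in Ioo 0 (endpt k r), u.pos r x * f x) (u.vel t f) (Icc 0 T) t
  /-- `u'` is continuous with values in `H⁻¹(Ω_t)`, where the spaces for different times are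
  compared through the dilations that map `Ω_s` onto `Ω_t`. -/
  continuousOn_vel : ∀ t ∈ Icc 0 T, ∀ ε > 0, ∃ δ > 0, ∀ s ∈ Icc 0 T, |s - t| < δ →
    ∀ (f : H01 (endpt k s)) (g : H01 (endpt k t)),
      (∀ y : ℝ, f (endpt k s * y) = g (endpt k t * y)) → |u.vel s f - u.vel t g| ≤ ε * ‖g‖
  initial_pos : u.pos 0 = 0
  initial_vel : u.vel 0 = 0
  /-- Duality with the backward problem `θ'' - θ_xx = h`, `θ = 0` on the lateral boundary,
  `θ(T) = θ'(T) = 0`. -/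
  transposition : ∀ h : ℝ → ℝ → ℝ,
    MemLp (Function.uncurry h) 2 (volume.restrict (domainQ k T)) →
    ∀ θ : EnergyPath k, IsEnergySolution k T h θ → θ.pos T = 0 → θ.vel T = 0 →
    ∀ g : L2 T, HasNormalDeriv k T θ g →
      ∫ t in Ioo 0 T, ∫ x in Ioo 0 (endpt k t), u.pos t x * h t x = - ∫ t in Ioo 0 T, w t * g t

/-! ### The hierarchical control problem -/

/-- The cost of the follower, evaluated at the state `u` and the follower control `w₂`; `z` is
the desired state. -/
def followerCost (k T σ : ℝ) (z : ℝ → ℝ → ℝ) (u : TranspPath k) (w₂ : L2 T) : ℝ :=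
  1 / 2 * (∫ t in Ioo 0 T, ∫ x in Ioo 0 (endpt k t), (u.pos t x - z t x) ^ 2) +
    σ / 2 * ∫ t in Ioo 0 T, (w₂ t) ^ 2

/-- The cost of the leader. -/
def leaderCost {T : ℝ} (w₁ : L2 T) : ℝ := 1 / 2 * ∫ t in Ioo 0 T, (w₁ t) ^ 2

/-- `w₂` is a Nash equilibrium (an optimal answer of the follower) for the leader control `w₁`, and
`u` is the resulting state, with boundary control `w₁ + w₂`. -/
def IsNash (k T σ : ℝ) (z : ℝ → ℝ → ℝ) (w₁ w₂ : L2 T) (u : TranspPath k) : Prop :=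
  IsTranspSolution k T (w₁ + w₂) u ∧
    ∀ (v₂ : L2 T) (v : TranspPath k), IsTranspSolution k T (w₁ + v₂) v →
      followerCost k T σ z u w₂ ≤ followerCost k T σ z v v₂

/-- Admissible leader controls: with the follower at equilibrium, the state at time `T` lies in the
product of the balls of centres `u₀, u₁` and radii `ρ₀, ρ₁`. -/
def Admissible (k T σ ρ₀ ρ₁ : ℝ) (z : ℝ → ℝ → ℝ) (u₀ : L2 (endpt k T)) (u₁ : Hm1 (endpt k T))
    (w₁ : L2 T) : Prop :=
  ∃ (w₂ : L2 T) (u : TranspPath k), IsNash k T σ z w₁ w₂ u ∧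
    u.pos T ∈ Metric.closedBall u₀ ρ₀ ∧ u.vel T ∈ Metric.closedBall u₁ ρ₁

/-- Optimal leader controls: admissible controls of minimal cost. -/
def IsOptimalLeader (k T σ ρ₀ ρ₁ : ℝ) (z : ℝ → ℝ → ℝ) (u₀ : L2 (endpt k T))
    (u₁ : Hm1 (endpt k T)) (w₁ : L2 T) : Prop :=
  Admissible k T σ ρ₀ ρ₁ z u₀ u₁ w₁ ∧
    ∀ v₁ : L2 T, Admissible k T σ ρ₀ ρ₁ z u₀ u₁ v₁ → leaderCost w₁ ≤ leaderCost v₁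

/-! ### The optimality system -/

/-- The unknowns `{φ, ψ, u, p}` of the optimality system, with the outward normal derivatives
`dφ, dp` of `φ, p` at `x = 0`. -/
structure Quadruple (k T : ℝ) where
  φ : EnergyPath k
  ψ : TranspPath k
  u : TranspPath k
  p : EnergyPath k
  dφ : L2 T
  dp : L2 T

/-- Two quadruples coincide on `[0, T]`. -/
def Quadruple.Agree {k T : ℝ} (S S' : Quadruple k T) : Prop :=
  S.φ.AgreeOn T S'.φ ∧ S.ψ.AgreeOn T S'.ψ ∧ S.u.AgreeOn T S'.u ∧ S.p.AgreeOn T S'.p ∧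
    S.dφ = S'.dφ ∧ S.dp = S'.dp

/-- The optimality system with final data `f⁰, f¹` for `φ`. -/
structure IsOptimalitySystem (k T σ : ℝ) (z : ℝ → ℝ → ℝ) (f₀ : H01 (endpt k T))
    (f₁ : L2 (endpt k T)) (S : Quadruple k T) : Prop where
  phi_solution : IsEnergySolution k T (fun t x => S.ψ.pos t x) S.φ
  phi_normal : HasNormalDeriv k T S.φ S.dφ
  phi_final_pos : S.φ.pos T = f₀
  phi_final_vel : S.φ.vel T = f₁
  psi_solution : IsTranspSolution k T (σ⁻¹ • S.dφ) S.ψ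
  u_solution : IsTranspSolution k T (-S.dφ + σ⁻¹ • S.dp) S.u
  p_solution : IsEnergySolution k T (fun t x => S.u.pos t x - z t x) S.p
  p_normal : HasNormalDeriv k T S.p S.dp
  p_final_pos : S.p.pos T = 0
  p_final_vel : S.p.vel T = 0

/-- The variational inequality for `{f⁰, f¹}`, where `u` is the third component of the solution of
the optimality system with data `{f⁰, f¹}`. -/
def VariationalInequality (k T ρ₀ ρ₁ : ℝ) (u₀ : L2 (endpt k T)) (u₁ : Hm1 (endpt k T))
    (f₀ : H01 (endpt k T)) (f₁ : L2 (endpt k T)) (u : TranspPath k) : Prop :=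
  ∀ (e₀ : H01 (endpt k T)) (e₁ : L2 (endpt k T)),
    0 ≤ (u.vel T - u₁) (e₀ - f₀) - inner ℝ (u.pos T - u₀) (e₁ - f₁) +
      ρ₁ * (‖e₀‖ - ‖f₀‖) + ρ₀ * (‖e₁‖ - ‖f₁‖)

end MovingWave

end

/-! Everything concrete comes from d'Alembert's formula. A displacement that vanishes at x = 0 is
half the integral over (t - x, t + x) of a Riemann invariant in the characteristic variable ξ = t ±
x. The two lateral lines meet at time -1/k, so reflection at the moving endpoint followed by
reflection at the fixed one is, in ξ, a dilation about -1/k with factor `lam k` = (1+k)/(1-k).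
Summing finitely many dilated copies of the data and of the source (`unfold`) enforces the moving
boundary condition. This produces finite energy solutions with arbitrary final data and L² source,
together with their normal derivative, which is minus the invariant on the diagonal ξ = t
(`exists_energySolution_of_force`). The adjoint operation `fold`, applied to a boundary signal,
produces the solution by transposition (`wave`), and the substitution identity `integral_fold_mul`
becomes the duality `wave_duality`. Uniqueness of finite energy solutions rests on a conserved
quantity built from the displacement and the time integral of the strain
(`IsEnergySolution.unique`); uniqueness by transposition follows by duality.

The control problem then involves only two bounded operators (`Operators`): S, from the boundary
control to the state, and D, from final data to the normal derivative of the homogeneous solution. A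
source h changes the normal derivative to D f - S† h. For the state u of a control w, the inner
product of w with D f is (u(T), f¹) - ⟨u'(T), f⁰⟩. For T ≥ 2/(1-k) the trace at x = 0 sees both
Riemann components of the data, so D is bounded below. The exponential time hypothesis enters only
to give this inequality, through e^y ≥ 1 + y.

Let M be the inverse of 1 + σ⁻¹ S†S, and A = M D. The optimality system says that ∂_ν φ = A f and
that the total control y at u satisfies y + σ⁻¹ S†S y = -∂_ν φ + σ⁻¹ S†z. The Euler equation of the
follower is the same equation with w₁ in place of -∂_ν φ, so u is the equilibrium state for the
leader control -∂_ν φ. Since M is self-adjoint, every leader control v with equilibrium state u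
satisfies ⟨u'(T) - u¹, e⁰⟩ - (u(T) - u⁰, e¹) = -(v, A e) + ℓ(e) with one fixed functional ℓ
(`exists_reduction`).

What remains is convex duality. With R(e) = ρ₁‖e⁰‖ + ρ₀|e¹|, the variational inequality
characterizes the minimizer of ½|A f|² + ℓ(f) + R(f), which exists and is unique because A is
bounded below (`existsUnique_variational`). A control v is admissible exactly when -(v, A e) + ℓ(e)
+ R(e) ≥ 0 for all e, since R is the support function of the two balls. The element of least norm of
this set is -A f (`norm_le_iff_eq_of_variational`). -/

namespace MovingWave

/-! ### Curves in `L²(ℝ)` -/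

open Classical in
/-- The class in `L²(ℝ)` of a square integrable function, and `0` for other functions. -/
noncomputable def toLR (f : ℝ → ℝ) : Lp ℝ 2 (volume : Measure ℝ) :=
  if h : MemLp f 2 volume then h.toLp f else 0

theorem toLR_of {f : ℝ → ℝ} (h : MemLp f 2 volume) : toLR f = h.toLp f := dif_pos h

theorem coeFn_toLR {f : ℝ → ℝ} (h : MemLp f 2 volume) : toLR f =ᵐ[volume] f := by
  rw [toLR_of h]; exact h.coeFn_toLp

theorem toLR_congr {f g : ℝ → ℝ} (h : f =ᵐ[volume] g) : toLR f = toLR g := by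
  by_cases hf : MemLp f 2 volume
  · rw [toLR_of hf, toLR_of (hf.ae_eq h)]
    exact (MemLp.toLp_eq_toLp_iff _ _).2 h
  · have hg : ¬ MemLp g 2 volume := fun hg => hf (hg.ae_eq h.symm)
    rw [toLR, toLR, dif_neg hf, dif_neg hg]

theorem norm_toLR_sub {f g : ℝ → ℝ} (hf : MemLp f 2 volume) (hg : MemLp g 2 volume) :
    ‖toLR f - toLR g‖ = (eLpNorm (f - g) 2 volume).toReal := by
  rw [toLR_of hf, toLR_of hg, ← MemLp.toLp_sub, Lp.norm_toLp]

/-- The curve `t ↦ m t` is continuous on `s` with values in `L²(ℝ)`. -/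
structure L2Cont {X : Type*} [TopologicalSpace X] (m : X → ℝ → ℝ) (s : Set X) : Prop where
  memLp : ∀ t ∈ s, MemLp (m t) 2 volume
  cont : ContinuousOn (fun t => toLR (m t)) s

section L2Cont
variable {X : Type*} [TopologicalSpace X] {m m' : X → ℝ → ℝ} {s : Set X}

theorem L2Cont.congr (h : L2Cont m s) (h' : ∀ t ∈ s, m' t =ᵐ[volume] m t) : L2Cont m' s :=
  ⟨fun t ht => (h.memLp t ht).ae_eq (h' t ht).symm,
    h.cont.congr fun t ht => toLR_congr (h' t ht)⟩

theorem L2Cont.mono (h : L2Cont m s) {s' : Set X} (hs : s' ⊆ s) : L2Cont m s' :=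
  ⟨fun t ht => h.memLp t (hs ht), h.cont.mono hs⟩

theorem L2Cont.add (h : L2Cont m s) (h' : L2Cont m' s) : L2Cont (fun t x => m t x + m' t x) s := by
  refine ⟨fun t ht => (h.memLp t ht).add (h'.memLp t ht), (h.cont.add h'.cont).congr fun t ht => ?_⟩
  have := (h.memLp t ht).add (h'.memLp t ht)
  simp only [Pi.add_apply]
  rw [toLR_of (h.memLp t ht), toLR_of (h'.memLp t ht), ← MemLp.toLp_add]
  exact toLR_of this

theorem L2Cont.const_mul (h : L2Cont m s) (c : ℝ) : L2Cont (fun t x => c * m t x) s := by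
  refine ⟨fun t ht => (h.memLp t ht).const_mul c, (h.cont.const_smul c).congr fun t ht => ?_⟩
  have := (h.memLp t ht).const_smul c
  simp only [Pi.smul_apply]
  rw [toLR_of (h.memLp t ht), ← MemLp.toLp_const_smul]
  exact toLR_of this

theorem L2Cont.neg (h : L2Cont m s) : L2Cont (fun t x => - m t x) s :=
  (h.const_mul (-1)).congr fun t _ => by simp

theorem L2Cont.sub (h : L2Cont m s) (h' : L2Cont m' s) : L2Cont (fun t x => m t x - m' t x) s :=
  (h.add h'.neg).congr fun t _ => by simp [sub_eq_add_neg]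

theorem L2Cont.sum {ι : Type*} (J : Finset ι) {m : ι → X → ℝ → ℝ} (h : ∀ i ∈ J, L2Cont (m i) s) :
    L2Cont (fun t x => ∑ i ∈ J, m i t x) s := by
  classical
  induction J using Finset.induction_on with
  | empty =>
    refine ⟨fun t _ => by simp, ?_⟩
    simp only [Finset.sum_empty]
    exact continuousOn_const
  | insert i J hi ih =>
    refine ((h i (by simp)).add (ih fun j hj => h j (by simp [hj]))).congr fun t _ => ?_
    simp [Finset.sum_insert hi]

theorem L2Cont.const {f : ℝ → ℝ} (hf : MemLp f 2 volume) : L2Cont (fun _ : X => f) s :=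
  ⟨fun _ _ => hf, continuousOn_const⟩

/-- Composition is jointly continuous in the L² class and in the measure preserving map, the maps
carrying the compact-open topology. Translations and reflections depending on time are the cases
needed. -/
theorem L2Cont.comp_measurePreserving (h : L2Cont m s) {g : X → C(ℝ, ℝ)} (hg : ContinuousOn g s)
    (hgm : ∀ t, MeasurePreserving (g t) volume volume) : L2Cont (fun t x => m t (g t x)) s := by
  refine ⟨fun t ht => (h.memLp t ht).comp_measurePreserving (hgm t), ?_⟩
  refine (ContinuousOn.compMeasurePreservingLp h.cont hg hgm (by simp)).congr fun t ht => ?_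
  have h1 : (Lp.compMeasurePreserving (g t) (hgm t)) (toLR (m t)) =
      toLR (fun x => m t (g t x)) := by
    rw [toLR_of (h.memLp t ht)]
    exact (toLR_of ((h.memLp t ht).comp_measurePreserving (hgm t))).symm
  exact h1.symm

theorem L2Cont.comp_add (h : L2Cont m s) {τ : X → ℝ} (hτ : Continuous τ) :
    L2Cont (fun t x => m t (τ t + x)) s :=
  h.comp_measurePreserving (g := fun t => ⟨fun x => τ t + x, by fun_prop⟩)
    ((ContinuousMap.continuous_of_continuous_uncurry _
      (by simp only [Function.uncurry_def, ContinuousMap.coe_mk]; fun_prop)).continuousOn)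
    (fun t => measurePreserving_add_left volume (τ t))

theorem L2Cont.comp_sub (h : L2Cont m s) {τ : X → ℝ} (hτ : Continuous τ) :
    L2Cont (fun t x => m t (τ t - x)) s :=
  h.comp_measurePreserving (g := fun t => ⟨fun x => τ t - x, by fun_prop⟩)
    ((ContinuousMap.continuous_of_continuous_uncurry _
      (by simp only [Function.uncurry_def, ContinuousMap.coe_mk]; fun_prop)).continuousOn)
    (fun t => Measure.measurePreserving_sub_left volume (τ t))

end L2Cont

theorem map_affine_volume {a : ℝ} (ha : a ≠ 0) (b : ℝ) :
    Measure.map (fun x : ℝ => a * x + b) volume = ENNReal.ofReal |a⁻¹| • volume := by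
  have h1 : (fun x : ℝ => a * x + b) = (fun x => x + b) ∘ (fun x => a * x) := rfl
  rw [h1, ← Measure.map_map (by fun_prop) (by fun_prop), Real.map_volume_mul_left ha,
    Measure.map_smul, map_add_right_eq_self]

theorem memLp_comp_affine {f : ℝ → ℝ} (hf : MemLp f 2 volume) {a : ℝ} (ha : a ≠ 0) (b : ℝ) :
    MemLp (fun x => f (a * x + b)) 2 volume := by
  have h1 : MemLp f 2 (Measure.map (fun x : ℝ => a * x + b) volume) := by
    rw [map_affine_volume ha]
    exact hf.smul_measure (by simp)
  exact (memLp_map_measure_iff h1.1 (by fun_prop)).1 h1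

theorem eLpNorm_comp_affine {f : ℝ → ℝ} (hf : AEStronglyMeasurable f volume) {a : ℝ} (ha : a ≠ 0)
    (b : ℝ) : eLpNorm (fun x => f (a * x + b)) 2 volume =
      ENNReal.ofReal |a⁻¹| ^ (1 / 2 : ℝ) * eLpNorm f 2 volume := by
  have h1 : AEStronglyMeasurable f (Measure.map (fun x : ℝ => a * x + b) volume) := by
    rw [map_affine_volume ha]
    exact hf.mono_ac (Measure.smul_absolutelyContinuous)
  have h2 := eLpNorm_map_measure (p := 2) h1 (by fun_prop)
  rw [map_affine_volume ha, eLpNorm_smul_measure_of_ne_top (by simp)] at h2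
  simp only [smul_eq_mul] at h2
  refine h2.symm.trans ?_
  norm_num

/-- A fixed affine map is not measure preserving, but it multiplies every L² distance by one
constant. -/
theorem L2Cont.comp_affine {X : Type*} [TopologicalSpace X] {m : X → ℝ → ℝ} {s : Set X}
    (h : L2Cont m s) {a : ℝ} (ha : a ≠ 0) (b : ℝ) : L2Cont (fun t x => m t (a * x + b)) s := by
  refine ⟨fun t ht => memLp_comp_affine (h.memLp t ht) ha b, ?_⟩
  intro t ht
  have hc := h.cont t ht
  rw [ContinuousWithinAt, tendsto_iff_norm_sub_tendsto_zero] at hc ⊢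
  have h1 : Tendsto (fun r => (ENNReal.ofReal |a⁻¹| ^ (1 / 2 : ℝ)).toReal *
      ‖toLR (m r) - toLR (m t)‖) (𝓝[s] t) (𝓝 0) := by
    simpa using hc.const_mul (ENNReal.ofReal |a⁻¹| ^ (1 / 2 : ℝ)).toReal
  refine h1.congr' ?_
  filter_upwards [self_mem_nhdsWithin] with r hr
  rw [norm_toLR_sub (h.memLp r hr) (h.memLp t ht),
    norm_toLR_sub (memLp_comp_affine (h.memLp r hr) ha b) (memLp_comp_affine (h.memLp t ht) ha b),
    ← ENNReal.toReal_mul,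
    ← eLpNorm_comp_affine ((h.memLp r hr).1.sub (h.memLp t ht).1) ha b]
  rfl

/-- Dominated convergence: the indicators converge at every point other than the two limiting
endpoints. -/
theorem tendsto_eLpNorm_indicator_sub {X : Type*} [TopologicalSpace X] [FirstCountableTopology X]
    {f : ℝ → ℝ} (hf : MemLp f 2 volume)
    {α β : X → ℝ} (hα : Continuous α) (hβ : Continuous β) (t : X) :
    Tendsto (fun r => eLpNorm ((Ioo (α r) (β r)).indicator f - (Ioo (α t) (β t)).indicator f) 2
      volume) (𝓝 t) (𝓝 0) := by
  simp_rw [eLpNorm_eq_lintegral_rpow_enorm_toReal (p := 2) (by simp) (by simp)]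
  have h0 : (0 : ℝ≥0∞) = 0 ^ (1 / (2 : ℝ≥0∞).toReal) := by simp
  rw [h0]
  refine Tendsto.ennrpow_const _ ?_
  have hz : (0 : ℝ≥0∞) = ∫⁻ x : ℝ, 0 := by simp
  rw [hz]
  refine tendsto_lintegral_filter_of_dominated_convergence'
    (fun x => ‖f x‖ₑ ^ (2 : ℝ≥0∞).toReal) ?_ ?_ ?_ ?_
  · refine Eventually.of_forall fun r => ?_
    exact (((hf.indicator measurableSet_Ioo).sub (hf.indicator measurableSet_Ioo)).1.enorm).pow_const _
  · refine Eventually.of_forall fun r => Eventually.of_forall fun x => ?_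
    refine ENNReal.rpow_le_rpow ?_ (by simp)
    by_cases h1 : x ∈ Ioo (α r) (β r) <;> by_cases h2 : x ∈ Ioo (α t) (β t) <;>
      simp [h1, h2, indicator]
  · exact (lintegral_rpow_enorm_lt_top_of_eLpNorm_lt_top (by simp) (by simp) hf.2).ne
  · have : ∀ᵐ x : ℝ, x ≠ α t ∧ x ≠ β t := by
      filter_upwards [compl_mem_ae_iff.2 (measure_singleton (μ := volume) (α t)),
        compl_mem_ae_iff.2 (measure_singleton (μ := volume) (β t))] with x h1 h2
      exact ⟨h1, h2⟩
    filter_upwards [this] with x hx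
    have hev : ∀ᶠ r in 𝓝 t, (x ∈ Ioo (α r) (β r) ↔ x ∈ Ioo (α t) (β t)) := by
      have e1 : ∀ᶠ r in 𝓝 t, (α r < x ↔ α t < x) := by
        rcases lt_or_gt_of_ne hx.1 with h | h
        · filter_upwards [hα.continuousAt.eventually (lt_mem_nhds h)] with r hr
          simp [h.le.not_gt, hr.le.not_gt]
        · filter_upwards [hα.continuousAt.eventually (gt_mem_nhds h)] with r hr
          simp [h, hr]
      have e2 : ∀ᶠ r in 𝓝 t, (x < β r ↔ x < β t) := by
        rcases lt_or_gt_of_ne hx.2 with h | h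
        · filter_upwards [hβ.continuousAt.eventually (lt_mem_nhds h)] with r hr
          simp [h, hr]
        · filter_upwards [hβ.continuousAt.eventually (gt_mem_nhds h)] with r hr
          simp [h.le.not_gt, hr.le.not_gt]
      filter_upwards [e1, e2] with r h1 h2
      simp [h1, h2]
    refine tendsto_const_nhds.congr' ?_
    filter_upwards [hev] with r hr
    by_cases h : x ∈ Ioo (α t) (β t)
    · simp [indicator, h, hr.2 h]
    · simp [indicator, h, mt hr.1 h]

/-- The difference splits into a change of the function under a fixed cut, which does not increase
the norm, and a change of the cut for the fixed function at time `t`. -/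
theorem L2Cont.indicator {X : Type*} [TopologicalSpace X] [FirstCountableTopology X]
    {m : X → ℝ → ℝ} {s : Set X} (h : L2Cont m s)
    {α β : X → ℝ} (hα : Continuous α) (hβ : Continuous β) :
    L2Cont (fun t => (Ioo (α t) (β t)).indicator (m t)) s := by
  have hm : ∀ t ∈ s, ∀ r, MemLp ((Ioo (α r) (β r)).indicator (m t)) 2 volume :=
    fun t ht r => (h.memLp t ht).indicator measurableSet_Ioo
  refine ⟨fun t ht => hm t ht t, fun t ht => ?_⟩
  have hc := h.cont t ht
  rw [ContinuousWithinAt, tendsto_iff_norm_sub_tendsto_zero] at hc ⊢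
  have h2 : Tendsto (fun r => ‖toLR ((Ioo (α r) (β r)).indicator (m t)) -
      toLR ((Ioo (α t) (β t)).indicator (m t))‖) (𝓝[s] t) (𝓝 0) := by
    have := (ENNReal.tendsto_toReal ENNReal.zero_ne_top).comp
      ((tendsto_eLpNorm_indicator_sub (h.memLp t ht) hα hβ t).mono_left
        (nhdsWithin_le_nhds (s := s)))
    refine this.congr fun r => ?_
    rw [norm_toLR_sub (hm t ht r) (hm t ht t)]; rfl
  have h3 := hc.add h2
  rw [add_zero] at h3
  refine squeeze_zero' (Eventually.of_forall fun _ => norm_nonneg _) ?_ h3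
  filter_upwards [self_mem_nhdsWithin] with r hr
  refine (norm_sub_le_norm_sub_add_norm_sub _ (toLR ((Ioo (α r) (β r)).indicator (m t))) _).trans ?_
  refine add_le_add_left ?_ _
  rw [norm_toLR_sub (hm r hr r) (hm t ht r), norm_toLR_sub (h.memLp r hr) (h.memLp t ht),
    ← indicator_sub']
  exact ENNReal.toReal_mono ((h.memLp r hr).sub (h.memLp t ht)).2.ne (eLpNorm_indicator_le _)

/-- Two classes in `L²(0, L)` with the same extension by zero coincide. -/
theorem extZero_eq_toLR {L : ℝ} (f : L2 L) : extZero f = toLR ((Ioo 0 L).indicator f) :=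
  (toLR_of _).symm

theorem coeFn_extZero {L : ℝ} (f : L2 L) : extZero f =ᵐ[volume] (Ioo 0 L).indicator f :=
  MemLp.coeFn_toLp _

theorem memLp_indicator {L : ℝ} (f : L2 L) : MemLp ((Ioo 0 L).indicator f) 2 volume :=
  (memLp_indicator_iff_restrict measurableSet_Ioo).2 (Lp.memLp f)

theorem extZero_injective {L : ℝ} : Function.Injective (extZero (L := L)) := by
  intro f g h
  apply Lp.ext
  have h1 := (coeFn_extZero f).symm.trans ((by rw [h]) : _ =ᵐ[volume] (extZero g : ℝ → ℝ))
  have h2 := h1.trans (coeFn_extZero g)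
  rw [EventuallyEq, ae_restrict_iff' measurableSet_Ioo]
  filter_upwards [h2] with x hx hxL
  simpa [hxL] using hx

theorem extZero_eq_of {L : ℝ} {f : L2 L} {g : ℝ → ℝ}
    (h : f =ᵐ[volume.restrict (Ioo 0 L)] g) : extZero f = toLR ((Ioo 0 L).indicator g) := by
  rw [extZero_eq_toLR]
  refine toLR_congr ?_
  rw [EventuallyEq, ae_restrict_iff' measurableSet_Ioo] at h
  filter_upwards [h] with x hx
  by_cases hxL : x ∈ Ioo 0 L
  · simp [hxL, hx hxL]
  · simp [hxL]

end MovingWave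

/-! ### Primitives in H¹₀, the Cauchy-Schwarz inequality, and Riemann invariants with a source. -/

namespace MovingWave

theorem AC_congr {f g : ℝ → ℝ} {a b : ℝ} (hf : AbsolutelyContinuousOnInterval f a b)
    (h : EqOn g f (uIcc a b)) : AbsolutelyContinuousOnInterval g a b := by
  rw [absolutelyContinuousOnInterval_iff] at hf ⊢
  intro ε hε
  obtain ⟨δ, hδ, H⟩ := hf ε hε
  refine ⟨δ, hδ, fun E hE hlt => ?_⟩
  refine lt_of_eq_of_lt (Finset.sum_congr rfl fun i hi => ?_) (H E hE hlt)
  have := (hE.1 i hi)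
  rw [h this.1, h this.2]

theorem intervalIntegrable_of_memLp {g : ℝ → ℝ} {L : ℝ} (hL : 0 ≤ L)
    (hg : MemLp g 2 (volume.restrict (Ioo 0 L))) : IntervalIntegrable g volume 0 L := by
  rw [intervalIntegrable_iff_integrableOn_Ioo_of_le hL]
  exact hg.integrable (by norm_num)

/-- Primitives of square integrable functions with mean zero belong to `H¹₀(0, L)`. -/
theorem exists_H01_primitive {L : ℝ} (hL : 0 < L) {g : ℝ → ℝ}
    (hg : MemLp g 2 (volume.restrict (Ioo 0 L))) (h0 : ∫ x in (0 : ℝ)..L, g x = 0) :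
    ∃ f : H01 L, (∀ x ∈ Icc 0 L, f x = ∫ y in (0 : ℝ)..x, g y) ∧ H01.grad L f = hg.toLp := by
  classical
  have hgi := intervalIntegrable_of_memLp hL.le hg
  -- Elements of `H01` are zero off the open interval by definition. The mean-zero hypothesis makes
  -- this agree with the primitive at the endpoint `L`.
  set F : ℝ → ℝ := fun x => if x ∈ Ioo 0 L then ∫ y in (0 : ℝ)..x, g y else 0 with hF
  have hFe : EqOn F (fun x => ∫ y in (0 : ℝ)..x, g y) (Icc 0 L) := by
    intro x hx
    by_cases hx' : x ∈ Ioo 0 L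
    · simp only [hF, if_pos hx']
    · simp only [hF, if_neg hx']
      rcases eq_or_lt_of_le hx.1 with h | h
      · simp [← h]
      · have : x = L := by
          by_contra hne
          exact hx' ⟨h, lt_of_le_of_ne hx.2 hne⟩
        rw [this, h0]
  have hac : AbsolutelyContinuousOnInterval F 0 L :=
    AC_congr (hgi.absolutelyContinuousOnInterval_intervalIntegral left_mem_uIcc)
      (by rwa [uIcc_of_le hL.le])
  have hd : deriv F =ᵐ[volume.restrict (Ioo 0 L)] g := by
    rw [EventuallyEq, ae_restrict_iff' measurableSet_Ioo]
    filter_upwards [hgi.ae_hasDerivAt_integral] with x hx hxL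
    have h1 := hx (by rw [uIcc_of_le hL.le]; exact Ioo_subset_Icc_self hxL) 0 left_mem_uIcc
    refine (h1.congr_of_eventuallyEq ?_).deriv
    filter_upwards [isOpen_Ioo.mem_nhds hxL] with y hy
    exact hFe (Ioo_subset_Icc_self hy)
  refine ⟨⟨F, fun x hx => by simp only [hF, if_neg hx], hac, hg.ae_eq hd.symm⟩, hFe, ?_⟩
  have hF2 : MemLp (deriv F) 2 (volume.restrict (Ioo 0 L)) := hg.ae_eq hd.symm
  show hF2.toLp = hg.toLp
  exact (MemLp.toLp_eq_toLp_iff _ _).2 hd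

theorem H01.eq_integral {L : ℝ} (hL : 0 ≤ L) (f : H01 L) {x : ℝ} (hx : x ∈ Icc 0 L) :
    f x = ∫ y in (0 : ℝ)..x, deriv (f : ℝ → ℝ) y := by
  have hac := f.2.2.1.mono (c := 0) (d := x)
    (by rw [uIcc_of_le hL, uIcc_of_le hx.1]; exact Icc_subset_Icc_right hx.2)
  have h00 : f.1 0 = 0 := f.2.1 0 (by simp)
  rw [hac.integral_deriv_eq_sub]
  show f.1 x = f.1 x - f.1 0
  rw [h00, sub_zero]

theorem H01.coeFn_grad {L : ℝ} (f : H01 L) :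
    H01.grad L f =ᵐ[volume.restrict (Ioo 0 L)] deriv (f : ℝ → ℝ) :=
  MemLp.coeFn_toLp f.2.2.2

theorem H01.norm_eq {L : ℝ} (f : H01 L) : ‖f‖ = ‖H01.grad L f‖ := rfl

theorem H01.integral_grad {L : ℝ} (hL : 0 ≤ L) (f : H01 L) :
    ∫ y in (0 : ℝ)..L, H01.grad L f y = 0 := by
  have h1 := f.eq_integral hL (right_mem_Icc.2 hL)
  have h2 : f.1 L = 0 := f.2.1 L (by simp)
  rw [intervalIntegral.integral_of_le hL, integral_Ioc_eq_integral_Ioo] at h1 ⊢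
  rw [integral_congr_ae f.coeFn_grad, ← h1]
  exact h2

theorem eLpNorm_two_sq {α : Type*} [MeasurableSpace α] {μ : Measure α} (f : α → ℝ) :
    eLpNorm f 2 μ ^ 2 = ∫⁻ x, ‖f x‖ₑ ^ 2 ∂μ := by
  have := eLpNorm_nnreal_pow_eq_lintegral (μ := μ) (f := f) (p := 2) (by norm_num)
  simpa using this

theorem memLp_two_iff {α : Type*} [MeasurableSpace α] {μ : Measure α} {f : α → ℝ}
    (hf : AEStronglyMeasurable f μ) : MemLp f 2 μ ↔ ∫⁻ x, ‖f x‖ₑ ^ 2 ∂μ < ⊤ := by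
  rw [← eLpNorm_two_sq]
  simp [MemLp, hf]

/-- The Cauchy-Schwarz inequality. -/
theorem enorm_integral_sq_le {α : Type*} [MeasurableSpace α] {μ : Measure α} {f : α → ℝ}
    (hf : AEStronglyMeasurable f μ) :
    ‖∫ x, f x ∂μ‖ₑ ^ 2 ≤ μ univ * ∫⁻ x, ‖f x‖ₑ ^ 2 ∂μ := by
  have h1 := eLpNorm_le_eLpNorm_mul_rpow_measure_univ (μ := μ) (p := 1) (q := 2) (by norm_num) hf
  rw [eLpNorm_one_eq_lintegral_enorm] at h1
  have h2 := (enorm_integral_le_lintegral_enorm f).trans h1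
  calc ‖∫ x, f x ∂μ‖ₑ ^ 2
      ≤ (eLpNorm f 2 μ * μ univ ^ (1 / (1 : ℝ≥0∞).toReal - 1 / (2 : ℝ≥0∞).toReal)) ^ 2 := by
        gcongr
    _ = μ univ * ∫⁻ x, ‖f x‖ₑ ^ 2 ∂μ := by
        rw [mul_pow, eLpNorm_two_sq, ← ENNReal.rpow_mul_natCast]
        norm_num [mul_comm]

theorem ae_slice_integrable {H : ℝ × ℝ → ℝ} (hi : Integrable H volume) :
    ∀ᵐ ξ : ℝ, Integrable (fun s => H (s, ξ)) volume :=
  hi.prod_left_ae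

/-- The time integral of a square integrable source over a set of times. -/
theorem lintegral_sq_integral_slice_le {H : ℝ × ℝ → ℝ} (hm : StronglyMeasurable H) (A : Set ℝ) :
    ∫⁻ ξ : ℝ, ‖∫ s in A, H (s, ξ)‖ₑ ^ 2 ≤
      volume A * ∫⁻ z : ℝ × ℝ, ‖H z‖ₑ ^ 2 := by
  calc ∫⁻ ξ : ℝ, ‖∫ s in A, H (s, ξ)‖ₑ ^ 2
      ≤ ∫⁻ ξ : ℝ, volume A * ∫⁻ s, ‖H (s, ξ)‖ₑ ^ 2 := by
        refine lintegral_mono fun ξ => ?_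
        have hs : StronglyMeasurable fun s => H (s, ξ) :=
          hm.comp_measurable measurable_prodMk_right
        refine (enorm_integral_sq_le hs.aestronglyMeasurable).trans ?_
        rw [Measure.restrict_apply_univ]
        gcongr
        exact Measure.restrict_le_self
    _ = _ := by
        have hme : Measurable fun z : ℝ × ℝ => ‖H z‖ₑ ^ 2 := (hm.enorm).pow_const 2
        rw [lintegral_const_mul _ (Measurable.lintegral_prod_left' hme), Measure.volume_eq_prod,
          lintegral_prod_symm _ hme.aemeasurable]

/-- The Riemann invariant generated by final data `g₀` and a source `H`. -/
noncomputable def gam (g₀ : ℝ → ℝ) (H : ℝ × ℝ → ℝ) (t ξ : ℝ) : ℝ :=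
  g₀ ξ - ∫ s in Ioi t, H (s, ξ)

/-- Square integrable final data and source of a Riemann invariant. -/
structure Source (T : ℝ) (g₀ : ℝ → ℝ) (H : ℝ × ℝ → ℝ) : Prop where
  meas₀ : StronglyMeasurable g₀
  memLp₀ : MemLp g₀ 2 volume
  int₀ : Integrable g₀ volume
  meas : StronglyMeasurable H
  memLp : MemLp H 2 volume
  int : Integrable H volume
  supp : ∀ s, s ∉ Ioo 0 T → ∀ ξ, H (s, ξ) = 0

variable {T : ℝ} {g₀ : ℝ → ℝ} {H : ℝ × ℝ → ℝ}

/-- Trades the half-line for a set of finite measure, as the Cauchy-Schwarz bound in time requires.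
-/
theorem Source.setIntegral_eq (hS : Source T g₀ H) (t ξ : ℝ) :
    ∫ s in Ioi t, H (s, ξ) = ∫ s in Ioi t ∩ Ioo 0 T, H (s, ξ) := by
  refine setIntegral_eq_of_subset_of_forall_sdiff_eq_zero measurableSet_Ioi inter_subset_left ?_
  intro s hs
  exact hS.supp s (fun h => hs.2 ⟨hs.1, h⟩) ξ

theorem Source.stronglyMeasurable_slice (hS : Source T g₀ H) (A : Set ℝ) :
    StronglyMeasurable fun ξ => ∫ s in A, H (s, ξ) :=
  hS.meas.integral_prod_left'

theorem Source.memLp_slice (hS : Source T g₀ H) {A : Set ℝ} (hA : volume A ≠ ⊤) :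
    MemLp (fun ξ => ∫ s in A, H (s, ξ)) 2 volume := by
  rw [memLp_two_iff (hS.stronglyMeasurable_slice A).aestronglyMeasurable]
  refine (lintegral_sq_integral_slice_le hS.meas A).trans_lt ?_
  exact ENNReal.mul_lt_top hA.lt_top ((memLp_two_iff hS.memLp.1).1 hS.memLp)

theorem Source.memLp_gam (hS : Source T g₀ H) (t : ℝ) : MemLp (gam g₀ H t) 2 volume := by
  refine hS.memLp₀.sub ?_
  simp_rw [hS.setIntegral_eq t]
  refine hS.memLp_slice (ne_top_of_le_ne_top ?_ (measure_mono inter_subset_right))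
  simp

theorem Source.integrable_gam (hS : Source T g₀ H) (t : ℝ) : Integrable (gam g₀ H t) volume := by
  refine hS.int₀.sub ?_
  have : Integrable H ((volume.restrict (Ioi t)).prod volume) := by
    rw [← Measure.restrict_univ (μ := (volume : Measure ℝ)), Measure.prod_restrict,
      Measure.restrict_univ]
    exact Integrable.mono_measure hS.int Measure.restrict_le_self
  exact this.integral_prod_right

theorem Source.stronglyMeasurable_gam (hS : Source T g₀ H) :
    StronglyMeasurable (Function.uncurry (gam g₀ H)) := by
  refine (hS.meas₀.comp_measurable measurable_snd).sub ?_
  have h1 : ∀ z : ℝ × ℝ, ∫ s in Ioi z.1, H (s, z.2) =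
      ∫ s, (Ioi z.1).indicator (fun s => H (s, z.2)) s := fun z =>
    (integral_indicator measurableSet_Ioi).symm
  simp_rw [h1]
  refine StronglyMeasurable.integral_prod_right' (f := fun q : (ℝ × ℝ) × ℝ =>
    (Ioi q.1.1).indicator (fun s => H (s, q.1.2)) q.2) ?_
  have h2 : (fun q : (ℝ × ℝ) × ℝ => (Ioi q.1.1).indicator (fun s => H (s, q.1.2)) q.2) =
      {q : (ℝ × ℝ) × ℝ | q.1.1 < q.2}.indicator (fun q => H (q.2, q.1.2)) := by
    ext q; simp [indicator]
  rw [h2]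
  exact (hS.meas.comp_measurable (by fun_prop)).indicator
    (measurableSet_lt (by fun_prop) (by fun_prop))

theorem Source.gam_sub_ae (hS : Source T g₀ H) {t r : ℝ} (htr : t ≤ r) :
    (fun ξ => gam g₀ H r ξ - gam g₀ H t ξ) =ᵐ[volume] fun ξ => ∫ s in Ioc t r, H (s, ξ) := by
  filter_upwards [ae_slice_integrable hS.int] with ξ hξ
  have := setIntegral_union (μ := volume) (f := fun s => H (s, ξ)) (s := Ioc t r) (t := Ioi r)
    (Set.disjoint_left.2 fun x hx hx' => (not_lt.2 hx.2 hx').elim) measurableSet_Ioi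
    hξ.integrableOn hξ.integrableOn
  rw [Ioc_union_Ioi_eq_Ioi htr] at this
  simp only [gam, this]
  ring

/-- Cauchy-Schwarz over the times between `t` and `r`: the invariant is Hölder continuous of
exponent 1/2 in time with values in L². -/
theorem Source.norm_gam_sub_sq_le (hS : Source T g₀ H) {t r : ℝ} (htr : t ≤ r) :
    ‖toLR (gam g₀ H r) - toLR (gam g₀ H t)‖ ^ 2 ≤
      (r - t) * (∫⁻ z : ℝ × ℝ, ‖H z‖ₑ ^ 2).toReal := by
  rw [norm_toLR_sub (hS.memLp_gam r) (hS.memLp_gam t), ← ENNReal.toReal_pow, eLpNorm_two_sq]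
  have h1 : ∫⁻ ξ, ‖(gam g₀ H r - gam g₀ H t) ξ‖ₑ ^ 2 = ∫⁻ ξ : ℝ, ‖∫ s in Ioc t r, H (s, ξ)‖ₑ ^ 2 := by
    refine lintegral_congr_ae ?_
    filter_upwards [hS.gam_sub_ae htr] with ξ hξ
    rw [Pi.sub_apply, hξ]
  rw [h1]
  have h2 := lintegral_sq_integral_slice_le hS.meas (Ioc t r)
  have h3 : (volume (Ioc t r) * ∫⁻ z : ℝ × ℝ, ‖H z‖ₑ ^ 2) ≠ ⊤ :=
    (ENNReal.mul_lt_top (by simp) ((memLp_two_iff hS.memLp.1).1 hS.memLp)).ne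
  refine (ENNReal.toReal_mono h3 h2).trans ?_
  rw [ENNReal.toReal_mul, Real.volume_Ioc, ENNReal.toReal_ofReal (sub_nonneg.2 htr)]

theorem Source.l2Cont_gam (hS : Source T g₀ H) (s : Set ℝ) : L2Cont (gam g₀ H) s := by
  refine ⟨fun t _ => hS.memLp_gam t, Continuous.continuousOn ?_⟩
  rw [continuous_iff_continuousAt]
  intro t
  rw [ContinuousAt, tendsto_iff_norm_sub_tendsto_zero]
  set C := (∫⁻ z : ℝ × ℝ, ‖H z‖ₑ ^ 2).toReal
  have hb : ∀ r, ‖toLR (gam g₀ H r) - toLR (gam g₀ H t)‖ ≤ √(|r - t| * C) := by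
    intro r
    refine Real.le_sqrt_of_sq_le ?_
    rcases le_total t r with h | h
    · rw [abs_of_nonneg (sub_nonneg.2 h)]
      exact hS.norm_gam_sub_sq_le h
    · rw [abs_of_nonpos (sub_nonpos.2 h), norm_sub_rev, neg_sub]
      exact hS.norm_gam_sub_sq_le h
  refine squeeze_zero (fun _ => norm_nonneg _) hb ?_
  have : Continuous fun r : ℝ => √(|r - t| * C) := by fun_prop
  simpa using this.tendsto t

end MovingWave

/-! ### Displacement, velocity and strain of a Riemann invariant. -/

namespace MovingWave

theorem integral_swap_sets {F : ℝ × ℝ → ℝ} (hF : Integrable F volume) (A B : Set ℝ) :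
    ∫ x in A, ∫ y in B, F (x, y) = ∫ y in B, ∫ x in A, F (x, y) := by
  refine integral_integral_swap (f := fun x y => F (x, y)) ?_
  rw [Measure.prod_restrict]
  exact hF.restrict

theorem integrable_prod_sets {F : ℝ × ℝ → ℝ} (hF : Integrable F volume) (A B : Set ℝ) :
    Integrable F ((volume.restrict A).prod (volume.restrict B)) := by
  rw [Measure.prod_restrict]
  exact hF.restrict

theorem measurePreserving_swap_shift (c : ℝ) :
    MeasurePreserving (fun z : ℝ × ℝ => (z.2, z.1 + c)) volume volume := by
  have h1 : MeasurePreserving (Prod.map id (fun y : ℝ => y + c)) (volume : Measure (ℝ × ℝ))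
      volume := by
    rw [Measure.volume_eq_prod]
    exact (MeasurePreserving.id volume).prod (measurePreserving_add_right volume c)
  have h2 : MeasurePreserving (Prod.swap : ℝ × ℝ → ℝ × ℝ) volume volume :=
    Measure.measurePreserving_swap
  exact h1.comp h2

/-- The displacement, velocity and strain given by a Riemann invariant. -/
noncomputable def posF (g₀ : ℝ → ℝ) (H : ℝ × ℝ → ℝ) (t x : ℝ) : ℝ :=
  1 / 2 * ∫ ξ in (t - x)..(t + x), gam g₀ H t ξ

/-- Differentiating `posF` in time also produces half the integral of `H (t, ·)` over (t - x, t +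
x). That term is absent here because it vanishes for a source odd about `ξ = t`. -/
noncomputable def velF (g₀ : ℝ → ℝ) (H : ℝ × ℝ → ℝ) (t x : ℝ) : ℝ :=
  1 / 2 * (gam g₀ H t (t + x) - gam g₀ H t (t - x))

noncomputable def gradF (g₀ : ℝ → ℝ) (H : ℝ × ℝ → ℝ) (t x : ℝ) : ℝ :=
  1 / 2 * (gam g₀ H t (t + x) + gam g₀ H t (t - x))

/-- A source that is odd about the fixed endpoint and generates displacements that vanish at the
moving endpoint. -/
structure Reflected (k T : ℝ) (g₀ : ℝ → ℝ) (H : ℝ × ℝ → ℝ) : Prop extends Source T g₀ H where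
  odd : ∀ t ∈ Ioo 0 T, ∀ x ∈ Ioo 0 (endpt k t), H (t, t - x) = - H (t, t + x)
  mean : ∀ t ∈ Icc 0 T, ∫ ξ in (t - endpt k t)..(t + endpt k t), gam g₀ H t ξ = 0

variable {k T : ℝ} {g₀ : ℝ → ℝ} {H : ℝ × ℝ → ℝ}

theorem integral_gradF (hS : Source T g₀ H) (t x : ℝ) :
    ∫ y in (0 : ℝ)..x, gradF g₀ H t y = posF g₀ H t x := by
  have hi := hS.integrable_gam t
  simp only [gradF, posF]
  rw [intervalIntegral.integral_const_mul, intervalIntegral.integral_add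
    ((hi.comp_add_left t).intervalIntegrable) ((hi.comp_sub_left t).intervalIntegrable),
    intervalIntegral.integral_comp_add_left, intervalIntegral.integral_comp_sub_left]
  simp only [add_zero, sub_zero]
  rw [add_comm (∫ ξ in t..(t + x), gam g₀ H t ξ),
    intervalIntegral.integral_add_adjacent_intervals hi.intervalIntegrable hi.intervalIntegrable]

/-- Integrals of the source over a symmetric interval vanish. -/
theorem Reflected.integral_eq_zero (hR : Reflected k T g₀ H) {r x : ℝ} (hr : r ∈ Ioo 0 T)
    (hx : 0 ≤ x) (hxL : x ≤ endpt k r) (hi : Integrable fun ξ => H (r, ξ)) :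
    ∫ ξ in (r - x)..(r + x), H (r, ξ) = 0 := by
  rw [← intervalIntegral.integral_add_adjacent_intervals (b := r) hi.intervalIntegrable
    hi.intervalIntegrable]
  have h1 := intervalIntegral.integral_comp_sub_left (a := 0) (b := x) (fun ξ => H (r, ξ)) r
  have h2 := intervalIntegral.integral_comp_add_left (a := 0) (b := x) (fun ξ => H (r, ξ)) r
  simp only [sub_zero, add_zero] at h1 h2
  rw [← h1, ← h2, ← intervalIntegral.integral_add (hi.comp_sub_left r).intervalIntegrable
    (hi.comp_add_left r).intervalIntegrable, intervalIntegral.integral_of_le hx,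
    integral_Ioc_eq_integral_Ioo]
  refine integral_eq_zero_of_ae ?_
  rw [EventuallyEq, ae_restrict_iff' measurableSet_Ioo]
  refine Eventually.of_forall fun y hy => ?_
  simp only [hR.odd r hr y ⟨hy.1, hy.2.trans_le hxL⟩, Pi.zero_apply, neg_add_cancel]

theorem Source.integral_gam_interval (hS : Source T g₀ H) (t : ℝ) {a b : ℝ} (hab : a ≤ b) :
    ∫ ξ in a..b, gam g₀ H t ξ =
      (∫ ξ in a..b, g₀ ξ) - ∫ s in Ioi t, ∫ ξ in a..b, H (s, ξ) := by
  have h1 : Integrable (fun ξ => ∫ s in Ioi t, H (s, ξ)) volume := by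
    have := (integrable_prod_sets hS.int (Ioi t) univ).integral_prod_right
    rwa [Measure.restrict_univ] at this
  simp only [gam]
  rw [intervalIntegral.integral_sub hS.int₀.intervalIntegrable h1.intervalIntegrable]
  simp_rw [intervalIntegral.integral_of_le hab]
  rw [integral_swap_sets hS.int (Ioi t) (Ioc a b)]

/-- The source at time `r` seen along the characteristic through `s`, cut to `s < r`, so that Fubini
applies to the iterated time integrals of the invariant. -/
theorem Source.integrable_sheared (hS : Source T g₀ H) (c : ℝ) :
    Integrable (fun z : ℝ × ℝ => (Ioi z.1).indicator (fun r => H (r, z.1 + c)) z.2) volume := by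
  have h1 := (measurePreserving_swap_shift c).integrable_comp_of_integrable hS.int
  have h2 := h1.indicator (measurableSet_lt measurable_fst measurable_snd)
  refine h2.congr (Eventually.of_forall fun z => ?_)
  simp [indicator]

/-- Time integrals of the source along a characteristic. -/
theorem Source.integral_characteristic (hS : Source T g₀ H) {t t' : ℝ} (htt : t ≤ t') (c : ℝ) :
    (∫ s in t..t', ∫ r in Ioi s, H (r, s + c)) =
      ∫ r in Ioi t, ∫ ξ in (t + c)..(min r t' + c), H (r, ξ) := by
  have hF := hS.integrable_sheared c
  have h1 : ∀ s, ∫ r in Ioi s, H (r, s + c) =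
      ∫ r, (Ioi s).indicator (fun r => H (r, s + c)) r := fun s =>
    (integral_indicator measurableSet_Ioi).symm
  rw [intervalIntegral.integral_of_le htt]
  simp_rw [h1]
  have h2 := integral_swap_sets hF (Ioc t t') univ
  simp only [Measure.restrict_univ] at h2
  -- For a fixed source time `r` the constraint `s < r` leaves the range `(t, min r t')` for `s`.
  rw [h2, ← integral_indicator measurableSet_Ioi]
  congr 1
  ext r
  have h3 : ∀ s, (Ioi s).indicator (fun r => H (r, s + c)) r =
      (Iio r).indicator (fun s => H (r, s + c)) s := fun s => by simp [indicator]
  simp_rw [h3]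
  rw [setIntegral_indicator measurableSet_Iio]
  by_cases hr : t < r
  · rw [indicator_of_mem (show r ∈ Ioi t from hr)]
    rw [← intervalIntegral.integral_comp_add_right (fun ξ => H (r, ξ)),
      intervalIntegral.integral_of_le (le_min hr.le htt)]
    refine setIntegral_congr_set ?_
    have h4 : Ioc t (min r t') = Ioc t t' ∩ Iic r := by
      ext s; simp only [mem_Ioc, le_min_iff, mem_inter_iff, mem_Iic]; tauto
    rw [h4]
    exact (Filter.EventuallyEq.refl _ _).inter Iio_ae_eq_Iic
  · rw [indicator_of_notMem (show r ∉ Ioi t from hr)]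
    have : Ioc t t' ∩ Iio r = ∅ := by
      ext s; simp only [mem_inter_iff, mem_Ioc, mem_Iio, mem_empty_iff_false, iff_false]
      rintro ⟨h, h'⟩; exact hr (h.1.trans h')
    rw [this]; simp

theorem Source.integrable_characteristic (hS : Source T g₀ H) {t t' : ℝ} (htt : t ≤ t') (c : ℝ) :
    IntegrableOn (fun r => ∫ ξ in (t + c)..(min r t' + c), H (r, ξ)) (Ioi t) := by
  have hF := (integrable_prod_sets (hS.integrable_sheared c) (Ioc t t') (Ioi t)).integral_prod_right
  refine hF.congr ?_
  rw [EventuallyEq, ae_restrict_iff' measurableSet_Ioi]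
  refine Eventually.of_forall fun r hr => ?_
  have h3 : ∀ s, (Ioi s).indicator (fun r => H (r, s + c)) r =
      (Iio r).indicator (fun s => H (r, s + c)) s := fun s => by simp [indicator]
  simp_rw [h3]
  rw [setIntegral_indicator measurableSet_Iio]
  rw [← intervalIntegral.integral_comp_add_right (fun ξ => H (r, ξ)),
    intervalIntegral.integral_of_le (le_min (le_of_lt hr) htt)]
  refine setIntegral_congr_set ?_
  have h4 : Ioc t (min r t') = Ioc t t' ∩ Iic r := by
    ext s; simp only [mem_Ioc, le_min_iff, mem_inter_iff, mem_Iic]; tauto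
  rw [h4]
  exact (Filter.EventuallyEq.refl _ _).inter Iio_ae_eq_Iic

theorem Source.intervalIntegrable_gam_characteristic (hS : Source T g₀ H) {t t' : ℝ}
    (htt : t ≤ t') (c : ℝ) :
    IntervalIntegrable (fun s => ∫ r in Ioi s, H (r, s + c)) volume t t' := by
  rw [intervalIntegrable_iff_integrableOn_Ioc_of_le htt]
  have hF := (integrable_prod_sets (hS.integrable_sheared c) (Ioc t t') univ).integral_prod_left
  refine hF.congr (Eventually.of_forall fun s => ?_)
  simp only [Measure.restrict_univ]
  exact integral_indicator measurableSet_Ioi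

theorem Source.intervalIntegrable_velF (hS : Source T g₀ H) {t t' : ℝ} (htt : t ≤ t') (x : ℝ) :
    IntervalIntegrable (fun s => velF g₀ H s x) volume t t' := by
  have h : ∀ c, IntervalIntegrable (fun s => gam g₀ H s (s + c)) volume t t' := fun c =>
    ((hS.int₀.comp_add_right c).intervalIntegrable).sub
      (hS.intervalIntegrable_gam_characteristic htt c)
  have := ((h x).sub (h (-x))).const_mul (1 / 2)
  simpa only [velF, sub_eq_add_neg] using this

/-- The displacement is the time integral of the velocity. -/
theorem Reflected.posF_sub (hR : Reflected k T g₀ H) (hk : 0 ≤ k) {t t' x : ℝ}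
    (htt : t ≤ t') (hx : 0 ≤ x) (hxL : x ≤ endpt k t) :
    posF g₀ H t' x - posF g₀ H t x = ∫ s in t..t', velF g₀ H s x := by
  have hS := hR.toSource
  have hi := hS.int₀
  have hc := fun c => hS.intervalIntegrable_gam_characteristic htt c
  have hv : ∫ s in t..t', velF g₀ H s x = 1 / 2 * (((∫ s in t..t', g₀ (s + x)) -
      ∫ s in t..t', ∫ r in Ioi s, H (r, s + x)) - ((∫ s in t..t', g₀ (s + -x)) -
      ∫ s in t..t', ∫ r in Ioi s, H (r, s + -x))) := by
    have hg := fun c => (hi.comp_add_right c).intervalIntegrable (a := t) (b := t')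
    rw [← intervalIntegral.integral_sub (hg x) (hc x),
      ← intervalIntegral.integral_sub (hg (-x)) (hc (-x)),
      ← intervalIntegral.integral_sub ((hg x).sub (hc x)) ((hg (-x)).sub (hc (-x))),
      ← intervalIntegral.integral_const_mul]
    simp only [velF, gam, sub_eq_add_neg]
  rw [hv, hS.integral_characteristic htt, hS.integral_characteristic htt,
    intervalIntegral.integral_comp_add_right, intervalIntegral.integral_comp_add_right]
  have hI : ∀ᵐ r : ℝ, Integrable fun ξ => H (r, ξ) := hS.int.prod_right_ae
  have hA := hS.integrable_characteristic htt x
  have hB := hS.integrable_characteristic htt (-x)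
  have hQ : ∀ c, IntegrableOn (fun r => ∫ ξ in (c - x)..(c + x), H (r, ξ)) (Ioi t) := by
    intro c
    have := (integrable_prod_sets hS.int (Ioi t) (Ioc (c - x) (c + x))).integral_prod_left
    simpa only [intervalIntegral.integral_of_le (show c - x ≤ c + x by linarith), IntegrableOn]
      using this
  -- For each source time `r` the three inner intervals combine to one centred at `min r t'`. If `r
  -- ≤ t'` the centre is `r` and oddness of the source makes the integral vanish; if `r > t'` the
  -- interval about `t'` remains.
  have hkey : (∫ r in Ioi t, ∫ ξ in (t + x)..(min r t' + x), H (r, ξ)) -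
      (∫ r in Ioi t, ∫ ξ in (t + -x)..(min r t' + -x), H (r, ξ)) +
      (∫ r in Ioi t, ∫ ξ in (t - x)..(t + x), H (r, ξ)) =
      ∫ r in Ioi t', ∫ ξ in (t' - x)..(t' + x), H (r, ξ) := by
    have hAB : IntegrableOn (fun r => (∫ ξ in (t + x)..(min r t' + x), H (r, ξ)) -
      ∫ ξ in (t + -x)..(min r t' + -x), H (r, ξ)) (Ioi t) := hA.sub hB
    rw [← integral_sub hA hB, ← integral_add hAB (hQ t)]
    have e0 : ∫ r in Ioi t', ∫ ξ in (t' - x)..(t' + x), H (r, ξ) = ∫ r in Ioi t,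
        (Ioi t').indicator (fun r => ∫ ξ in (t' - x)..(t' + x), H (r, ξ)) r := by
      rw [setIntegral_indicator measurableSet_Ioi,
        inter_eq_self_of_subset_right (Ioi_subset_Ioi htt)]
    rw [e0]
    · refine integral_congr_ae ?_
      filter_upwards [ae_restrict_of_ae hI, ae_restrict_mem measurableSet_Ioi] with r hr hrt
      have hii : ∀ a b, IntervalIntegrable (fun ξ => H (r, ξ)) volume a b := fun a b =>
        hr.intervalIntegrable
      have e1 : (∫ ξ in (t + x)..(min r t' + x), H (r, ξ)) -
          (∫ ξ in (t + -x)..(min r t' + -x), H (r, ξ)) + (∫ ξ in (t - x)..(t + x), H (r, ξ)) =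
          ∫ ξ in (min r t' - x)..(min r t' + x), H (r, ξ) := by
        have a1 := intervalIntegral.integral_add_adjacent_intervals (hii (t - x) (t + x))
          (hii (t + x) (min r t' + x))
        have a2 := intervalIntegral.integral_add_adjacent_intervals (hii (t - x) (min r t' - x))
          (hii (min r t' - x) (min r t' + x))
        simp only [← sub_eq_add_neg]
        linarith
      rw [e1]
      rcases le_or_gt r t' with h | h
      · rw [indicator_of_notMem (by simpa using h), min_eq_left h]
        by_cases hrT : r ∈ Ioo 0 T
        · refine hR.integral_eq_zero hrT hx (hxL.trans ?_) hr
          have : t < r := hrt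
          simp only [endpt]; nlinarith
        · simp [hS.supp r hrT]
      · rw [indicator_of_mem (show r ∈ Ioi t' from h), min_eq_right h.le]
  have hab : ∀ c, c - x ≤ c + x := fun c => by linarith
  simp only [posF]
  rw [hS.integral_gam_interval t' (hab t'), hS.integral_gam_interval t (hab t), ← hkey]
  have hii : ∀ a b, IntervalIntegrable g₀ volume a b := fun a b => hi.intervalIntegrable
  have a1 := intervalIntegral.integral_add_adjacent_intervals (hii (t - x) (t + x))
    (hii (t + x) (t' + x))
  have a2 := intervalIntegral.integral_add_adjacent_intervals (hii (t - x) (t' - x))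
    (hii (t' - x) (t' + x))
  simp only [← sub_eq_add_neg] at *
  linarith

end MovingWave

/-! ### The displacement as a differentiable curve in L²(ℝ). -/

namespace MovingWave

/-- A continuous curve is bounded on the compact time interval, so the square of its norm is
integrable in time. -/
theorem L2Cont.memLp_prod {m : ℝ → ℝ → ℝ} {T : ℝ} (h : L2Cont m (Icc 0 T))
    (hm : StronglyMeasurable (Function.uncurry m)) :
    MemLp ((Ioo 0 T ×ˢ univ).indicator (Function.uncurry m)) 2 (volume : Measure (ℝ × ℝ)) := by
  obtain ⟨C, hC⟩ := isCompact_Icc.exists_bound_of_continuousOn h.cont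
  have hms : MeasurableSet (Ioo (0 : ℝ) T ×ˢ (univ : Set ℝ)) := measurableSet_Ioo.prod .univ
  rw [memLp_two_iff (hm.indicator hms).aestronglyMeasurable, Measure.volume_eq_prod,
    lintegral_prod _ (((hm.indicator hms).enorm).pow_const 2).aemeasurable]
  calc ∫⁻ t, ∫⁻ x, ‖(Ioo 0 T ×ˢ univ).indicator (Function.uncurry m) (t, x)‖ₑ ^ 2
      ≤ ∫⁻ t, (Ioo 0 T).indicator (fun _ => ENNReal.ofReal C ^ 2) t := by
        refine lintegral_mono fun t => ?_
        by_cases ht : t ∈ Ioo 0 T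
        · have ht' := Ioo_subset_Icc_self ht
          have h1 : ∀ x, (Ioo 0 T ×ˢ univ).indicator (Function.uncurry m) (t, x) = m t x := by
            intro x; simp [ht.1, ht.2]
          simp_rw [h1]
          rw [← eLpNorm_two_sq, indicator_of_mem ht]
          gcongr
          have h2 := hC t ht'
          rw [toLR_of (h.memLp t ht'), Lp.norm_toLp] at h2
          exact (ENNReal.le_ofReal_iff_toReal_le (h.memLp t ht').2.ne
            (ENNReal.toReal_nonneg.trans h2)).2 h2
        · have h1 : ∀ x, (Ioo 0 T ×ˢ univ).indicator (Function.uncurry m) (t, x) = 0 := by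
            intro x
            exact indicator_of_notMem (fun hh => ht hh.1) _
          simp [h1]
    _ < ⊤ := by
        rw [lintegral_indicator measurableSet_Ioo, lintegral_const]
        exact ENNReal.mul_lt_top (by simp) (by simp)

theorem inner_toLR (χ : Lp ℝ 2 (volume : Measure ℝ)) {f : ℝ → ℝ} (hf : MemLp f 2 volume) :
    inner ℝ χ (toLR f) = ∫ x, χ x * f x := by
  rw [L2.inner_def]
  refine integral_congr_ae ?_
  filter_upwards [coeFn_toLR hf] with x hx
  rw [hx]; simp [mul_comm]

/-- Restriction of a function to `(0, 1 + k t)`, extended by zero. -/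
noncomputable def cut (k : ℝ) (m : ℝ → ℝ → ℝ) (t x : ℝ) : ℝ := (Ioo 0 (endpt k t)).indicator (m t) x

theorem continuous_endpt (k : ℝ) : Continuous (endpt k) := by unfold endpt; fun_prop

theorem L2Cont.cut {m : ℝ → ℝ → ℝ} {s : Set ℝ} (h : L2Cont m s) (k : ℝ) : L2Cont (cut k m) s :=
  h.indicator continuous_const (continuous_endpt k)

theorem measurableSet_cone (k : ℝ) : MeasurableSet {z : ℝ × ℝ | z.2 ∈ Ioo 0 (endpt k z.1)} := by
  have h1 : Measurable (endpt k) := (continuous_endpt k).measurable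
  exact (measurableSet_lt measurable_const measurable_snd).inter
    (measurableSet_lt measurable_snd (h1.comp measurable_fst))

theorem measurableSet_domainQ (k T : ℝ) : MeasurableSet (domainQ k T) :=
  (measurableSet_Ioo.preimage measurable_fst).inter (measurableSet_cone k)

theorem stronglyMeasurable_cut {m : ℝ → ℝ → ℝ} (hm : StronglyMeasurable (Function.uncurry m))
    (k : ℝ) : StronglyMeasurable (Function.uncurry (cut k m)) := by
  have : Function.uncurry (cut k m) =
      {z : ℝ × ℝ | z.2 ∈ Ioo 0 (endpt k z.1)}.indicator (Function.uncurry m) := by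
    ext z; simp [cut, Function.uncurry, indicator]
  rw [this]
  exact hm.indicator (measurableSet_cone k)

variable {k T : ℝ} {g₀ : ℝ → ℝ} {H : ℝ × ℝ → ℝ}

theorem endpt_pos (hk : 0 ≤ k) {t : ℝ} (ht : 0 ≤ t) : 0 < endpt k t := by
  unfold endpt; positivity

theorem Source.l2Cont_velF (hS : Source T g₀ H) (s : Set ℝ) : L2Cont (velF g₀ H) s :=
  (((hS.l2Cont_gam s).comp_add continuous_id).sub
    ((hS.l2Cont_gam s).comp_sub continuous_id)).const_mul (1 / 2)

theorem Source.l2Cont_gradF (hS : Source T g₀ H) (s : Set ℝ) : L2Cont (gradF g₀ H) s :=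
  (((hS.l2Cont_gam s).comp_add continuous_id).add
    ((hS.l2Cont_gam s).comp_sub continuous_id)).const_mul (1 / 2)

theorem Source.stronglyMeasurable_velF (hS : Source T g₀ H) :
    StronglyMeasurable (Function.uncurry (velF g₀ H)) := by
  have h := hS.stronglyMeasurable_gam
  exact (((h.comp_measurable (g := fun z : ℝ × ℝ => (z.1, z.1 + z.2)) (by fun_prop)).sub
    (h.comp_measurable (g := fun z : ℝ × ℝ => (z.1, z.1 - z.2)) (by fun_prop))).const_mul (1 / 2))

theorem Source.stronglyMeasurable_gradF (hS : Source T g₀ H) :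
    StronglyMeasurable (Function.uncurry (gradF g₀ H)) := by
  have h := hS.stronglyMeasurable_gam
  exact (((h.comp_measurable (g := fun z : ℝ × ℝ => (z.1, z.1 + z.2)) (by fun_prop)).add
    (h.comp_measurable (g := fun z : ℝ × ℝ => (z.1, z.1 - z.2)) (by fun_prop))).const_mul (1 / 2))

/-- An integral with variable limits is a parameter integral of an indicator, to which measurability
of parameter integrals applies. -/
theorem Source.stronglyMeasurable_cut_posF (hS : Source T g₀ H) :
    StronglyMeasurable (Function.uncurry (cut k (posF g₀ H))) := by
  have h1 : Function.uncurry (cut k (posF g₀ H)) =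
      {z : ℝ × ℝ | z.2 ∈ Ioo 0 (endpt k z.1)}.indicator (fun z => 1 / 2 * ∫ ξ,
        (Ioc (z.1 - z.2) (z.1 + z.2)).indicator (gam g₀ H z.1) ξ) := by
    ext z
    by_cases hz : z.2 ∈ Ioo 0 (endpt k z.1)
    · rw [indicator_of_mem (show z ∈ {z : ℝ × ℝ | z.2 ∈ Ioo 0 (endpt k z.1)} from hz)]
      simp only [Function.uncurry, cut]
      rw [indicator_of_mem hz, integral_indicator measurableSet_Ioc, posF,
        intervalIntegral.integral_of_le (by linarith [hz.1])]
    · rw [indicator_of_notMem (show z ∉ {z : ℝ × ℝ | z.2 ∈ Ioo 0 (endpt k z.1)} from hz)]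
      simp only [Function.uncurry, cut]
      rw [indicator_of_notMem hz]
  rw [h1]
  refine StronglyMeasurable.indicator ?_ (measurableSet_cone k)
  refine StronglyMeasurable.const_mul ?_ _
  refine StronglyMeasurable.integral_prod_right' (f := fun q : (ℝ × ℝ) × ℝ =>
    (Ioc (q.1.1 - q.1.2) (q.1.1 + q.1.2)).indicator (gam g₀ H q.1.1) q.2) ?_
  have h2 : (fun q : (ℝ × ℝ) × ℝ =>
      (Ioc (q.1.1 - q.1.2) (q.1.1 + q.1.2)).indicator (gam g₀ H q.1.1) q.2) =
      ({q : (ℝ × ℝ) × ℝ | q.1.1 - q.1.2 < q.2} ∩ {q | q.2 ≤ q.1.1 + q.1.2}).indicator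
        (fun q => Function.uncurry (gam g₀ H) (q.1.1, q.2)) := by
    ext q; simp [indicator, Function.uncurry]
  rw [h2]
  exact (hS.stronglyMeasurable_gam.comp_measurable (by fun_prop)).indicator
    ((measurableSet_lt (by fun_prop) (by fun_prop)).inter
      (measurableSet_le (by fun_prop) (by fun_prop)))

theorem Source.abs_posF_le (hS : Source T g₀ H) (t x : ℝ) :
    ‖posF g₀ H t x‖ ≤ 1 / 2 * ∫ ξ, ‖gam g₀ H t ξ‖ := by
  rw [posF, norm_mul, Real.norm_of_nonneg (by norm_num : (0 : ℝ) ≤ 1 / 2)]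
  gcongr
  refine intervalIntegral.norm_integral_le_integral_norm_uIoc.trans ?_
  exact setIntegral_le_integral (hS.integrable_gam t).norm
    (Eventually.of_forall fun _ => norm_nonneg _)

theorem Source.memLp_cut_posF (hS : Source T g₀ H) (t : ℝ) :
    MemLp (cut k (posF g₀ H) t) 2 volume := by
  have hm : AEStronglyMeasurable (cut k (posF g₀ H) t) volume :=
    (hS.stronglyMeasurable_cut_posF.comp_measurable measurable_prodMk_left).aestronglyMeasurable
  have h1 : MemLp (cut k (posF g₀ H) t) 2 (volume.restrict (Ioo 0 (endpt k t))) := by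
    refine MemLp.of_bound hm.restrict (1 / 2 * ∫ ξ, ‖gam g₀ H t ξ‖) (Eventually.of_forall fun x => ?_)
    exact (norm_indicator_le_norm_self _ _).trans (hS.abs_posF_le t x)
  have h2 := (memLp_indicator_iff_restrict measurableSet_Ioo).2 h1
  refine h2.ae_eq (Eventually.of_forall fun x => ?_)
  by_cases hx : x ∈ Ioo 0 (endpt k t)
  · rw [indicator_of_mem hx]
  · rw [indicator_of_notMem hx, cut, indicator_of_notMem hx]

/-- The displacement, set to zero outside the domain, is the time integral of the velocity. -/
theorem Reflected.cut_posF_sub (hR : Reflected k T g₀ H) (hk : 0 < k) {t t' : ℝ} (ht : 0 ≤ t)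
    (htt : t ≤ t') (ht' : t' ≤ T) (x : ℝ) :
    cut k (posF g₀ H) t' x - cut k (posF g₀ H) t x = ∫ s in t..t', cut k (velF g₀ H) s x := by
  rcases le_or_gt x 0 with hx | hx
  · simp [cut, indicator, hx.not_gt]
  have hout : ∀ (m : ℝ → ℝ → ℝ) s, endpt k s ≤ x → cut k m s x = 0 := fun m s hs =>
    indicator_of_notMem (fun h => hs.not_gt h.2) _
  have hin : ∀ (m : ℝ → ℝ → ℝ) s, x < endpt k s → cut k m s x = m s x := fun m s hs =>
    indicator_of_mem (show x ∈ Ioo 0 (endpt k s) from ⟨hx, hs⟩) _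
  have hmono : ∀ {a b : ℝ}, a ≤ b → endpt k a ≤ endpt k b := fun {a b} h => by
    simp only [endpt]; nlinarith
  have hmono' : ∀ {a b : ℝ}, a < b → endpt k a < endpt k b := fun {a b} h => by
    simp only [endpt]; nlinarith
  have hzero : ∀ {a b : ℝ}, a ≤ b → endpt k b ≤ x → ∫ s in a..b, cut k (velF g₀ H) s x = 0 := by
    intro a b hab hb
    rw [intervalIntegral.integral_of_le hab]
    refine integral_eq_zero_of_ae ?_
    rw [EventuallyEq, ae_restrict_iff' measurableSet_Ioc]
    exact Eventually.of_forall fun s hs => hout _ s ((hmono hs.2).trans hb)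
  have hpos : ∀ {a b : ℝ}, a ≤ b → x ≤ endpt k a →
      ∫ s in a..b, cut k (velF g₀ H) s x = ∫ s in a..b, velF g₀ H s x := by
    intro a b hab ha
    rw [intervalIntegral.integral_of_le hab, intervalIntegral.integral_of_le hab]
    exact setIntegral_congr_fun measurableSet_Ioc fun s hs => hin _ s (ha.trans_lt (hmono' hs.1))
  rcases lt_or_ge x (endpt k t) with h1 | h1
  · rw [hin _ _ h1, hin _ _ (h1.trans_le (hmono htt)), hpos htt h1.le]
    exact hR.posF_sub hk.le htt hx.le h1.le
  rcases le_or_gt (endpt k t') x with h2 | h2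
  · rw [hout _ _ h2, hout _ _ h1, hzero htt h2, sub_zero]
  -- The endpoint reaches `x` at time `r`. Before `r` the cut displacement is zero, and at `r` the
  -- displacement itself vanishes by `Reflected.mean`, so nothing jumps when the cut opens.
  set r := (x - 1) / k with hr
  have hrx : endpt k r = x := by rw [hr, endpt]; field_simp; ring
  have htr : t ≤ r := by
    rw [hr, le_div_iff₀ hk]; simp only [endpt] at h1; linarith
  have hrt : r ≤ t' := by
    rw [hr, div_le_iff₀ hk]; simp only [endpt] at h2; linarith
  have hii : ∀ {a b : ℝ}, a ≤ b → x ≤ endpt k a →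
      IntervalIntegrable (fun s => cut k (velF g₀ H) s x) volume a b := by
    intro a b hab ha
    refine (hR.intervalIntegrable_velF hab x).congr ?_
    rw [uIoc_of_le hab]
    exact fun s hs => (hin _ s (ha.trans_lt (hmono' hs.1))).symm
  have hi0 : IntervalIntegrable (fun s => cut k (velF g₀ H) s x) volume t r := by
    refine (intervalIntegrable_const (c := (0 : ℝ))).congr ?_
    rw [uIoc_of_le htr]
    exact fun s hs => (hout _ s ((hmono hs.2).trans hrx.le)).symm
  rw [← intervalIntegral.integral_add_adjacent_intervals hi0 (hii hrt hrx.ge), hzero htr hrx.le,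
    hpos hrt hrx.ge, hin _ _ h2, hout _ _ h1, ← hR.posF_sub hk.le hrt hx.le hrx.ge]
  have hm := hR.mean r ⟨ht.trans htr, hrt.trans ht'⟩
  rw [hrx] at hm
  simp [posF, hm]

theorem Source.intervalIntegrable_toLR (hS : Source T g₀ H) (a b : ℝ) :
    IntervalIntegrable (fun s => toLR (cut k (velF g₀ H) s)) volume a b :=
  (continuousOn_univ.1 ((hS.l2Cont_velF univ).cut k).cont).intervalIntegrable a b

/-- The pointwise formula `Reflected.cut_posF_sub` becomes an identity of Bochner integrals after
pairing with an arbitrary L² function and exchanging the integrals. -/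
theorem Reflected.toLR_cut_posF (hR : Reflected k T g₀ H) (hk : 0 < k) {t : ℝ} (ht : t ∈ Icc 0 T) :
    toLR (cut k (posF g₀ H) t) = toLR (cut k (posF g₀ H) 0) +
      ∫ s in (0 : ℝ)..t, toLR (cut k (velF g₀ H) s) := by
  have hS := hR.toSource
  have hv := (hS.l2Cont_velF univ).cut k
  refine ext_inner_left ℝ fun χ => ?_
  rw [inner_add_right, inner_toLR χ (hS.memLp_cut_posF t), inner_toLR χ (hS.memLp_cut_posF 0)]
  have h1 : inner ℝ χ (∫ s in (0 : ℝ)..t, toLR (cut k (velF g₀ H) s)) =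
      ∫ s in (0 : ℝ)..t, ∫ x, χ x * cut k (velF g₀ H) s x := by
    have := (innerSL ℝ χ).intervalIntegral_comp_comm (hS.intervalIntegrable_toLR (k := k) 0 t)
    simp only [innerSL_apply_apply] at this
    rw [← this]
    refine intervalIntegral.integral_congr fun s _ => ?_
    exact inner_toLR χ (hv.memLp s (mem_univ s))
  rw [h1, intervalIntegral.integral_of_le ht.1, integral_Ioc_eq_integral_Ioo]
  have hint : Integrable (fun z : ℝ × ℝ => χ z.2 * cut k (velF g₀ H) z.1 z.2)
      ((volume.restrict (Ioo 0 t)).prod volume) := by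
    have hm2 := (hv.mono (subset_univ (Icc 0 t))).memLp_prod
      (stronglyMeasurable_cut hS.stronglyMeasurable_velF k)
    have hχ : MemLp (fun z : ℝ × ℝ => χ z.2) 2 ((volume.restrict (Ioo 0 t)).prod volume) :=
      (Lp.memLp χ).comp_snd (volume.restrict (Ioo 0 t))
    have hms : MeasurableSet (Ioo (0 : ℝ) t ×ˢ (univ : Set ℝ)) := measurableSet_Ioo.prod .univ
    have h2 := (memLp_indicator_iff_restrict hms).1 hm2
    rw [Measure.volume_eq_prod, ← Measure.prod_restrict, Measure.restrict_univ] at h2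
    exact hχ.integrable_mul h2
  rw [integral_integral_swap hint]
  have h3 : ∀ x, ∫ s in Ioo 0 t, χ x * cut k (velF g₀ H) s x =
      χ x * cut k (posF g₀ H) t x - χ x * cut k (posF g₀ H) 0 x := by
    intro x
    rw [integral_const_mul, ← integral_Ioc_eq_integral_Ioo,
      ← intervalIntegral.integral_of_le ht.1, ← hR.cut_posF_sub hk le_rfl ht.1 ht.2 x, mul_sub]
  simp_rw [h3]
  rw [integral_sub]
  · ring
  · exact (Lp.memLp χ).integrable_mul (hS.memLp_cut_posF t)
  · exact (Lp.memLp χ).integrable_mul (hS.memLp_cut_posF 0)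

theorem Reflected.hasDerivWithinAt_cut_posF (hR : Reflected k T g₀ H) (hk : 0 < k) {t : ℝ}
    (ht : t ∈ Icc 0 T) :
    HasDerivWithinAt (fun s => toLR (cut k (posF g₀ H) s)) (toLR (cut k (velF g₀ H) t))
      (Icc 0 T) t := by
  have hc := continuousOn_univ.1 ((hR.l2Cont_velF univ).cut k).cont
  have h1 := (hc.integral_hasStrictDerivAt 0 t).hasDerivAt
  exact ((h1.const_add (toLR (cut k (posF g₀ H) 0))).hasDerivWithinAt).congr
    (fun s hs => hR.toLR_cut_posF hk hs) (hR.toLR_cut_posF hk ht)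

theorem Reflected.l2Cont_cut_posF (hR : Reflected k T g₀ H) (hk : 0 < k) :
    L2Cont (cut k (posF g₀ H)) (Icc 0 T) :=
  ⟨fun t _ => hR.memLp_cut_posF t,
    fun _ ht => (hR.hasDerivWithinAt_cut_posF hk ht).continuousWithinAt⟩

end MovingWave

namespace MovingWave

/-! ### Calculus of test functions -/

/-- Partial derivatives of a function of `(t, x)`. -/
noncomputable def D1 (E : ℝ × ℝ → ℝ) (z : ℝ × ℝ) : ℝ := fderiv ℝ E z (1, 0)
noncomputable def D2 (E : ℝ × ℝ → ℝ) (z : ℝ × ℝ) : ℝ := fderiv ℝ E z (0, 1)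

theorem contDiff_D1 {E : ℝ × ℝ → ℝ} (hE : ContDiff ℝ ∞ E) : ContDiff ℝ ∞ (D1 E) :=
  (hE.fderiv_right (m := ∞) (by simp)).clm_apply contDiff_const

theorem contDiff_D2 {E : ℝ × ℝ → ℝ} (hE : ContDiff ℝ ∞ E) : ContDiff ℝ ∞ (D2 E) :=
  (hE.fderiv_right (m := ∞) (by simp)).clm_apply contDiff_const

theorem tsupport_D1_subset (E : ℝ × ℝ → ℝ) : tsupport (D1 E) ⊆ tsupport E := by
  refine (closure_mono fun z hz => ?_).trans (tsupport_fderiv_subset ℝ (f := E))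
  intro h
  exact hz (by simp [D1, h])

theorem tsupport_D2_subset (E : ℝ × ℝ → ℝ) : tsupport (D2 E) ⊆ tsupport E := by
  refine (closure_mono fun z hz => ?_).trans (tsupport_fderiv_subset ℝ (f := E))
  intro h
  exact hz (by simp [D2, h])

theorem hasDerivAt_comp_path {E : ℝ × ℝ → ℝ} (hE : ContDiff ℝ ∞ E) {p q : ℝ → ℝ} {p' q' s : ℝ}
    (hp : HasDerivAt p p' s) (hq : HasDerivAt q q' s) :
    HasDerivAt (fun r => E (p r, q r)) (p' * D1 E (p s, q s) + q' * D2 E (p s, q s)) s := by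
  have h1 := ((hE.differentiable (by simp)) (p s, q s)).hasFDerivAt.comp_hasDerivAt s
    (hp.prodMk hq)
  have h2 : fderiv ℝ E (p s, q s) (p', q') = p' * D1 E (p s, q s) + q' * D2 E (p s, q s) := by
    have : ((p', q') : ℝ × ℝ) = p' • (1, 0) + q' • (0, 1) := by simp
    rw [this, map_add, map_smul, map_smul]
    simp [D1, D2]
  rw [← h2]
  exact h1

theorem hasDerivAt_fst {E : ℝ × ℝ → ℝ} (hE : ContDiff ℝ ∞ E) (t x : ℝ) :
    HasDerivAt (fun s => E (s, x)) (D1 E (t, x)) t := by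
  have := hasDerivAt_comp_path hE (hasDerivAt_id t) (hasDerivAt_const t x)
  simpa using this

theorem hasDerivAt_snd {E : ℝ × ℝ → ℝ} (hE : ContDiff ℝ ∞ E) (t x : ℝ) :
    HasDerivAt (fun y => E (t, y)) (D2 E (t, x)) x := by
  have := hasDerivAt_comp_path hE (hasDerivAt_const x t) (hasDerivAt_id x)
  simpa using this

theorem iteratedDeriv_two_fst {E : ℝ × ℝ → ℝ} (hE : ContDiff ℝ ∞ E) (t x : ℝ) :
    iteratedDeriv 2 (fun s => E (s, x)) t = D1 (D1 E) (t, x) := by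
  rw [iteratedDeriv_succ, iteratedDeriv_one]
  have : deriv (fun s => E (s, x)) = fun s => D1 E (s, x) := by
    ext s; exact (hasDerivAt_fst hE s x).deriv
  rw [this]
  exact (hasDerivAt_fst (contDiff_D1 hE) t x).deriv

theorem iteratedDeriv_two_snd {E : ℝ × ℝ → ℝ} (hE : ContDiff ℝ ∞ E) (t x : ℝ) :
    iteratedDeriv 2 (fun y => E (t, y)) x = D2 (D2 E) (t, x) := by
  rw [iteratedDeriv_succ, iteratedDeriv_one]
  have : deriv (fun s => E (t, s)) = fun s => D2 E (t, s) := by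
    ext s; exact (hasDerivAt_snd hE t s).deriv
  rw [this]
  exact (hasDerivAt_snd (contDiff_D2 hE) t x).deriv

/-- A smooth function of compact support contained in `U`. -/
structure IsTest (U : Set (ℝ × ℝ)) (E : ℝ × ℝ → ℝ) : Prop where
  smooth : ContDiff ℝ ∞ E
  compact : HasCompactSupport E
  supp : tsupport E ⊆ U

theorem IsTest.D1 {U : Set (ℝ × ℝ)} {E : ℝ × ℝ → ℝ} (h : IsTest U E) : IsTest U (D1 E) :=
  ⟨contDiff_D1 h.smooth, h.compact.mono' ((subset_tsupport _).trans (tsupport_D1_subset E)),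
    (tsupport_D1_subset E).trans h.supp⟩

theorem IsTest.D2 {U : Set (ℝ × ℝ)} {E : ℝ × ℝ → ℝ} (h : IsTest U E) : IsTest U (D2 E) :=
  ⟨contDiff_D2 h.smooth, h.compact.mono' ((subset_tsupport _).trans (tsupport_D2_subset E)),
    (tsupport_D2_subset E).trans h.supp⟩

theorem IsTest.eq_zero {U : Set (ℝ × ℝ)} {E : ℝ × ℝ → ℝ} (h : IsTest U E) {z : ℝ × ℝ}
    (hz : z ∉ U) : E z = 0 :=
  image_eq_zero_of_notMem_tsupport fun h' => hz (h.supp h')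

theorem IsTest.memLp {U : Set (ℝ × ℝ)} {E : ℝ × ℝ → ℝ} (h : IsTest U E) : MemLp E 2 volume :=
  h.smooth.continuous.memLp_of_hasCompactSupport h.compact

theorem IsTest.smul {U : Set (ℝ × ℝ)} {E : ℝ × ℝ → ℝ} (h : IsTest U E) (c : ℝ) :
    IsTest U (fun z => c * E z) :=
  ⟨contDiff_const.mul h.smooth, h.compact.mul_left,
    (tsupport_mul_subset_right).trans h.supp⟩

theorem IsTest.add {U : Set (ℝ × ℝ)} {E F : ℝ × ℝ → ℝ} (h : IsTest U E) (h' : IsTest U F) :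
    IsTest U (fun z => E z + F z) :=
  ⟨h.smooth.add h'.smooth, h.compact.add h'.compact,
    (tsupport_add E F).trans (union_subset h.supp h'.supp)⟩

/-- Iterated integrals over the non-cylindrical domain. -/
theorem integral_domainQ {k T : ℝ} {F : ℝ × ℝ → ℝ}
    (hF : Integrable F (volume.restrict (domainQ k T))) :
    ∫ t in Ioo 0 T, ∫ x in Ioo 0 (endpt k t), F (t, x) = ∫ z in domainQ k T, F z := by
  rw [← integral_indicator (measurableSet_domainQ k T), Measure.volume_eq_prod, integral_prod,
    ← integral_indicator measurableSet_Ioo]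
  · refine integral_congr_ae (Eventually.of_forall fun t => ?_)
    by_cases ht : t ∈ Ioo 0 T
    · simp only [indicator_of_mem ht]
      rw [← integral_indicator measurableSet_Ioo]
      refine integral_congr_ae (Eventually.of_forall fun x => ?_)
      by_cases hx : x ∈ Ioo 0 (endpt k t)
      · simp only [indicator_of_mem hx]
        rw [indicator_of_mem (show (t, x) ∈ domainQ k T from ⟨ht, hx⟩)]
      · simp only [indicator_of_notMem hx]
        rw [indicator_of_notMem (fun h : (t, x) ∈ domainQ k T => hx h.2)]
    · simp only [indicator_of_notMem ht]
      symm
      refine integral_eq_zero_of_ae (Eventually.of_forall fun x => ?_)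
      exact indicator_of_notMem (fun h : (t, x) ∈ domainQ k T => ht h.1) _
  · rw [← Measure.volume_eq_prod]
    exact (integrable_indicator_iff (measurableSet_domainQ k T)).2 hF

/-- Integration by parts for the primitive of an integrable function. -/
theorem integral_primitive_mul_deriv {a b C : ℝ} (hab : a ≤ b) {v Φ η η' : ℝ → ℝ}
    (hv : IntervalIntegrable v volume a b) (hΦ : ∀ t ∈ Icc a b, Φ t = C + ∫ s in a..t, v s)
    (hη : ∀ t, HasDerivAt η (η' t) t) (hη' : Continuous η') (ha : η a = 0) (hb : η b = 0) :
    ∫ t in a..b, Φ t * η' t = - ∫ t in a..b, v t * η t := by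
  have hP : AbsolutelyContinuousOnInterval (fun t => C + ∫ s in a..t, v s) a b := by
    have h1 := hv.absolutelyContinuousOnInterval_intervalIntegral (left_mem_uIcc)
    have h2 : AbsolutelyContinuousOnInterval (fun _ : ℝ => C) a b :=
      ((LipschitzWith.const C).lipschitzOnWith (s := uIcc a b)).absolutelyContinuousOnInterval
    exact h2.add h1
  have hd : deriv η = η' := by ext t; exact (hη t).deriv
  have hc : ContDiff ℝ 1 η := by
    rw [contDiff_one_iff_deriv]
    exact ⟨fun t => (hη t).differentiableAt, by rwa [hd]⟩
  have hE : AbsolutelyContinuousOnInterval η a b := hc.contDiffOn.absolutelyContinuousOnInterval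
  have h3 := hP.integral_mul_deriv_eq_deriv_mul hE
  rw [ha, hb, hd] at h3
  simp only [mul_zero, sub_zero, zero_sub] at h3
  have h4 : ∫ t in a..b, Φ t * η' t = ∫ t in a..b, (C + ∫ s in a..t, v s) * η' t := by
    refine intervalIntegral.integral_congr fun t ht => ?_
    rw [uIcc_of_le hab] at ht
    simp only [hΦ t ht]
  rw [h4, h3]
  congr 1
  refine intervalIntegral.integral_congr_ae ?_
  filter_upwards [hv.ae_hasDerivAt_integral] with t ht htt
  rw [(((ht (uIoc_subset_uIcc htt) a left_mem_uIcc)).const_add C).deriv]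

end MovingWave

/-! ### The wave equation in the sense of distributions. -/

namespace MovingWave

variable {k T : ℝ} {g₀ : ℝ → ℝ} {H : ℝ × ℝ → ℝ}

/-- The pairing of a curve with a test function on the strip `(0, T) × ℝ`. -/
noncomputable def pairing (T : ℝ) (m : ℝ → ℝ → ℝ) (E : ℝ × ℝ → ℝ) : ℝ :=
  ∫ t in Ioo 0 T, ∫ x, m t x * E (t, x)

theorem memLp_strip {m : ℝ → ℝ → ℝ} (h : L2Cont m (Icc 0 T))
    (hm : StronglyMeasurable (Function.uncurry m)) :
    MemLp (fun z : ℝ × ℝ => m z.1 z.2) 2 ((volume.restrict (Ioo 0 T)).prod volume) := by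
  have hms : MeasurableSet (Ioo (0 : ℝ) T ×ˢ (univ : Set ℝ)) := measurableSet_Ioo.prod .univ
  have h2 := (memLp_indicator_iff_restrict hms).1 (h.memLp_prod hm)
  rwa [Measure.volume_eq_prod, ← Measure.prod_restrict, Measure.restrict_univ] at h2

theorem integrable_strip {m : ℝ → ℝ → ℝ} (h : L2Cont m (Icc 0 T))
    (hm : StronglyMeasurable (Function.uncurry m)) {E : ℝ × ℝ → ℝ} (hE : MemLp E 2 volume) :
    Integrable (fun z : ℝ × ℝ => m z.1 z.2 * E z) ((volume.restrict (Ioo 0 T)).prod volume) := by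
  have := hE.restrict (Ioo 0 T ×ˢ (univ : Set ℝ))
  rw [Measure.volume_eq_prod, ← Measure.prod_restrict, Measure.restrict_univ] at this
  exact (memLp_strip h hm).integrable_mul this

theorem pairing_eq_integral {m : ℝ → ℝ → ℝ} (h : L2Cont m (Icc 0 T))
    (hm : StronglyMeasurable (Function.uncurry m)) {E : ℝ × ℝ → ℝ} (hE : MemLp E 2 volume) :
    pairing T m E = ∫ z, m z.1 z.2 * E z ∂((volume.restrict (Ioo 0 T)).prod volume) :=
  (integral_prod _ (integrable_strip h hm hE)).symm

theorem pairing_swap {m : ℝ → ℝ → ℝ} (hT : 0 ≤ T) (h : L2Cont m (Icc 0 T))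
    (hm : StronglyMeasurable (Function.uncurry m)) {E : ℝ × ℝ → ℝ} (hE : MemLp E 2 volume) :
    pairing T m E = ∫ x, ∫ t in (0 : ℝ)..T, m t x * E (t, x) := by
  rw [pairing_eq_integral h hm hE, integral_prod_symm _ (integrable_strip h hm hE)]
  simp_rw [intervalIntegral.integral_of_le hT, integral_Ioc_eq_integral_Ioo]

theorem integral_Ioo_eq_of_isTest {E : ℝ × ℝ → ℝ} (hE : IsTest (domainQ k T) E) (m : ℝ → ℝ → ℝ)
    (t : ℝ) : ∫ x in Ioo 0 (endpt k t), m t x * E (t, x) = ∫ x, m t x * E (t, x) := by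
  refine setIntegral_eq_integral_of_forall_compl_eq_zero fun x hx => ?_
  rw [hE.eq_zero (fun h => hx h.2), mul_zero]

theorem iterated_eq_pairing {E : ℝ × ℝ → ℝ} (hE : IsTest (domainQ k T) E) (m : ℝ → ℝ → ℝ) :
    ∫ t in Ioo 0 T, ∫ x in Ioo 0 (endpt k t), m t x * E (t, x) = pairing T m E := by
  simp_rw [integral_Ioo_eq_of_isTest hE]; rfl

theorem IsTest.comp_homeo {U : Set (ℝ × ℝ)} {E : ℝ × ℝ → ℝ} (hE : IsTest U E)
    (e : ℝ × ℝ ≃ₜ ℝ × ℝ) (he : ContDiff ℝ ∞ e) : IsTest univ (fun z => E (e z)) :=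
  ⟨hE.smooth.comp he, hE.compact.comp_homeomorph e, subset_univ _⟩

/-- The change of variables `(t, x) ↦ (t, x - t)`. -/
def shearHomeo : ℝ × ℝ ≃ₜ ℝ × ℝ where
  toFun z := (z.1, z.2 - z.1)
  invFun z := (z.1, z.2 + z.1)
  left_inv z := by ext <;> simp
  right_inv z := by ext <;> simp
  continuous_toFun := by fun_prop
  continuous_invFun := by fun_prop

/-- The change of variables `(t, x) ↦ (t, t - x)`. -/
def reflHomeo : ℝ × ℝ ≃ₜ ℝ × ℝ where
  toFun z := (z.1, z.1 - z.2)
  invFun z := (z.1, z.1 - z.2)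
  left_inv z := by ext <;> simp
  right_inv z := by ext <;> simp
  continuous_toFun := by fun_prop
  continuous_invFun := by fun_prop

theorem shearHomeo_apply (t x : ℝ) : shearHomeo (t, x) = (t, x - t) := rfl

theorem reflHomeo_apply (t x : ℝ) : reflHomeo (t, x) = (t, t - x) := rfl

theorem contDiff_shear : ContDiff ℝ ∞ shearHomeo := by
  show ContDiff ℝ ∞ fun z : ℝ × ℝ => (z.1, z.2 - z.1)
  fun_prop

theorem contDiff_refl : ContDiff ℝ ∞ reflHomeo := by
  show ContDiff ℝ ∞ fun z : ℝ × ℝ => (z.1, z.1 - z.2)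
  fun_prop

/-- Along characteristics the Riemann invariant is a primitive of the source. -/
theorem Source.pairing_gam_D1 (hS : Source T g₀ H) (hT : 0 ≤ T) {E : ℝ × ℝ → ℝ}
    (hE : IsTest univ E) (h0 : ∀ ξ, E (0, ξ) = 0) (h1 : ∀ ξ, E (T, ξ) = 0) :
    pairing T (gam g₀ H) (MovingWave.D1 E) = - ∫ t in Ioo 0 T, ∫ ξ, H (t, ξ) * E (t, ξ) := by
  rw [pairing_swap hT (hS.l2Cont_gam _) hS.stronglyMeasurable_gam hE.D1.memLp]
  have hHE : Integrable (fun z : ℝ × ℝ => H z * E z) volume := hS.memLp.integrable_mul hE.memLp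
  have hsw := integral_swap_sets hHE (Ioo 0 T) univ
  simp only [Measure.restrict_univ] at hsw
  rw [hsw, ← integral_neg]
  refine integral_congr_ae ?_
  filter_upwards [ae_slice_integrable hS.int] with ξ hξ
  rw [integral_primitive_mul_deriv (C := g₀ ξ - ∫ s in Ioi 0, H (s, ξ)) (v := fun s => H (s, ξ))
    (η := fun t => E (t, ξ)) hT hξ.intervalIntegrable ?_ (fun t => hasDerivAt_fst hE.smooth t ξ) ?_
    (h0 ξ) (h1 ξ)]
  · rw [intervalIntegral.integral_of_le hT, integral_Ioc_eq_integral_Ioo]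
  · intro t ht
    have := setIntegral_union (μ := volume) (f := fun s => H (s, ξ)) (s := Ioc 0 t) (t := Ioi t)
      (Set.disjoint_left.2 fun x hx hx' => (not_lt.2 hx.2 hx').elim) measurableSet_Ioi
      hξ.integrableOn hξ.integrableOn
    rw [Ioc_union_Ioi_eq_Ioi ht.1] at this
    rw [gam, this, intervalIntegral.integral_of_le ht.1]
    ring
  · exact (contDiff_D1 hE.smooth).continuous.comp (by fun_prop)

/-- The displacement generated by a reflected source solves the wave equation. -/
theorem Reflected.weak_equation (hR : Reflected k T g₀ H) (hk : 0 < k) (hT : 0 < T)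
    {E : ℝ × ℝ → ℝ} (hE : IsTest (domainQ k T) E) :
    ∫ t in Ioo 0 T, ∫ x in Ioo 0 (endpt k t),
      posF g₀ H t x * (D1 (D1 E) (t, x) - D2 (D2 E) (t, x)) =
    ∫ t in Ioo 0 T, ∫ x in Ioo 0 (endpt k t), H (t, t + x) * E (t, x) := by
  have hS := hR.toSource
  have hout : ∀ (F : ℝ × ℝ → ℝ), IsTest (domainQ k T) F → ∀ x, F (0, x) = 0 ∧ F (T, x) = 0 :=
    fun F hF x => ⟨hF.eq_zero fun h => lt_irrefl _ h.1.1, hF.eq_zero fun h => lt_irrefl _ h.1.2⟩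
  have hP := hR.l2Cont_cut_posF hk
  have hPm := hS.stronglyMeasurable_cut_posF (k := k)
  have hV := (hS.l2Cont_velF (Icc 0 T)).cut k
  have hVm := stronglyMeasurable_cut hS.stronglyMeasurable_velF k
  have hcut : ∀ (m : ℝ → ℝ → ℝ) (F : ℝ × ℝ → ℝ), IsTest (domainQ k T) F → ∀ t x,
      cut k m t x * F (t, x) = m t x * F (t, x) := by
    intro m F hF t x
    by_cases hx : x ∈ Ioo 0 (endpt k t)
    · rw [cut, indicator_of_mem hx]
    · rw [hF.eq_zero (fun h => hx h.2), mul_zero, mul_zero]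
  -- For fixed `x` the cut displacement is a primitive in time of the cut velocity.
  have hA : pairing T (cut k (posF g₀ H)) (D1 (D1 E)) = - pairing T (cut k (velF g₀ H)) (D1 E) := by
    rw [pairing_swap hT.le hP hPm hE.D1.D1.memLp, pairing_swap hT.le hV hVm hE.D1.memLp,
      ← integral_neg]
    refine integral_congr_ae (Eventually.of_forall fun x => ?_)
    refine integral_primitive_mul_deriv (C := cut k (posF g₀ H) 0 x) hT.le ?_ ?_
      (fun t => hasDerivAt_fst hE.D1.smooth t x) ?_ (hout _ hE.D1 x).1 (hout _ hE.D1 x).2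
    · have hm : Measurable fun t => cut k (velF g₀ H) t x :=
        (hVm.comp_measurable measurable_prodMk_right).measurable
      rw [intervalIntegrable_iff_integrableOn_Ioc_of_le hT.le]
      refine Integrable.mono (g := fun s => velF g₀ H s x)
        ((intervalIntegrable_iff_integrableOn_Ioc_of_le hT.le).1 (hS.intervalIntegrable_velF hT.le x))
        hm.aestronglyMeasurable (Eventually.of_forall fun s => ?_)
      simp only [cut, indicator]
      split_ifs <;> simp
    · intro t ht
      have := hR.cut_posF_sub hk le_rfl ht.1 ht.2 x
      linarith
    · exact hE.D1.D1.smooth.continuous.comp (by fun_prop)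
  -- For fixed `t` the displacement is a primitive in space of the strain.
  have hB : pairing T (cut k (posF g₀ H)) (D2 (D2 E)) = - pairing T (gradF g₀ H) (D2 E) := by
    rw [← iterated_eq_pairing hE.D2.D2, ← iterated_eq_pairing hE.D2, ← integral_neg]
    refine setIntegral_congr_fun measurableSet_Ioo fun t ht => ?_
    have hL := (endpt_pos hk.le ht.1.le).le
    have hi := hS.integrable_gam t
    simp only [← integral_Ioc_eq_integral_Ioo]
    rw [← intervalIntegral.integral_of_le hL, ← intervalIntegral.integral_of_le hL]
    refine Eq.trans (intervalIntegral.integral_congr fun x _ => hcut _ _ hE.D2.D2 t x) ?_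
    refine integral_primitive_mul_deriv (C := 0) hL ?_ ?_
      (fun x => hasDerivAt_snd hE.D2.smooth t x) ?_
      (hE.D2.eq_zero fun h => lt_irrefl _ h.2.1) (hE.D2.eq_zero fun h => lt_irrefl _ h.2.2)
    · exact (((hi.comp_add_left t).add (hi.comp_sub_left t)).const_mul (1 / 2)).intervalIntegrable
    · intro x _
      rw [zero_add, integral_gradF hS]
    · exact hE.D2.D2.smooth.continuous.comp (by fun_prop)
  have hgm := hS.stronglyMeasurable_gam
  have hm1 := (hS.l2Cont_gam (Icc 0 T)).comp_add continuous_id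
  have hm2 := (hS.l2Cont_gam (Icc 0 T)).comp_sub continuous_id
  have hm1m : StronglyMeasurable (Function.uncurry fun t x => gam g₀ H t (id t + x)) :=
    hgm.comp_measurable (g := fun z : ℝ × ℝ => (z.1, z.1 + z.2)) (by fun_prop)
  have hm2m : StronglyMeasurable (Function.uncurry fun t x => gam g₀ H t (id t - x)) :=
    hgm.comp_measurable (g := fun z : ℝ × ℝ => (z.1, z.1 - z.2)) (by fun_prop)
  have i1 := fun (F : ℝ × ℝ → ℝ) (hF : IsTest (domainQ k T) F) => integrable_strip hm1 hm1m hF.memLp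
  have i2 := fun (F : ℝ × ℝ → ℝ) (hF : IsTest (domainQ k T) F) => integrable_strip hm2 hm2m hF.memLp
  have hV' : pairing T (cut k (velF g₀ H)) (D1 E) =
      1 / 2 * (pairing T (fun t x => gam g₀ H t (id t + x)) (D1 E) -
        pairing T (fun t x => gam g₀ H t (id t - x)) (D1 E)) := by
    rw [pairing_eq_integral hV hVm hE.D1.memLp, pairing_eq_integral hm1 hm1m hE.D1.memLp,
      pairing_eq_integral hm2 hm2m hE.D1.memLp, ← integral_sub (i1 _ hE.D1) (i2 _ hE.D1),
      ← integral_const_mul]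
    refine integral_congr_ae (Eventually.of_forall fun z => ?_)
    show cut k (velF g₀ H) z.1 z.2 * D1 E (z.1, z.2) = _
    rw [hcut _ _ hE.D1]
    simp only [velF, id]
    ring
  have hG' : pairing T (gradF g₀ H) (D2 E) =
      1 / 2 * (pairing T (fun t x => gam g₀ H t (id t + x)) (D2 E) +
        pairing T (fun t x => gam g₀ H t (id t - x)) (D2 E)) := by
    rw [pairing_eq_integral (hS.l2Cont_gradF _) hS.stronglyMeasurable_gradF hE.D2.memLp,
      pairing_eq_integral hm1 hm1m hE.D2.memLp,
      pairing_eq_integral hm2 hm2m hE.D2.memLp, ← integral_add (i1 _ hE.D2) (i2 _ hE.D2),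
      ← integral_const_mul]
    refine integral_congr_ae (Eventually.of_forall fun z => ?_)
    simp only [gradF, id]
    ring
  -- The two changes of variables straighten the characteristics ξ = t + x and ξ = t - x, turning
  -- `D1 E - D2 E` and `D1 E + D2 E` into pure time derivatives.
  have hE1 := hE.comp_homeo shearHomeo contDiff_shear
  have hE2 := hE.comp_homeo reflHomeo contDiff_refl
  have hC1 : pairing T (fun t x => gam g₀ H t (id t + x)) (D1 E) -
      pairing T (fun t x => gam g₀ H t (id t + x)) (D2 E) =
      - ∫ t in Ioo 0 T, ∫ x in Ioo 0 (endpt k t), H (t, t + x) * E (t, x) := by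
    have e1 := hS.pairing_gam_D1 hT.le hE1 (fun ξ => (hout E hE _).1) (fun ξ => (hout E hE _).2)
    have e2 : ∀ t ξ, D1 (fun z => E (shearHomeo z)) (t, ξ) = D1 E (t, ξ - t) - D2 E (t, ξ - t) := by
      intro t ξ
      have a1 := hasDerivAt_fst hE1.smooth t ξ
      have a2 := hasDerivAt_comp_path hE.smooth (hasDerivAt_id t)
        ((hasDerivAt_const t ξ).sub (hasDerivAt_id t))
      have a3 := a1.unique a2
      rw [a3]; simp [sub_eq_add_neg]
    have e0 := integral_prod _ ((i1 _ hE.D1).sub (i1 _ hE.D2))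
    simp only [Pi.sub_apply] at e0
    rw [pairing_eq_integral hm1 hm1m hE.D1.memLp, pairing_eq_integral hm1 hm1m hE.D2.memLp,
      ← integral_sub (i1 _ hE.D1) (i1 _ hE.D2), e0]
    rw [pairing] at e1
    have e3 : ∀ t, ∫ ξ, H (t, ξ) * E (shearHomeo (t, ξ)) =
        ∫ x in Ioo 0 (endpt k t), H (t, t + x) * E (t, x) := by
      intro t
      rw [integral_Ioo_eq_of_isTest hE (fun t x => H (t, t + x)),
        ← integral_add_left_eq_self (fun ξ => H (t, ξ) * E (shearHomeo (t, ξ))) t]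
      refine integral_congr_ae (Eventually.of_forall fun x => ?_)
      simp [shearHomeo_apply]
    simp_rw [e3] at e1
    rw [← e1]
    refine integral_congr_ae (Eventually.of_forall fun t => ?_)
    show ∫ x, _ = ∫ ξ, gam g₀ H t ξ * D1 (fun z => E (shearHomeo z)) (t, ξ)
    rw [← integral_add_left_eq_self (fun ξ => gam g₀ H t ξ * D1 (fun z => E (shearHomeo z)) (t,
      ξ)) t]
    refine integral_congr_ae (Eventually.of_forall fun x => ?_)
    simp only [e2, id, add_sub_cancel_left]
    ring
  have hC2 : pairing T (fun t x => gam g₀ H t (id t - x)) (D1 E) +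
      pairing T (fun t x => gam g₀ H t (id t - x)) (D2 E) =
      ∫ t in Ioo 0 T, ∫ x in Ioo 0 (endpt k t), H (t, t + x) * E (t, x) := by
    have e1 := hS.pairing_gam_D1 hT.le hE2 (fun ξ => (hout E hE _).1) (fun ξ => (hout E hE _).2)
    have e2 : ∀ t ξ, D1 (fun z => E (reflHomeo z)) (t, ξ) = D1 E (t, t - ξ) + D2 E (t, t - ξ) := by
      intro t ξ
      have a1 := hasDerivAt_fst hE2.smooth t ξ
      have a2 := hasDerivAt_comp_path hE.smooth (hasDerivAt_id t)
        ((hasDerivAt_id t).sub (hasDerivAt_const t ξ))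
      have a3 := a1.unique a2
      rw [a3]; simp
    have e0 := integral_prod _ ((i2 _ hE.D1).add (i2 _ hE.D2))
    simp only [Pi.add_apply] at e0
    rw [pairing_eq_integral hm2 hm2m hE.D1.memLp, pairing_eq_integral hm2 hm2m hE.D2.memLp,
      ← integral_add (i2 _ hE.D1) (i2 _ hE.D2), e0]
    rw [pairing] at e1
    -- Oddness of the source about `t` turns the contribution of the other family of characteristics
    -- into the negative of the same integral.
    have e3 : ∀ t ∈ Ioo 0 T, ∫ ξ, H (t, ξ) * E (reflHomeo (t, ξ)) =
        - ∫ x in Ioo 0 (endpt k t), H (t, t + x) * E (t, x) := by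
      intro t ht
      rw [← integral_neg, ← integral_sub_left_eq_self (fun ξ => H (t, ξ) * E (reflHomeo (t, ξ)))
        volume t]
      have := integral_Ioo_eq_of_isTest hE (fun t x => H (t, t - x)) t
      simp only [reflHomeo_apply, sub_sub_cancel]
      rw [← this]
      refine setIntegral_congr_fun measurableSet_Ioo fun x hx => ?_
      simp only [hR.odd t ht x hx]
      ring
    rw [setIntegral_congr_fun measurableSet_Ioo e3, integral_neg, neg_neg] at e1
    rw [← e1]
    refine integral_congr_ae (Eventually.of_forall fun t => ?_)
    show ∫ x, _ = ∫ ξ, gam g₀ H t ξ * D1 (fun z => E (reflHomeo z)) (t, ξ)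
    rw [← integral_sub_left_eq_self (fun ξ => gam g₀ H t ξ * D1 (fun z => E (reflHomeo z)) (t, ξ))
      volume t]
    refine integral_congr_ae (Eventually.of_forall fun x => ?_)
    simp only [e2, id, sub_sub_cancel]
    ring
  have hfin : ∫ t in Ioo 0 T, ∫ x in Ioo 0 (endpt k t),
      posF g₀ H t x * (D1 (D1 E) (t, x) - D2 (D2 E) (t, x)) =
      pairing T (cut k (posF g₀ H)) (D1 (D1 E)) - pairing T (cut k (posF g₀ H)) (D2 (D2 E)) := by
    have hF : IsTest (domainQ k T) (fun z => D1 (D1 E) z + -1 * D2 (D2 E) z) :=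
      hE.D1.D1.add (hE.D2.D2.smul (-1))
    have a1 := iterated_eq_pairing hF (posF g₀ H)
    have i3 := fun (F : ℝ × ℝ → ℝ) (hF : IsTest (domainQ k T) F) => integrable_strip hP hPm hF.memLp
    have a2 : pairing T (posF g₀ H) (fun z => D1 (D1 E) z + -1 * D2 (D2 E) z) =
        pairing T (cut k (posF g₀ H)) (fun z => D1 (D1 E) z + -1 * D2 (D2 E) z) := by
      simp only [pairing]
      simp_rw [hcut _ _ hF]
    rw [pairing_eq_integral hP hPm hE.D1.D1.memLp, pairing_eq_integral hP hPm hE.D2.D2.memLp,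
      ← integral_sub (i3 _ hE.D1.D1) (i3 _ hE.D2.D2)]
    rw [a2, pairing_eq_integral hP hPm hF.memLp] at a1
    simp only [neg_one_mul, ← sub_eq_add_neg] at a1
    rw [a1]
    refine integral_congr_ae (Eventually.of_forall fun z => ?_)
    simp only
    ring
  -- Each family of characteristics contributes half of the source term.
  rw [hfin, hA, hB, hV', hG']
  linarith

end MovingWave

/-! ### The normal derivative at the fixed endpoint. -/

namespace MovingWave

variable {k T : ℝ} {g₀ : ℝ → ℝ} {H : ℝ × ℝ → ℝ}

theorem tendsto_eLpNorm_translate {f : ℝ → ℝ} (hf : MemLp f 2 volume) :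
    Tendsto (fun z : ℝ => eLpNorm (fun t => f (t + z) - f t) 2 volume) (𝓝 0) (𝓝 0) := by
  have h := ((L2Cont.const (X := ℝ) (s := univ) hf).comp_add continuous_id).cont.continuousAt
    (x := (0 : ℝ)) univ_mem
  rw [ContinuousAt, tendsto_iff_norm_sub_tendsto_zero] at h
  have hm : ∀ z : ℝ, MemLp (fun t => f (z + t)) 2 volume := fun z =>
    hf.comp_measurePreserving (measurePreserving_add_left volume z)
  refine (ENNReal.tendsto_toReal_iff (fun z => ?_) ENNReal.zero_ne_top).1 ?_
  · have := (hm z).sub hf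
    simp_rw [add_comm z] at this
    exact this.2.ne
  · rw [ENNReal.toReal_zero]
    refine h.congr fun z => ?_
    rw [norm_toLR_sub (hm _) (hm _)]
    congr 2
    ext t
    simp [add_comm]

theorem tendsto_eLpNorm_translate_snd {f : ℝ × ℝ → ℝ} (hf : MemLp f 2 volume) :
    Tendsto (fun z : ℝ => eLpNorm (fun p => f (p.1, p.2 + z) - f p) 2 volume) (𝓝 0) (𝓝 0) := by
  have hp : ∀ z : ℝ, MeasurePreserving (fun p : ℝ × ℝ => (p.1, p.2 + z)) volume volume := by
    intro z
    have := measurePreserving_add_right (volume : Measure (ℝ × ℝ)) (0, z)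
    convert this using 1
    ext p <;> simp
  have hm : ∀ z : ℝ, MemLp (fun p : ℝ × ℝ => f (p.1, p.2 + z)) 2 volume := fun z =>
    hf.comp_measurePreserving (hp z)
  have hg : Continuous fun z : ℝ => (⟨fun p : ℝ × ℝ => (p.1, p.2 + z), by fun_prop⟩ :
      C(ℝ × ℝ, ℝ × ℝ)) :=
    ContinuousMap.continuous_of_continuous_uncurry _
      (by simp only [Function.uncurry_def, ContinuousMap.coe_mk]; fun_prop)
  have h := (Continuous.compMeasurePreservingLp (f := fun _ : ℝ => hf.toLp f)
    continuous_const hg hp (by simp)).tendsto 0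
  rw [tendsto_iff_norm_sub_tendsto_zero] at h
  refine (ENNReal.tendsto_toReal_iff (fun z => ((hm z).sub hf).2.ne) ENNReal.zero_ne_top).1 ?_
  rw [ENNReal.toReal_zero]
  refine h.congr fun z => ?_
  have e : ∀ z, Lp.compMeasurePreserving (fun p : ℝ × ℝ => (p.1, p.2 + z)) (hp z) (hf.toLp f) =
      (hm z).toLp := fun z => rfl
  show ‖Lp.compMeasurePreserving (fun p : ℝ × ℝ => (p.1, p.2 + z)) (hp z) (hf.toLp f) -
    Lp.compMeasurePreserving (fun p : ℝ × ℝ => (p.1, p.2 + 0)) (hp 0) (hf.toLp f)‖ = _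
  rw [e, e, ← MemLp.toLp_sub, Lp.norm_toLp]
  congr 2
  ext p
  simp

/-- Continuity in time of the invariant says nothing about its trace on a diagonal ξ = t + z. With
the constraint `s > t` absorbed into the integrand, Cauchy-Schwarz over `(0, T)` bounds that trace
by the L² norm of the translated source, and bounds its variation in `z` by the corresponding
difference of translates. -/
theorem Source.memLp_diag (hS : Source T g₀ H) (z : ℝ) :
    MemLp (fun t => ∫ s in Ioi t, H (s, t + z)) 2 volume ∧
    ∀ z', eLpNorm (fun t => (∫ s in Ioi t, H (s, t + z)) - ∫ s in Ioi t, H (s, t + z')) 2 volume ^ 2 ≤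
      ENNReal.ofReal T * eLpNorm (fun p : ℝ × ℝ => H (p.1, p.2 + z) - H (p.1, p.2 + z')) 2 volume ^ 2 := by
  have hp : ∀ z : ℝ, MeasurePreserving (fun p : ℝ × ℝ => (p.1, p.2 + z)) volume volume := by
    intro z
    have := measurePreserving_add_right (volume : Measure (ℝ × ℝ)) (0, z)
    convert this using 1
    ext p <;> simp
  have hsm : ∀ z : ℝ, StronglyMeasurable fun p : ℝ × ℝ => H (p.1, p.2 + z) := fun z =>
    hS.meas.comp_measurable (by fun_prop)
  have hsi : ∀ z : ℝ, Integrable (fun p : ℝ × ℝ => H (p.1, p.2 + z)) volume := fun z =>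
    (hp z).integrable_comp_of_integrable hS.int
  have hind : ∀ (F : ℝ × ℝ → ℝ), StronglyMeasurable F → (∀ s, s ∉ Ioo 0 T → ∀ t, F (s, t) = 0) →
      ∫⁻ t : ℝ, ‖∫ s in Ioi t, F (s, t)‖ₑ ^ 2 ≤
        ENNReal.ofReal T * ∫⁻ p : ℝ × ℝ, ‖F p‖ₑ ^ 2 := by
    intro F hF hF0
    set G : ℝ × ℝ → ℝ := {p : ℝ × ℝ | p.2 < p.1}.indicator F
    have hG : StronglyMeasurable G := hF.indicator (measurableSet_lt measurable_snd measurable_fst)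
    have h1 : ∀ t, ∫ s in Ioi t, F (s, t) = ∫ s in Ioo 0 T, G (s, t) := by
      intro t
      rw [← integral_indicator measurableSet_Ioi, ← integral_indicator measurableSet_Ioo]
      congr 1
      ext s
      by_cases hs : s ∈ Ioo 0 T
      · simp [G, indicator, hs.1, hs.2]
      · rw [indicator_of_notMem hs]
        simp [indicator, hF0 s hs]
    simp_rw [h1]
    refine (lintegral_sq_integral_slice_le hG (Ioo 0 T)).trans ?_
    rw [Real.volume_Ioo, sub_zero]
    gcongr
    exact enorm_indicator_le_enorm_self _ _
  have hms : StronglyMeasurable fun t : ℝ => ∫ s in Ioi t, H (s, t + z) := by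
    have h0 : (fun t : ℝ => ∫ s in Ioi t, H (s, t + z)) =
        fun t => g₀ (t + z) - Function.uncurry (gam g₀ H) (t, t + z) := by
      ext t; simp [gam, Function.uncurry]
    rw [h0]
    exact (hS.meas₀.comp_measurable (by fun_prop)).sub
      (hS.stronglyMeasurable_gam.comp_measurable (by fun_prop))
  constructor
  · rw [memLp_two_iff hms.aestronglyMeasurable]
    refine (hind _ (hsm z) (fun s hs t => hS.supp s hs _)).trans_lt ?_
    exact ENNReal.mul_lt_top (by simp)
      ((memLp_two_iff (hsm z).aestronglyMeasurable).1 (hS.memLp.comp_measurePreserving (hp z)))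
  · intro z'
    rw [eLpNorm_two_sq, eLpNorm_two_sq]
    refine le_trans (le_of_eq ?_) (hind _ ((hsm z).sub (hsm z')) (fun s hs t => ?_))
    · refine lintegral_congr_ae ?_
      filter_upwards [ae_slice_integrable (hsi z), ae_slice_integrable (hsi z')] with t h1 h2
      rw [← integral_sub h1.integrableOn h2.integrableOn]
    · simp [hS.supp s hs]

theorem Source.memLp_gam_diag (hS : Source T g₀ H) (z : ℝ) :
    MemLp (fun t => gam g₀ H t (t + z)) 2 volume :=
  (hS.memLp₀.comp_measurePreserving (measurePreserving_add_right volume z)).sub (hS.memLp_diag z).1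

/-- Continuity of translations in L², for the final data on the line and for the source in the
plane. -/
theorem Source.tendsto_gam_diag (hS : Source T g₀ H) :
    Tendsto (fun z : ℝ => eLpNorm (fun t => gam g₀ H t (t + z) - gam g₀ H t t) 2 volume)
      (𝓝 0) (𝓝 0) := by
  have h1 := tendsto_eLpNorm_translate hS.memLp₀
  have h2 := (ENNReal.Tendsto.const_mul (tendsto_eLpNorm_translate_snd hS.memLp)
    (Or.inr (ENNReal.rpow_ne_top_of_nonneg (by norm_num : (0 : ℝ) ≤ 1 / 2)
      (ENNReal.ofReal_ne_top (r := T)))))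
  have h3 := h1.add h2
  rw [mul_zero, add_zero] at h3
  refine tendsto_of_tendsto_of_tendsto_of_le_of_le tendsto_const_nhds h3 (fun z => zero_le) fun z => ?_
  have hd : (fun t => gam g₀ H t (t + z) - gam g₀ H t t) = fun t => (g₀ (t + z) - g₀ t) -
      ((∫ s in Ioi t, H (s, t + z)) - ∫ s in Ioi t, H (s, t + 0)) := by
    ext t; simp only [gam, add_zero]; ring
  simp only [hd]
  have hm0 := (hS.memLp₀.comp_measurePreserving (measurePreserving_add_right volume z)).sub hS.memLp₀
  have hm1 := (hS.memLp_diag z).1.sub (hS.memLp_diag 0).1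
  refine (eLpNorm_sub_le hm0.1 hm1.1 (by norm_num)).trans ?_
  refine add_le_add le_rfl ?_
  have h4 := (hS.memLp_diag z).2 0
  simp only [add_zero] at h4 ⊢
  have h5 := ENNReal.rpow_le_rpow h4 (by norm_num : (0 : ℝ) ≤ 1 / 2)
  rw [ENNReal.mul_rpow_of_nonneg _ _ (by norm_num), ← ENNReal.rpow_natCast, ← ENNReal.rpow_natCast,
    ← ENNReal.rpow_mul, ← ENNReal.rpow_mul] at h5
  norm_num at h5
  exact h5

/-- Difference quotients at the fixed endpoint converge in `L²(0, T)`. -/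
theorem Source.tendsto_difference_quotient (hS : Source T g₀ H) :
    Tendsto (fun x : ℝ => eLpNorm (fun t => posF g₀ H t x / x - gam g₀ H t t) 2 volume)
      (𝓝[>] 0) (𝓝 0) := by
  rw [ENNReal.tendsto_nhds_zero]
  intro ε hε
  have h0 := (ENNReal.tendsto_nhds_zero.1 hS.tendsto_gam_diag) ε hε
  obtain ⟨δ, hδ, hball⟩ := Metric.eventually_nhds_iff.1 h0
  filter_upwards [Ioo_mem_nhdsGT hδ] with x hx
  have hx0 := hx.1
  have hgm := hS.stronglyMeasurable_gam
  set D : ℝ × ℝ → ℝ := fun p => gam g₀ H p.2 (p.2 + p.1) - gam g₀ H p.2 p.2 with hD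
  have hDm : StronglyMeasurable D :=
    (hgm.comp_measurable (g := fun p : ℝ × ℝ => (p.2, p.2 + p.1)) (by fun_prop)).sub
      (hgm.comp_measurable (g := fun p : ℝ × ℝ => (p.2, p.2)) (by fun_prop))
  -- The quotient is the mean of the invariant over (t - x, t + x), an interval of length `2 * x`.
  -- The difference is therefore an average of `D` over shifts of size at most `x`, each small in L²
  -- of the time variable.
  have e1 : ∀ t, posF g₀ H t x / x - gam g₀ H t t =
      (2 * x)⁻¹ * ∫ z in Ioc (-x) x, D (z, t) := by
    intro t
    have hi := hS.integrable_gam t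
    rw [← intervalIntegral.integral_of_le (by linarith)]
    simp only [hD]
    rw [intervalIntegral.integral_sub (hi.comp_add_left t).intervalIntegrable
      intervalIntegrable_const, intervalIntegral.integral_comp_add_left,
      intervalIntegral.integral_const, posF, ← sub_eq_add_neg, smul_eq_mul]
    field_simp
    ring
  simp_rw [e1]
  have hsq : eLpNorm (fun t => (2 * x)⁻¹ * ∫ z in Ioc (-x) x, D (z, t)) 2 volume ^ 2 ≤ ε ^ 2 := by
    rw [eLpNorm_two_sq]
    have hle : ∀ t, ‖(2 * x)⁻¹ * ∫ z in Ioc (-x) x, D (z, t)‖ₑ ^ 2 ≤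
        ENNReal.ofReal (2 * x)⁻¹ * ∫⁻ z in Ioc (-x) x, ‖D (z, t)‖ₑ ^ 2 := by
      intro t
      rw [enorm_mul, mul_pow, Real.enorm_of_nonneg (by positivity)]
      have := enorm_integral_sq_le (μ := volume.restrict (Ioc (-x) x)) (f := fun z => D (z, t))
        (hDm.comp_measurable measurable_prodMk_right).aestronglyMeasurable
      rw [Measure.restrict_apply_univ, Real.volume_Ioc, show x - -x = 2 * x by ring] at this
      refine (mul_le_mul_right this _).trans (le_of_eq ?_)
      rw [← mul_assoc, pow_two, mul_assoc (ENNReal.ofReal _), ← ENNReal.ofReal_mul (by positivity),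
        inv_mul_cancel₀ (by positivity), ENNReal.ofReal_one, mul_one]
    have hDme : Measurable fun p : ℝ × ℝ => ‖D p‖ₑ ^ 2 := hDm.enorm.pow_const 2
    refine (lintegral_mono hle).trans ?_
    rw [lintegral_const_mul _ (Measurable.lintegral_prod_left' hDme),
      lintegral_lintegral_swap (by exact (hDme.comp measurable_swap).aemeasurable)]
    have hz : ∀ z ∈ Ioc (-x) x, ∫⁻ t, ‖D (z, t)‖ₑ ^ 2 ≤ ε ^ 2 := by
      intro z hz
      rw [← eLpNorm_two_sq]
      gcongr
      refine hball ?_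
      rw [Real.dist_eq, sub_zero]
      exact (abs_le.2 ⟨hz.1.le, hz.2⟩).trans_lt hx.2
    refine (mul_le_mul_right (setLIntegral_mono measurable_const hz) _).trans ?_
    rw [setLIntegral_const, Real.volume_Ioc, show x - -x = 2 * x by ring, mul_comm (ε ^ 2),
      ← mul_assoc,
      ← ENNReal.ofReal_mul (by positivity), inv_mul_cancel₀ (by positivity), ENNReal.ofReal_one,
      one_mul]
  exact (ENNReal.pow_le_pow_left_iff (by norm_num)).1 hsq

end MovingWave

/-! ### From reflected sources to finite energy solutions. -/

namespace MovingWave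

variable {k T : ℝ} {g₀ : ℝ → ℝ} {H : ℝ × ℝ → ℝ}

/-- A reflected source generates a finite energy solution. -/
theorem Reflected.exists_energySolution (hR : Reflected k T g₀ H) (hk : 0 < k) (hT : 0 < T) :
    ∃ φ : EnergyPath k, IsEnergySolution k T (fun t x => H (t, t + x)) φ ∧
      (∀ t ∈ Icc 0 T, H01.grad _ (φ.pos t) =ᵐ[volume.restrict (Ioo 0 (endpt k t))] gradF g₀ H t) ∧
      (∀ t ∈ Icc 0 T, φ.vel t =ᵐ[volume.restrict (Ioo 0 (endpt k t))] velF g₀ H t) ∧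
      ∃ g : L2 T, HasNormalDeriv k T φ g ∧
        g =ᵐ[volume.restrict (Ioo 0 T)] fun t => - gam g₀ H t t := by
  have hS := hR.toSource
  have hG : ∀ t, MemLp (gradF g₀ H t) 2 volume := fun t => (hS.l2Cont_gradF univ).memLp t (mem_univ t)
  have hV : ∀ t, MemLp (velF g₀ H t) 2 volume := fun t => (hS.l2Cont_velF univ).memLp t (mem_univ t)
  have hex : ∀ t, ∃ p : H01 (endpt k t), t ∈ Icc 0 T →
      (∀ x ∈ Icc 0 (endpt k t), p x = posF g₀ H t x) ∧ H01.grad _ p = ((hG t).restrict _).toLp := by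
    intro t
    by_cases ht : t ∈ Icc 0 T
    · have h0 : ∫ x in (0 : ℝ)..endpt k t, gradF g₀ H t x = 0 := by
        rw [integral_gradF hS, posF, hR.mean t ht, mul_zero]
      obtain ⟨p, hp, hp'⟩ := exists_H01_primitive (endpt_pos hk.le ht.1)
        ((hG t).restrict (Ioo 0 (endpt k t))) h0
      exact ⟨p, fun _ => ⟨fun x hx => by rw [hp x hx, integral_gradF hS], hp'⟩⟩
    -- Times outside `[0, T]` carry no condition, so any value serves.
    · exact ⟨0, fun h => (ht h).elim⟩
  choose p hp using hex
  set φ : EnergyPath k := ⟨p, fun t => ((hV t).restrict _).toLp⟩ with hφ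
  have hgrad : ∀ t ∈ Icc 0 T,
      H01.grad _ (φ.pos t) =ᵐ[volume.restrict (Ioo 0 (endpt k t))] gradF g₀ H t := by
    intro t ht
    show H01.grad _ (p t) =ᵐ[_] _
    rw [(hp t ht).2]
    exact MemLp.coeFn_toLp _
  have hvel : ∀ t, φ.vel t =ᵐ[volume.restrict (Ioo 0 (endpt k t))] velF g₀ H t := fun t =>
    MemLp.coeFn_toLp ((hV t).restrict _)
  have hpos : ∀ t ∈ Icc 0 T, extZero (φ.pos t).toL2 = toLR (cut k (posF g₀ H) t) := by
    intro t ht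
    have h1 : (φ.pos t).toL2 =ᵐ[volume.restrict (Ioo 0 (endpt k t))] posF g₀ H t := by
      refine (MemLp.coeFn_toLp (φ.pos t).memLp).trans ?_
      rw [EventuallyEq, ae_restrict_iff' measurableSet_Ioo]
      exact Eventually.of_forall fun x hx => (hp t ht).1 x (Ioo_subset_Icc_self hx)
    rw [extZero_eq_of h1]; rfl
  refine ⟨φ, ⟨?_, ?_, ?_, ?_⟩, hgrad, fun t _ => hvel t, ?_⟩
  · exact (((hS.l2Cont_gradF (Icc 0 T)).cut k).cont).congr fun t ht => extZero_eq_of (hgrad t ht)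
  · exact (((hS.l2Cont_velF (Icc 0 T)).cut k).cont).congr fun t _ => extZero_eq_of (hvel t)
  · intro t ht
    rw [extZero_eq_of (hvel t)]
    exact (hR.hasDerivWithinAt_cut_posF hk ht).congr hpos (hpos t ht)
  · intro η hη1 hη2 hη3
    have hE : IsTest (domainQ k T) (Function.uncurry η) := ⟨hη1, hη2, hη3⟩
    have h1 := hR.weak_equation hk hT hE
    simp only [Function.uncurry_apply_pair] at h1
    rw [← h1]
    refine setIntegral_congr_fun measurableSet_Ioo fun t ht => ?_
    refine setIntegral_congr_fun measurableSet_Ioo fun x hx => ?_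
    have e1 := iteratedDeriv_two_fst hη1 t x
    have e2 := iteratedDeriv_two_snd hη1 t x
    simp only [Function.uncurry_apply_pair] at e1 e2
    simp only [e1]
    rw [show iteratedDeriv 2 (η t) x = _ from e2]
    congr 1
    exact (hp t (Ioo_subset_Icc_self ht)).1 x (Ioo_subset_Icc_self hx)
  · have hm : MemLp (fun t => - gam g₀ H t t) 2 volume := by
      have := (hS.memLp_gam_diag 0).neg
      simp only [add_zero] at this
      exact this
    refine ⟨(hm.restrict _).toLp, ?_, MemLp.coeFn_toLp _⟩
    refine tendsto_of_tendsto_of_tendsto_of_le_of_le' tendsto_const_nhds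
      hS.tendsto_difference_quotient (Eventually.of_forall fun _ => zero_le) ?_
    -- The string has length at least 1 at every nonnegative time, so a single `x < 1` lies inside
    -- it throughout `(0, T)`.
    filter_upwards [Ioo_mem_nhdsGT (one_pos)] with x hx
    have h1 : eLpNorm (fun t => (φ.pos t 0 - φ.pos t x) / x -
        ((hm.restrict (Ioo 0 T)).toLp (fun t => - gam g₀ H t t) : L2 T) t) 2
        (volume.restrict (Ioo 0 T)) =
        eLpNorm (fun t => posF g₀ H t x / x - gam g₀ H t t) 2 (volume.restrict (Ioo 0 T)) := by
      rw [← eLpNorm_neg]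
      refine eLpNorm_congr_ae ?_
      filter_upwards [MemLp.coeFn_toLp (hm.restrict (Ioo 0 T)), ae_restrict_mem measurableSet_Ioo]
        with t ht htT
      have hL : 1 ≤ endpt k t := by
        have := htT.1
        simp only [endpt]; nlinarith
      have e0 : φ.pos t 0 = 0 := (φ.pos t).2.1 0 (by simp)
      have e1 : φ.pos t x = posF g₀ H t x :=
        (hp t (Ioo_subset_Icc_self htT)).1 x ⟨hx.1.le, hx.2.le.trans hL⟩
      simp only [Pi.neg_apply, ht, e0, e1]
      ring
    rw [h1]
    exact eLpNorm_mono_measure _ Measure.restrict_le_self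

end MovingWave

namespace MovingWave

/-! ### Unfolding the reflections at the two endpoints -/

/-- The dilation factor of a reflection at the moving endpoint followed by one at the fixed
endpoint. -/
noncomputable def lam (k : ℝ) : ℝ := (1 + k) / (1 - k)

/-- The dilation of factor `lam k ^ n` about `-1/k`, the time at which the lines x = 0 and x = 1 +
kt meet. -/
noncomputable def dil (k : ℝ) (n : ℕ) (ξ : ℝ) : ℝ := lam k ^ n * ξ + (lam k ^ n - 1) / k

noncomputable def idil (k : ℝ) (n : ℕ) (ξ : ℝ) : ℝ := (lam k ^ n)⁻¹ * ξ + ((lam k ^ n)⁻¹ - 1) / k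

/-- The sum of the reflected copies of a density. -/
noncomputable def unfold (k : ℝ) (N : ℕ) (v : ℝ → ℝ) (ξ : ℝ) : ℝ :=
  ∑ n ∈ Finset.range (N + 1), lam k ^ n * v (dil k n ξ)

/-- The sum of the reflected copies of a function. -/
noncomputable def fold (k : ℝ) (N : ℕ) (w : ℝ → ℝ) (ξ : ℝ) : ℝ :=
  ∑ n ∈ Finset.range (N + 1), w (idil k n ξ)

variable {k T : ℝ} {N : ℕ}

theorem one_lt_lam (hk : 0 < k) (hk1 : k < 1) : 1 < lam k := by
  rw [lam, one_lt_div (by linarith)]; linarith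

theorem lam_pos (hk : 0 < k) (hk1 : k < 1) : 0 < lam k := one_pos.trans (one_lt_lam hk hk1)

theorem dil_add (hk : 0 < k) (n : ℕ) (ξ : ℝ) : dil k n ξ + 1 / k = lam k ^ n * (ξ + 1 / k) := by
  simp only [dil]; field_simp; ring

theorem dil_idil (hk : 0 < k) (hk1 : k < 1) (n : ℕ) (ξ : ℝ) : dil k n (idil k n ξ) = ξ := by
  have := (pow_pos (lam_pos hk hk1) n).ne'
  simp only [dil, idil]; field_simp; ring

theorem idil_dil (hk : 0 < k) (hk1 : k < 1) (n : ℕ) (ξ : ℝ) : idil k n (dil k n ξ) = ξ := by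
  have := (pow_pos (lam_pos hk hk1) n).ne'
  simp only [dil, idil]; field_simp; ring

theorem left_add (hk : 0 < k) (t : ℝ) : t - endpt k t + 1 / k = (1 - k) * (t + 1 / k) := by
  simp only [endpt]; field_simp; ring

theorem right_add (hk : 0 < k) (t : ℝ) : t + endpt k t + 1 / k = (1 + k) * (t + 1 / k) := by
  simp only [endpt]; field_simp; ring

theorem lam_mul (hk1 : k < 1) : lam k * (1 - k) = 1 + k := by
  rw [lam, div_mul_cancel₀]; linarith

/-- The characteristics arriving at and leaving the moving endpoint at time `t` carry the labels `t
+ endpt k t` and `t - endpt k t`, and one dilation takes the latter to the former. The images of the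
section at time `t` under successive dilations therefore abut. -/
theorem dil_succ_left (hk : 0 < k) (hk1 : k < 1) (n : ℕ) (t : ℝ) :
    dil k (n + 1) (t - endpt k t) = dil k n (t + endpt k t) := by
  have h1 := dil_add hk (n + 1) (t - endpt k t)
  have h2 := dil_add hk n (t + endpt k t)
  rw [left_add hk] at h1
  rw [right_add hk, ← lam_mul hk1] at h2
  have : lam k ^ (n + 1) * ((1 - k) * (t + 1 / k)) = lam k ^ n * (lam k * (1 - k) * (t + 1 / k)) := by
    ring
  linarith

/-- Reflected copies lie beyond the moving endpoint. -/
theorem le_dil (hk : 0 < k) (hk1 : k < 1) {t ξ : ℝ} (ht : 0 ≤ t) (hξ : t - endpt k t ≤ ξ) {n : ℕ}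
    (hn : n ≠ 0) : t + endpt k t ≤ dil k n ξ := by
  have h1 := dil_add hk n ξ
  have h2 := right_add hk t
  have h3 := left_add hk t
  have h4 : lam k ≤ lam k ^ n := le_self_pow₀ (one_lt_lam hk hk1).le hn
  have h5 : (1 - k) * (t + 1 / k) ≤ ξ + 1 / k := by linarith
  have h6 : 0 ≤ (1 - k) * (t + 1 / k) := mul_nonneg (by linarith) (by positivity)
  have h7 : lam k * ((1 - k) * (t + 1 / k)) ≤ lam k ^ n * (ξ + 1 / k) :=
    mul_le_mul h4 h5 h6 (pow_pos (lam_pos hk hk1) n).le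
  have h8 := lam_mul hk1
  have h9 : lam k * ((1 - k) * (t + 1 / k)) = (1 + k) * (t + 1 / k) := by rw [← h8]; ring
  linarith

/-- Inside the domain only the unreflected copy is visible: the others are evaluated beyond the
moving endpoint, where `v` vanishes. -/
theorem unfold_eq (hk : 0 < k) (hk1 : k < 1) {t ξ : ℝ} (ht : 0 ≤ t) (hξ : t - endpt k t ≤ ξ)
    {v : ℝ → ℝ} (hv : ∀ y, t + endpt k t ≤ y → v y = 0) : unfold k N v ξ = v ξ := by
  rw [unfold, Finset.sum_eq_single_of_mem 0 (by simp)]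
  · simp [dil]
  · intro n _ hn
    rw [hv _ (le_dil hk hk1 ht hξ hn), mul_zero]

theorem memLp_unfold (hk : 0 < k) (hk1 : k < 1) {v : ℝ → ℝ} (hv : MemLp v 2 volume) :
    MemLp (unfold k N v) 2 volume :=
  memLp_finsetSum _ fun n _ =>
    (memLp_comp_affine hv (pow_pos (lam_pos hk hk1) n).ne' _).const_mul _

theorem integrable_comp_dil (hk : 0 < k) (hk1 : k < 1) {v : ℝ → ℝ} (hv : Integrable v volume)
    (n : ℕ) : Integrable (fun ξ => v (dil k n ξ)) volume :=
  (hv.comp_add_right ((lam k ^ n - 1) / k)).comp_mul_left' (pow_pos (lam_pos hk hk1) n).ne'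

theorem integrable_unfold (hk : 0 < k) (hk1 : k < 1) {v : ℝ → ℝ} (hv : Integrable v volume) :
    Integrable (unfold k N v) volume :=
  integrable_finsetSum _ fun n _ => (integrable_comp_dil hk hk1 hv n).const_mul _

theorem continuous_dil (k : ℝ) (n : ℕ) : Continuous (dil k n) := by unfold dil; fun_prop

theorem continuous_idil (k : ℝ) (n : ℕ) : Continuous (idil k n) := by unfold idil; fun_prop

theorem stronglyMeasurable_unfold {v : ℝ → ℝ} (hv : StronglyMeasurable v) :
    StronglyMeasurable (unfold k N v) := by
  have : unfold k N v = fun ξ => ∑ n ∈ Finset.range (N + 1), lam k ^ n * v (dil k n ξ) := rfl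
  rw [this]
  exact Finset.stronglyMeasurable_fun_sum _ fun n _ =>
    (hv.comp_measurable (continuous_dil k n).measurable).const_mul _

/-- The number of reflections suffices up to time `T`. -/
def Enough (k T : ℝ) (N : ℕ) : Prop := (1 + k) * (T + 1 / k) ≤ lam k ^ (N + 1) * ((1 - k) / k)

theorem exists_enough (hk : 0 < k) (hk1 : k < 1) (T : ℝ) : ∃ N, Enough k T N := by
  have hc : 0 < (1 - k) / k := div_pos (by linarith) hk
  obtain ⟨n, hn⟩ := pow_unbounded_of_one_lt ((1 + k) * (T + 1 / k) / ((1 - k) / k)) (one_lt_lam hk hk1)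
  refine ⟨n, ?_⟩
  rw [div_lt_iff₀ hc] at hn
  refine hn.le.trans ?_
  gcongr
  · exact (one_lt_lam hk hk1).le
  · omega

/-- The quantity `(1 - k) / k` in `Enough` is the distance from `-1/k` to the left end of the
section at time 0, the least such distance over nonnegative times. Applying `N + 1` dilations to it
exceeds the distance to the right end of any section up to `T`. -/
theorem Enough.le_dil (hN : Enough k T N) (hk : 0 < k) (hk1 : k < 1) {s t : ℝ} (ht : 0 ≤ t)
    (hs : s ≤ T) : s + endpt k s ≤ dil k (N + 1) (t - endpt k t) := by
  have h1 := dil_add hk (N + 1) (t - endpt k t)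
  have h2 := right_add hk s
  rw [left_add hk] at h1
  have h3 : (1 - k) / k ≤ (1 - k) * (t + 1 / k) := by
    rw [div_eq_mul_one_div]
    exact mul_le_mul_of_nonneg_left (by linarith) (by linarith)
  have h4 := mul_le_mul_of_nonneg_left h3 (pow_pos (lam_pos hk hk1) (N + 1)).le
  have h5 : (1 + k) * (s + 1 / k) ≤ (1 + k) * (T + 1 / k) :=
    mul_le_mul_of_nonneg_left (by linarith) (by linarith)
  have h6 : (1 + k) * (T + 1 / k) ≤ lam k ^ (N + 1) * ((1 - k) / k) := hN
  linarith

/-- The unfolding of a density with mean zero has mean zero over every earlier section. -/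
theorem integral_unfold (hk : 0 < k) (hk1 : k < 1) (hN : Enough k T N) {s t : ℝ} (ht : 0 ≤ t)
    (hts : t ≤ s) (hs : s ≤ T) {v : ℝ → ℝ} (hv : Integrable v volume)
    (hl : ∀ y, y ≤ s - endpt k s → v y = 0) (hr : ∀ y, s + endpt k s ≤ y → v y = 0)
    (h0 : ∫ y, v y = 0) : ∫ ξ in (t - endpt k t)..(t + endpt k t), unfold k N v ξ = 0 := by
  have hii : ∀ a b, IntervalIntegrable v volume a b := fun a b => hv.intervalIntegrable
  have h1 : ∀ n : ℕ, ∫ ξ in (t - endpt k t)..(t + endpt k t), lam k ^ n * v (dil k n ξ) =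
      ∫ y in (dil k n (t - endpt k t))..(dil k (n + 1) (t - endpt k t)), v y := by
    intro n
    rw [intervalIntegral.integral_const_mul, dil_succ_left hk hk1]
    simp only [dil]
    rw [intervalIntegral.integral_comp_mul_add v (pow_pos (lam_pos hk hk1) n).ne', smul_eq_mul,
      mul_inv_cancel_left₀ (pow_pos (lam_pos hk hk1) n).ne']
  simp only [unfold]
  rw [intervalIntegral.integral_finsetSum fun n _ =>
    ((integrable_comp_dil hk hk1 hv n).const_mul _).intervalIntegrable]
  simp_rw [h1]
  -- The abutting intervals telescope to one integral of `v`, which by `Enough` covers its whole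
  -- support.
  rw [intervalIntegral.sum_integral_adjacent_intervals fun n _ => hii _ _]
  have hd0 : dil k 0 (t - endpt k t) = t - endpt k t := by simp [dil]
  rw [hd0]
  have hle := hN.le_dil hk hk1 ht hs
  have hle2 : t - endpt k t ≤ s - endpt k s := by simp only [endpt]; nlinarith
  have hpos := (endpt_pos hk.le (ht.trans hts))
  rw [intervalIntegral.integral_of_le (by linarith), ← h0]
  refine setIntegral_eq_integral_of_forall_compl_eq_zero fun y hy => ?_
  by_cases hy1 : y ≤ s - endpt k s
  · exact hl y hy1
  · refine hr y ?_
    by_contra hy2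
    exact hy ⟨by linarith, by linarith⟩

/-- The substitution identity for folding and unfolding. -/
theorem integral_fold_mul (hk : 0 < k) (hk1 : k < 1) {w v : ℝ → ℝ} (hw : MemLp w 2 volume)
    (hv : MemLp v 2 volume) : ∫ ξ, fold k N w ξ * v ξ = ∫ s, w s * unfold k N v s := by
  have h1 : ∀ n, MemLp (fun ξ => w (idil k n ξ)) 2 volume := fun n =>
    memLp_comp_affine hw (inv_pos.2 (pow_pos (lam_pos hk hk1) n)).ne' _
  have h2 : ∀ n, MemLp (fun ξ => lam k ^ n * v (dil k n ξ)) 2 volume := fun n =>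
    (memLp_comp_affine hv (pow_pos (lam_pos hk hk1) n).ne' _).const_mul _
  simp only [fold, unfold, Finset.sum_mul, Finset.mul_sum]
  have i1 : ∀ n, Integrable (fun ξ => w (idil k n ξ) * v ξ) volume := fun n =>
    (h1 n).integrable_mul hv
  have i2 : ∀ n, Integrable (fun s => w s * (lam k ^ n * v (dil k n s))) volume := fun n =>
    hw.integrable_mul (h2 n)
  rw [integral_finsetSum _ fun n _ => i1 n, integral_finsetSum _ fun n _ => i2 n]
  refine Finset.sum_congr rfl fun n _ => ?_
  have hp := pow_pos (lam_pos hk hk1) n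
  have h3 := Measure.integral_comp_mul_left (fun x => w (idil k n (x + (lam k ^ n - 1) / k)) *
    v (x + (lam k ^ n - 1) / k)) (lam k ^ n)
  rw [integral_add_right_eq_self (fun x => w (idil k n x) * v x), abs_of_pos (inv_pos.2 hp),
    smul_eq_mul] at h3
  have h4 : ∀ s, w s * (lam k ^ n * v (dil k n s)) = lam k ^ n *
      (w (idil k n (lam k ^ n * s + (lam k ^ n - 1) / k)) *
        v (lam k ^ n * s + (lam k ^ n - 1) / k)) := by
    intro s
    have := idil_dil hk hk1 n s
    simp only [dil] at this
    rw [this, dil]; ring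
  simp_rw [h4]
  rw [integral_const_mul, h3, mul_inv_cancel_left₀ hp.ne']

end MovingWave

/-! ### Reflected data and sources, and solvability with prescribed final data. -/

namespace MovingWave

variable {k T : ℝ} {N : ℕ}

/-- The odd reflection about the fixed endpoint of a source at time `t`. -/
noncomputable def oddRefl (h : ℝ × ℝ → ℝ) (t y : ℝ) : ℝ := h (t, y - t) - h (t, t - y)

/-- The Riemann invariant of final data with strain `e` and velocity `v`. -/
noncomputable def dataRefl (T : ℝ) (e v : ℝ → ℝ) (y : ℝ) : ℝ :=
  e (y - T) + e (T - y) + (v (y - T) - v (T - y))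

noncomputable def srcH (k : ℝ) (N : ℕ) (h : ℝ × ℝ → ℝ) (z : ℝ × ℝ) : ℝ :=
  unfold k N (oddRefl h z.1) z.2

noncomputable def dataG (k : ℝ) (N : ℕ) (T : ℝ) (e v : ℝ → ℝ) : ℝ → ℝ :=
  unfold k N (dataRefl T e v)

theorem map_affine_snd {a : ℝ} (ha : a ≠ 0) (b : ℝ) :
    Measure.map (fun z : ℝ × ℝ => (z.1, a * z.2 + b)) volume =
      ENNReal.ofReal |a⁻¹| • (volume : Measure (ℝ × ℝ)) := by
  have h := Measure.map_prod_map (volume : Measure ℝ) (volume : Measure ℝ) (f := id)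
    (g := fun x : ℝ => a * x + b) measurable_id (by fun_prop)
  rw [Measure.map_id, map_affine_volume ha, Measure.prod_smul_right, ← Measure.volume_eq_prod] at h
  exact h.symm

theorem memLp_comp_affine_snd {p : ℝ≥0∞} {f : ℝ × ℝ → ℝ} (hf : MemLp f p volume) {a : ℝ}
    (ha : a ≠ 0) (b : ℝ) : MemLp (fun z : ℝ × ℝ => f (z.1, a * z.2 + b)) p volume := by
  have h1 : MemLp f p (Measure.map (fun z : ℝ × ℝ => (z.1, a * z.2 + b)) volume) := by
    rw [map_affine_snd ha]
    exact hf.smul_measure (by simp)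
  exact (memLp_map_measure_iff h1.1 (by fun_prop)).1 h1

theorem measurePreserving_shear_sub :
    MeasurePreserving (fun z : ℝ × ℝ => (z.1, z.2 - z.1)) volume volume := by
  rw [Measure.volume_eq_prod]
  refine (MeasurePreserving.id volume).skew_product (g := fun t x => x - t) (by fun_prop) ?_
  exact Eventually.of_forall fun t => (measurePreserving_sub_right volume t).map_eq

theorem measurePreserving_shear_refl :
    MeasurePreserving (fun z : ℝ × ℝ => (z.1, z.1 - z.2)) volume volume := by
  rw [Measure.volume_eq_prod]
  refine (MeasurePreserving.id volume).skew_product (g := fun t x => t - x) (by fun_prop) ?_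
  exact Eventually.of_forall fun t => (Measure.measurePreserving_sub_left volume t).map_eq

/-- A jointly measurable square integrable source, extended by zero. -/
structure IsForce (k T : ℝ) (h : ℝ × ℝ → ℝ) : Prop where
  meas : StronglyMeasurable h
  memLp : MemLp h 2 volume
  supp : ∀ z, z ∉ domainQ k T → h z = 0

/-- A square integrable function on `(0, L)`, extended by zero. -/
structure IsState (L : ℝ) (e : ℝ → ℝ) : Prop where
  meas : StronglyMeasurable e
  memLp : MemLp e 2 volume
  supp : ∀ x, x ∉ Ioo 0 L → e x = 0

theorem isState_indicator {L : ℝ} (f : L2 L) : IsState L ((Ioo 0 L).indicator f) :=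
  ⟨(Lp.stronglyMeasurable f).indicator measurableSet_Ioo, memLp_indicator f,
    fun _ hx => indicator_of_notMem hx _⟩

theorem IsState.integrable {L : ℝ} {e : ℝ → ℝ} (h : IsState L e) : Integrable e volume := by
  have h1 : IntegrableOn e (Ioo 0 L) := (h.memLp.restrict (Ioo 0 L)).integrable (by norm_num)
  exact (integrableOn_iff_integrable_of_support_subset fun x hx => by
    by_contra hx'; exact hx (h.supp x hx')).1 h1

theorem volume_domainQ_lt_top (k T : ℝ) : volume (domainQ k T) < ⊤ := by
  have hsub : domainQ k T ⊆ Icc 0 T ×ˢ Icc 0 (1 + |k| * T) := by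
    rintro ⟨t, x⟩ ⟨ht, hx⟩
    refine ⟨Ioo_subset_Icc_self ht, hx.1.le, hx.2.le.trans ?_⟩
    simp only [endpt]
    have h1 := le_abs_self k
    have h2 : k * t ≤ |k| * t := mul_le_mul_of_nonneg_right h1 ht.1.le
    have h3 : |k| * t ≤ |k| * T := mul_le_mul_of_nonneg_left ht.2.le (abs_nonneg k)
    linarith
  exact (measure_mono hsub).trans_lt (isCompact_Icc.prod isCompact_Icc).measure_lt_top

theorem IsForce.integrable {h : ℝ × ℝ → ℝ} (hh : IsForce k T h) : Integrable h volume := by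
  have : IsFiniteMeasure (volume.restrict (domainQ k T)) :=
    ⟨by rw [Measure.restrict_apply_univ]; exact volume_domainQ_lt_top k T⟩
  have h1 : IntegrableOn h (domainQ k T) := (hh.memLp.restrict (domainQ k T)).integrable (by norm_num)
  exact (integrableOn_iff_integrable_of_support_subset fun x hx => by
    by_contra hx'; exact hx (hh.supp x hx')).1 h1

/-- The exponent is free because both square integrability and integrability are needed. -/
theorem IsForce.memLp_srcH {p : ℝ≥0∞} {h : ℝ × ℝ → ℝ} (hp : MemLp h p volume)
    (hk : 0 < k) (hk1 : k < 1) : MemLp (srcH k N h) p volume := by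
  have h1 : MemLp (fun z : ℝ × ℝ => oddRefl h z.1 z.2) p volume :=
    (hp.comp_measurePreserving measurePreserving_shear_sub).sub
      (hp.comp_measurePreserving measurePreserving_shear_refl)
  have h2 : MemLp (fun z : ℝ × ℝ => ∑ n ∈ Finset.range (N + 1), lam k ^ n *
      oddRefl h z.1 (lam k ^ n * z.2 + (lam k ^ n - 1) / k)) p volume :=
    memLp_finsetSum _ fun n _ =>
      (memLp_comp_affine_snd h1 (pow_pos (lam_pos hk hk1) n).ne' _).const_mul _
  exact h2

theorem stronglyMeasurable_srcH {h : ℝ × ℝ → ℝ} (hh : StronglyMeasurable h) :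
    StronglyMeasurable (srcH k N h) := by
  have : srcH k N h = fun z : ℝ × ℝ => ∑ n ∈ Finset.range (N + 1), lam k ^ n *
    (h (z.1, dil k n z.2 - z.1) - h (z.1, z.1 - dil k n z.2)) := rfl
  rw [this]
  have hd := fun n => continuous_dil k n
  refine Finset.stronglyMeasurable_fun_sum _ fun n _ => StronglyMeasurable.const_mul ?_ _
  exact (hh.comp_measurable (g := fun z : ℝ × ℝ => (z.1, dil k n z.2 - z.1))
      (by have := hd n; exact (by fun_prop : Continuous _).measurable)).sub
    (hh.comp_measurable (g := fun z : ℝ × ℝ => (z.1, z.1 - dil k n z.2))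
      (by have := hd n; exact (by fun_prop : Continuous _).measurable))

theorem integrable_dataRefl {e v : ℝ → ℝ} (he : Integrable e volume) (hv : Integrable v volume) :
    Integrable (dataRefl T e v) volume :=
  ((he.comp_sub_right T).add (he.comp_sub_left T)).add
    ((hv.comp_sub_right T).sub (hv.comp_sub_left T))

theorem memLp_dataRefl {e v : ℝ → ℝ} (he : MemLp e 2 volume) (hv : MemLp v 2 volume) :
    MemLp (dataRefl T e v) 2 volume :=
  ((he.comp_measurePreserving (measurePreserving_sub_right volume T)).add
    (he.comp_measurePreserving (Measure.measurePreserving_sub_left volume T))).add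
    ((hv.comp_measurePreserving (measurePreserving_sub_right volume T)).sub
      (hv.comp_measurePreserving (Measure.measurePreserving_sub_left volume T)))

/-- The strain is reflected evenly and counts twice; the velocity is reflected oddly and cancels. -/
theorem integral_dataRefl {e v : ℝ → ℝ} (he : Integrable e volume) (hv : Integrable v volume) :
    ∫ y, dataRefl T e v y = 2 * ∫ x, e x := by
  have h1 := integral_sub_right_eq_self (μ := volume) e T
  have h2 := integral_sub_left_eq_self e volume T
  have h3 := integral_sub_right_eq_self (μ := volume) v T
  have h4 := integral_sub_left_eq_self v volume T
  have i1 : Integrable (fun y => e (y - T) + e (T - y)) volume :=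
    (he.comp_sub_right T).add (he.comp_sub_left T)
  have i2 : Integrable (fun y => v (y - T) - v (T - y)) volume :=
    (hv.comp_sub_right T).sub (hv.comp_sub_left T)
  simp only [dataRefl]
  rw [integral_add i1 i2,
    integral_add (he.comp_sub_right T) (he.comp_sub_left T),
    integral_sub (hv.comp_sub_right T) (hv.comp_sub_left T), h1, h2, h3, h4]
  ring

/-- Inside the domain the unfolded source equals its unreflected copy, which is antisymmetric about
`ξ = t`. For the moving endpoint the invariant splits into the final data and the source slices at
times `s > t`. Each of these has total integral zero and support in the section of its own time, so
`integral_unfold` carries the vanishing mean back to time `t`. -/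
theorem reflected_of_data (hk : 0 < k) (hk1 : k < 1) (hN : Enough k T N)
    {h : ℝ × ℝ → ℝ} (hh : IsForce k T h) {e v : ℝ → ℝ} (he : IsState (endpt k T) e)
    (hv : IsState (endpt k T) v) (h0 : ∫ x, e x = 0) :
    Reflected k T (dataG k N T e v) (srcH k N h) := by
  have hodd_r : ∀ t y, t + endpt k t ≤ y → 0 ≤ t → oddRefl h t y = 0 := by
    intro t y hy ht
    have := endpt_pos hk.le ht
    rw [oddRefl, hh.supp, hh.supp, sub_zero]
    · exact fun hm => by have := hm.2.1; simp only at this; linarith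
    · exact fun hm => by have := hm.2.2; simp only at this; linarith
  have hodd_l : ∀ t y, y ≤ t - endpt k t → 0 ≤ t → oddRefl h t y = 0 := by
    intro t y hy ht
    have := endpt_pos hk.le ht
    rw [oddRefl, hh.supp, hh.supp, sub_zero]
    · exact fun hm => by have := hm.2.2; simp only at this; linarith
    · exact fun hm => by have := hm.2.1; simp only at this; linarith
  have hS : Source T (dataG k N T e v) (srcH k N h) := by
    refine ⟨?_, ?_, ?_, stronglyMeasurable_srcH hh.meas, IsForce.memLp_srcH hh.memLp hk hk1,
      memLp_one_iff_integrable.1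
        (IsForce.memLp_srcH (memLp_one_iff_integrable.2 hh.integrable) hk hk1), ?_⟩
    · refine stronglyMeasurable_unfold ?_
      exact ((he.meas.comp_measurable (g := fun y => y - T) (by fun_prop)).add
        (he.meas.comp_measurable (g := fun y => T - y) (by fun_prop))).add
        ((hv.meas.comp_measurable (g := fun y => y - T) (by fun_prop)).sub
        (hv.meas.comp_measurable (g := fun y => T - y) (by fun_prop)))
    · exact memLp_unfold hk hk1 (memLp_dataRefl he.memLp hv.memLp)
    · exact integrable_unfold hk hk1 (integrable_dataRefl he.integrable hv.integrable)
    · intro s hs ξ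
      simp only [srcH, unfold, oddRefl]
      refine Finset.sum_eq_zero fun n _ => ?_
      rw [hh.supp _ fun hm => hs hm.1, hh.supp _ fun hm => hs hm.1]
      simp
  refine ⟨hS, ?_, ?_⟩
  · intro t ht x hx
    have hp := hx.1
    have hp2 := hx.2
    have e1 := unfold_eq (N := N) (ξ := t - x) hk hk1 ht.1.le (by linarith)
      (fun y hy => hodd_r t y hy ht.1.le)
    have e2 := unfold_eq (N := N) (ξ := t + x) hk hk1 ht.1.le (by linarith)
      (fun y hy => hodd_r t y hy ht.1.le)
    simp only [srcH, e1, e2, oddRefl]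
    rw [show t - x - t = -x by ring, show t - (t - x) = x by ring, show t + x - t = x by ring,
      show t - (t + x) = -x by ring]
    ring
  · intro t ht
    have hL := endpt_pos hk.le ht.1
    have hLT := endpt_pos hk.le (ht.1.trans ht.2)
    rw [hS.integral_gam_interval t (by linarith)]
    have e1 : ∫ ξ in (t - endpt k t)..(t + endpt k t), dataG k N T e v ξ = 0 := by
      refine integral_unfold hk hk1 hN ht.1 ht.2 le_rfl
        (integrable_dataRefl he.integrable hv.integrable) ?_ ?_ ?_
      · intro y hy
        rw [dataRefl, he.supp _ (fun hm => by have := hm.1; linarith),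
          he.supp _ (fun hm => by have := hm.2; linarith),
          hv.supp _ (fun hm => by have := hm.1; linarith),
          hv.supp _ (fun hm => by have := hm.2; linarith)]
        simp
      · intro y hy
        rw [dataRefl, he.supp _ (fun hm => by have := hm.2; linarith),
          he.supp _ (fun hm => by have := hm.1; linarith),
          hv.supp _ (fun hm => by have := hm.2; linarith),
          hv.supp _ (fun hm => by have := hm.1; linarith)]
        simp
      · rw [integral_dataRefl he.integrable hv.integrable, h0, mul_zero]
    rw [e1, zero_sub, neg_eq_zero]
    refine integral_eq_zero_of_ae ?_
    have hI : ∀ᵐ s : ℝ, Integrable fun x => h (s, x) := hh.integrable.prod_right_ae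
    filter_upwards [ae_restrict_of_ae hI, ae_restrict_mem measurableSet_Ioi] with s hs hst
    by_cases hsT : s ∈ Ioo 0 T
    · refine integral_unfold (v := oddRefl h s) hk hk1 hN ht.1 (le_of_lt hst) hsT.2.le
        ((hs.comp_sub_right s).sub (hs.comp_sub_left s)) (fun y hy => hodd_l s y hy hsT.1.le)
        (fun y hy => hodd_r s y hy hsT.1.le) ?_
      have h1 := integral_sub_right_eq_self (μ := volume) (fun x => h (s, x)) s
      have h2 := integral_sub_left_eq_self (fun x => h (s, x)) volume s
      simp only [oddRefl]
      rw [integral_sub (hs.comp_sub_right s) (hs.comp_sub_left s), h1, h2, sub_self]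
    · have : ∀ ξ, srcH k N h (s, ξ) = 0 := hS.supp s hsT
      simp [this]

theorem IsEnergySolution.congr {h h' : ℝ → ℝ → ℝ} {φ : EnergyPath k}
    (hφ : IsEnergySolution k T h φ)
    (hh : ∀ᵐ t ∂(volume.restrict (Ioo 0 T)), h t =ᵐ[volume.restrict (Ioo 0 (endpt k t))] h' t) :
    IsEnergySolution k T h' φ := by
  refine ⟨hφ.continuousOn_grad, hφ.continuousOn_vel, hφ.hasDeriv, fun η h1 h2 h3 => ?_⟩
  rw [hφ.equation η h1 h2 h3]
  refine integral_congr_ae ?_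
  filter_upwards [hh] with t ht
  refine integral_congr_ae ?_
  filter_upwards [ht] with x hx
  rw [hx]

/-- Solvability of the wave equation in the finite energy class. -/
theorem exists_energySolution_of_force (hk : 0 < k) (hk1 : k < 1) (hT : 0 < T) (hN : Enough k T N)
    {h : ℝ × ℝ → ℝ} (hh : IsForce k T h) (f₀ : H01 (endpt k T)) (f₁ : L2 (endpt k T)) :
    ∃ (φ : EnergyPath k) (g : L2 T), IsEnergySolution k T (fun t x => h (t, x)) φ ∧
      HasNormalDeriv k T φ g ∧ φ.pos T = f₀ ∧ φ.vel T = f₁ ∧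
      g =ᵐ[volume.restrict (Ioo 0 T)] fun t =>
        - gam (dataG k N T ((Ioo 0 (endpt k T)).indicator (H01.grad _ f₀))
            ((Ioo 0 (endpt k T)).indicator f₁)) (srcH k N h) t t := by
  set e := (Ioo 0 (endpt k T)).indicator (H01.grad _ f₀) with he'
  set v := (Ioo 0 (endpt k T)).indicator f₁ with hv'
  have he : IsState (endpt k T) e := isState_indicator _
  have hv : IsState (endpt k T) v := isState_indicator _
  have hL := endpt_pos hk.le hT.le
  have h0 : ∫ x, e x = 0 := by
    have := f₀.integral_grad hL.le
    rw [intervalIntegral.integral_of_le hL.le, integral_Ioc_eq_integral_Ioo] at this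
    rw [he', integral_indicator measurableSet_Ioo, this]
  have hR := reflected_of_data hk hk1 hN hh he hv h0
  obtain ⟨φ, h1, h2, h3, g, h4, h5⟩ := hR.exists_energySolution hk hT
  -- No source lies ahead of the final time.
  have hgT : ∀ ξ, gam (dataG k N T e v) (srcH k N h) T ξ = dataG k N T e v ξ := by
    intro ξ
    rw [gam, setIntegral_eq_zero_of_forall_eq_zero, sub_zero]
    intro s hs
    exact hR.supp s (fun h' => lt_asymm h'.2 hs) ξ
  have hdr : ∀ y, T + endpt k T ≤ y → dataRefl T e v y = 0 := by
    intro y hy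
    rw [dataRefl, he.supp _ (fun hm => by have := hm.2; linarith),
      he.supp _ (fun hm => by have := hm.1; linarith),
      hv.supp _ (fun hm => by have := hm.2; linarith),
      hv.supp _ (fun hm => by have := hm.1; linarith)]
    simp
  have hneg : ∀ (q : ℝ → ℝ), IsState (endpt k T) q → ∀ x ∈ Ioo 0 (endpt k T), q (-x) = 0 :=
    fun q hq x hx => hq.supp _ fun hm => by have := hm.1; have := hx.1; linarith
  -- At `T + x` the invariant is strain plus velocity and at `T - x` it is strain minus velocity;
  -- their half-sum and half-difference return the prescribed data.
  have hplus : ∀ x ∈ Ioo 0 (endpt k T), dataG k N T e v (T + x) = e x + v x := by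
    intro x hx
    rw [dataG, unfold_eq hk hk1 hT.le (by linarith [hx.1]) hdr, dataRefl,
      show T + x - T = x by ring, show T - (T + x) = -x by ring, hneg e he x hx, hneg v hv x hx]
    ring
  have hminus : ∀ x ∈ Ioo 0 (endpt k T), dataG k N T e v (T - x) = e x - v x := by
    intro x hx
    rw [dataG, unfold_eq hk hk1 hT.le (by linarith [hx.2]) hdr, dataRefl,
      show T - x - T = -x by ring, show T - (T - x) = x by ring, hneg e he x hx, hneg v hv x hx]
    ring
  refine ⟨φ, g, h1.congr ?_, h4, ?_, ?_, h5⟩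
  · rw [ae_restrict_iff' measurableSet_Ioo]
    refine Eventually.of_forall fun t ht => ?_
    rw [EventuallyEq, ae_restrict_iff' measurableSet_Ioo]
    refine Eventually.of_forall fun x hx => ?_
    have hx1 := hx.1
    have hLt := endpt_pos hk.le ht.1.le
    simp only [srcH]
    rw [unfold_eq hk hk1 ht.1.le (by linarith), oddRefl, show t + x - t = x by ring,
      show t - (t + x) = -x by ring, hh.supp (t, -x) (fun hm => by have := hm.2.1; simp only at this; linarith),
      sub_zero]
    intro y hy
    rw [oddRefl, hh.supp, hh.supp, sub_zero]
    · exact fun hm => by have := hm.2.1; simp only at this; linarith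
    · exact fun hm => by have := hm.2.2; simp only at this; linarith
  · refine H01.grad_injective _ (Lp.ext ((h2 T ⟨hT.le, le_rfl⟩).trans ?_))
    rw [EventuallyEq, ae_restrict_iff' measurableSet_Ioo]
    refine Eventually.of_forall fun x hx => ?_
    rw [gradF, hgT, hgT, hplus x hx, hminus x hx, he', indicator_of_mem hx]
    ring
  · refine Lp.ext ((h3 T ⟨hT.le, le_rfl⟩).trans ?_)
    rw [EventuallyEq, ae_restrict_iff' measurableSet_Ioo]
    refine Eventually.of_forall fun x hx => ?_
    rw [velF, hgT, hgT, hplus x hx, hminus x hx, hv', indicator_of_mem hx]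
    ring

end MovingWave

namespace MovingWave

/-! ### Waves generated by a boundary datum -/

/-- Approximation by continuous functions of compact support. Factors above `a / 2` enlarge the
approximation error by at most one constant, and for the approximant dominated convergence applies.
-/
theorem tendsto_eLpNorm_comp_mul {f : ℝ → ℝ} (hf : MemLp f 2 volume) {a : ℝ} (ha : 0 < a) :
    Tendsto (fun r => eLpNorm (fun x => f (r * x) - f (a * x)) 2 volume) (𝓝 a) (𝓝 0) := by
  rw [ENNReal.tendsto_nhds_zero]
  intro ε hε
  set C : ℝ≥0∞ := ENNReal.ofReal |(a / 2)⁻¹| ^ (1 / 2 : ℝ) with hC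
  have hCt : C ≠ ⊤ := ENNReal.rpow_ne_top_of_nonneg (by norm_num) ENNReal.ofReal_ne_top
  obtain ⟨δ, hδ, hδε⟩ : ∃ δ : ℝ≥0∞, 0 < δ ∧ C * δ + C * δ + δ ≤ ε := by
    have h1 : Tendsto (fun d : ℝ≥0∞ => C * d + C * d + d) (𝓝 0) (𝓝 (C * 0 + C * 0 + 0)) := by
      have h2 : Tendsto (fun d : ℝ≥0∞ => C * d) (𝓝 0) (𝓝 (C * 0)) :=
        ENNReal.Tendsto.const_mul tendsto_id (Or.inr hCt)
      exact (h2.add h2).add tendsto_id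
    simp only [mul_zero, add_zero] at h1
    have h3 := (ENNReal.tendsto_nhds_zero.1 h1) ε hε
    obtain ⟨d, hd, hd'⟩ := (((h3.filter_mono nhdsWithin_le_nhds).and
      (self_mem_nhdsWithin (a := (0 : ℝ≥0∞)) (s := Ioi 0))).exists)
    exact ⟨d, hd', hd⟩
  obtain ⟨g, hg1, hg2, hg3, hg4⟩ := hf.exists_hasCompactSupport_eLpNorm_sub_le (by simp) hδ.ne'
  have hbd : ∀ r, a / 2 < r → eLpNorm (fun x => (f - g) (r * x)) 2 volume ≤ C * δ := by
    intro r hr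
    have h1 := eLpNorm_comp_affine (f := f - g) (hf.sub hg4).1 (a := r) (by linarith) 0
    simp only [add_zero] at h1
    rw [h1]
    refine mul_le_mul ?_ hg2 (zero_le) (zero_le)
    refine ENNReal.rpow_le_rpow (ENNReal.ofReal_le_ofReal ?_) (by norm_num)
    rw [abs_of_pos (by apply inv_pos.2; linarith), abs_of_pos (by apply inv_pos.2; linarith)]
    exact inv_anti₀ (by linarith) hr.le
  have hgc : Tendsto (fun r => eLpNorm (fun x => g (r * x) - g (a * x)) 2 volume) (𝓝 a) (𝓝 0) := by
    obtain ⟨B, hB⟩ := hg1.exists_bound_of_continuous hg3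
    obtain ⟨R, hR⟩ : ∃ R, ∀ x, R < |x| → g x = 0 := by
      obtain ⟨R, hR⟩ := hg1.isCompact.isBounded.subset_closedBall 0
      refine ⟨R, fun x hx => ?_⟩
      by_contra h
      have := hR (subset_tsupport g h)
      rw [mem_closedBall_zero_iff, Real.norm_eq_abs] at this
      linarith
    simp_rw [eLpNorm_eq_lintegral_rpow_enorm_toReal (p := 2) (by simp) (by simp)]
    have h0 : (0 : ℝ≥0∞) = 0 ^ (1 / (2 : ℝ≥0∞).toReal) := by simp
    rw [h0]
    refine Tendsto.ennrpow_const _ ?_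
    have hz : (0 : ℝ≥0∞) = ∫⁻ x : ℝ, 0 := by simp
    rw [hz]
    set A : ℝ := R / (a / 2) with hA
    refine tendsto_lintegral_filter_of_dominated_convergence'
      ((Icc (-A) A).indicator fun _ => ENNReal.ofReal (B + B) ^ (2 : ℝ≥0∞).toReal) ?_ ?_ ?_ ?_
    · refine Eventually.of_forall fun r => ?_
      have : Continuous fun x => g (r * x) - g (a * x) := by fun_prop
      exact (this.enorm.measurable.pow_const _).aemeasurable
    · filter_upwards [lt_mem_nhds (show a / 2 < a by linarith)] with r hr
      refine Eventually.of_forall fun x => ?_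
      by_cases hx : x ∈ Icc (-A) A
      · rw [indicator_of_mem hx]
        refine ENNReal.rpow_le_rpow ?_ (by simp)
        rw [← ofReal_norm]
        exact ENNReal.ofReal_le_ofReal ((norm_sub_le _ _).trans (add_le_add (hB _) (hB _)))
      · have hx' : A < |x| := by
          rw [mem_Icc, ← abs_le] at hx; exact not_le.1 hx
        have hbig : ∀ r, a / 2 < r → g (r * x) = 0 := by
          intro r hr
          refine hR _ ?_
          rw [hA, div_lt_iff₀ (by linarith)] at hx'
          rw [abs_mul, abs_of_pos (show 0 < r by linarith)]
          nlinarith [abs_nonneg x]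
        rw [hbig r hr, hbig a (by linarith), indicator_of_notMem hx]
        simp
    · rw [lintegral_indicator measurableSet_Icc, lintegral_const]
      refine ENNReal.mul_ne_top (by simp) ?_
      simp
    · refine Eventually.of_forall fun x => ?_
      have : Continuous fun r => ‖g (r * x) - g (a * x)‖ₑ ^ (2 : ℝ≥0∞).toReal :=
        ENNReal.continuous_rpow_const.comp (by fun_prop)
      have h2 := this.tendsto a
      simpa using h2
  filter_upwards [lt_mem_nhds (show a / 2 < a by linarith),
    (ENNReal.tendsto_nhds_zero.1 hgc) δ hδ] with r hr hr2
  have hm : ∀ r : ℝ, a / 2 < r → AEStronglyMeasurable (fun x => (f - g) (r * x)) volume := by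
    intro r hr
    have := (memLp_comp_affine (hf.sub hg4) (a := r) (by linarith) 0).1
    simpa only [add_zero] using this
  have heq : (fun x => f (r * x) - f (a * x)) = ((fun x => (f - g) (r * x)) -
      fun x => (f - g) (a * x)) + fun x => g (r * x) - g (a * x) := by
    ext x; simp only [Pi.add_apply, Pi.sub_apply]; ring
  rw [heq]
  refine (eLpNorm_add_le ((hm r hr).sub (hm a (by linarith)))
    (by fun_prop : Continuous _).aestronglyMeasurable (by norm_num)).trans (le_trans ?_ hδε)
  refine add_le_add ?_ hr2
  exact (eLpNorm_sub_le (hm r hr) (hm a (by linarith)) (by norm_num)).trans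
    (add_le_add (hbd r hr) (hbd a (by linarith)))

theorem L2Cont.comp_mul {X : Type*} [TopologicalSpace X] {m : X → ℝ → ℝ} {s : Set X}
    (h : L2Cont m s) {a : X → ℝ} (ha : Continuous a) (hpos : ∀ t ∈ s, 0 < a t) :
    L2Cont (fun t x => m t (a t * x)) s := by
  have hmem : ∀ t ∈ s, ∀ r : ℝ, 0 < r → MemLp (fun x => m t (r * x)) 2 volume := by
    intro t ht r hr
    have := memLp_comp_affine (h.memLp t ht) (a := r) hr.ne' 0
    simpa only [add_zero] using this
  refine ⟨fun t ht => hmem t ht _ (hpos t ht), fun t ht => ?_⟩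
  have hc := h.cont t ht
  rw [ContinuousWithinAt, tendsto_iff_norm_sub_tendsto_zero] at hc ⊢
  have h2 : Tendsto (fun r => ‖toLR (fun x => m t (a r * x)) - toLR (fun x => m t (a t * x))‖)
      (𝓝[s] t) (𝓝 0) := by
    have := (ENNReal.tendsto_toReal ENNReal.zero_ne_top).comp
      ((tendsto_eLpNorm_comp_mul (h.memLp t ht) (hpos t ht)).comp
        (ha.continuousAt.tendsto.mono_left (nhdsWithin_le_nhds (s := s))))
    refine this.congr' ?_
    filter_upwards [self_mem_nhdsWithin] with r hr
    rw [norm_toLR_sub (hmem t ht _ (hpos r hr)) (hmem t ht _ (hpos t ht))]; rfl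
  have h3 : Tendsto (fun r => (ENNReal.ofReal |(a t / 2)⁻¹| ^ (1 / 2 : ℝ)).toReal *
      ‖toLR (m r) - toLR (m t)‖) (𝓝[s] t) (𝓝 0) := by
    simpa using hc.const_mul (ENNReal.ofReal |(a t / 2)⁻¹| ^ (1 / 2 : ℝ)).toReal
  have h4 := h3.add h2
  rw [add_zero] at h4
  refine squeeze_zero' (Eventually.of_forall fun _ => norm_nonneg _) ?_ h4
  have hpt := hpos t ht
  have hev : ∀ᶠ r in 𝓝[s] t, a t / 2 < a r :=
    (ha.continuousAt.eventually (lt_mem_nhds (show a t / 2 < a t by linarith))).filter_mono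
      nhdsWithin_le_nhds
  filter_upwards [self_mem_nhdsWithin, hev] with r hr hr2
  refine (norm_sub_le_norm_sub_add_norm_sub _ (toLR fun x => m t (a r * x)) _).trans ?_
  refine add_le_add_left ?_ _
  rw [norm_toLR_sub (hmem r hr _ (hpos r hr)) (hmem t ht _ (hpos r hr)),
    norm_toLR_sub (h.memLp r hr) (h.memLp t ht), ← ENNReal.toReal_mul]
  have h5 := eLpNorm_comp_affine (f := m r - m t) ((h.memLp r hr).sub (h.memLp t ht)).1
    (a := a r) (hpos r hr).ne' 0
  simp only [add_zero] at h5
  refine ENNReal.toReal_mono (ENNReal.mul_ne_top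
    (ENNReal.rpow_ne_top_of_nonneg (by norm_num) ENNReal.ofReal_ne_top)
    ((h.memLp r hr).sub (h.memLp t ht)).2.ne) (h5.le.trans ?_)
  refine mul_le_mul ?_ le_rfl (zero_le) (zero_le)
  refine ENNReal.rpow_le_rpow (ENNReal.ofReal_le_ofReal ?_) (by norm_num)
  rw [abs_of_pos (inv_pos.2 (hpos r hr)), abs_of_pos (by apply inv_pos.2; linarith)]
  exact inv_anti₀ (by linarith) hr2.le

variable {k T : ℝ} {N : ℕ}

/-- The superposition of the reflections of the part of the signal `w` emitted before time `t`. -/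
noncomputable def foldW (k : ℝ) (N : ℕ) (w : ℝ → ℝ) (t ξ : ℝ) : ℝ :=
  fold k N ((Ioo 0 t).indicator w) ξ

/-- The displacement generated by the boundary signal `w`. -/
noncomputable def waveU (k : ℝ) (N : ℕ) (w : ℝ → ℝ) (t x : ℝ) : ℝ :=
  foldW k N w t (t - x) - foldW k N w t (t + x)

/-- Minus the potential of the velocity generated by the boundary signal `w`. -/
noncomputable def waveV (k : ℝ) (N : ℕ) (w : ℝ → ℝ) (t x : ℝ) : ℝ :=
  foldW k N w t (t - x) + foldW k N w t (t + x)

theorem l2Cont_foldW (hk : 0 < k) (hk1 : k < 1) {w : ℝ → ℝ} (hw : MemLp w 2 volume) (s : Set ℝ) :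
    L2Cont (foldW k N w) s := by
  have h1 : L2Cont (fun t => (Ioo 0 t).indicator w) s :=
    (L2Cont.const hw).indicator continuous_const continuous_id
  exact L2Cont.sum (Finset.range (N + 1)) fun n _ =>
    h1.comp_affine (inv_pos.2 (pow_pos (lam_pos hk hk1) n)).ne' (((lam k ^ n)⁻¹ - 1) / k)

theorem l2Cont_waveU (hk : 0 < k) (hk1 : k < 1) {w : ℝ → ℝ} (hw : MemLp w 2 volume) (s : Set ℝ) :
    L2Cont (waveU k N w) s :=
  ((l2Cont_foldW hk hk1 hw s).comp_sub continuous_id).sub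
    ((l2Cont_foldW hk hk1 hw s).comp_add continuous_id)

theorem l2Cont_waveV (hk : 0 < k) (hk1 : k < 1) {w : ℝ → ℝ} (hw : MemLp w 2 volume) (s : Set ℝ) :
    L2Cont (waveV k N w) s :=
  ((l2Cont_foldW hk hk1 hw s).comp_sub continuous_id).add
    ((l2Cont_foldW hk hk1 hw s).comp_add continuous_id)

theorem stronglyMeasurable_foldW {w : ℝ → ℝ} (hw : StronglyMeasurable w) :
    StronglyMeasurable (Function.uncurry (foldW k N w)) := by
  have h1 : Function.uncurry (foldW k N w) = fun z : ℝ × ℝ => ∑ n ∈ Finset.range (N + 1),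
      {z : ℝ × ℝ | idil k n z.2 ∈ Ioo 0 z.1}.indicator (fun z => w (idil k n z.2)) z := by
    ext z; simp [Function.uncurry, foldW, fold, indicator]
  rw [h1]
  refine Finset.stronglyMeasurable_fun_sum _ fun n _ => ?_
  have hm : Measurable fun z : ℝ × ℝ => idil k n z.2 :=
    (continuous_idil k n).measurable.comp measurable_snd
  exact (hw.comp_measurable hm).indicator
    ((measurableSet_lt measurable_const hm).inter (measurableSet_lt hm measurable_fst))

theorem stronglyMeasurable_waveU {w : ℝ → ℝ} (hw : StronglyMeasurable w) :
    StronglyMeasurable (Function.uncurry (waveU k N w)) := by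
  have h := stronglyMeasurable_foldW (k := k) (N := N) hw
  exact (h.comp_measurable (g := fun z : ℝ × ℝ => (z.1, z.1 - z.2)) (by fun_prop)).sub
    (h.comp_measurable (g := fun z : ℝ × ℝ => (z.1, z.1 + z.2)) (by fun_prop))

theorem memLp_foldW (hk : 0 < k) (hk1 : k < 1) {w : ℝ → ℝ} (hw : MemLp w 2 volume) (t : ℝ) :
    MemLp (foldW k N w t) 2 volume := (l2Cont_foldW hk hk1 hw univ).memLp t (mem_univ t)

theorem integral_foldW_add_mul (f : ℝ → ℝ) (e : ℝ → ℝ) (t : ℝ) :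
    ∫ x, f (t + x) * e x = ∫ y, f y * e (y - t) := by
  rw [← integral_add_left_eq_self (fun y => f y * e (y - t)) t]
  simp

theorem integral_foldW_sub_mul (f : ℝ → ℝ) (e : ℝ → ℝ) (t : ℝ) :
    ∫ x, f (t - x) * e x = ∫ y, f y * e (t - y) := by
  rw [← integral_sub_left_eq_self (fun y => f y * e (t - y)) volume t]
  simp

/-- Reflection of the test function moves the pairing to the characteristic variable, where folding
the signal is adjoint to unfolding the test function. The displacement sees the odd reflection; the
velocity potential `waveV` sees the even one. -/
theorem integral_waveU_mul (hk : 0 < k) (hk1 : k < 1) {w e : ℝ → ℝ} (hw : MemLp w 2 volume)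
    (he : MemLp e 2 volume) (t : ℝ) : ∫ x, waveU k N w t x * e x =
      - ∫ s, (Ioo 0 t).indicator w s * unfold k N (fun y => e (y - t) - e (t - y)) s := by
  have hM := memLp_foldW (N := N) hk hk1 hw t
  have e1 := he.comp_measurePreserving (measurePreserving_sub_right volume t)
  have e2 := he.comp_measurePreserving (Measure.measurePreserving_sub_left volume t)
  have m1 := hM.comp_measurePreserving (measurePreserving_add_left volume t)
  have m2 := hM.comp_measurePreserving (Measure.measurePreserving_sub_left volume t)
  have e3 : MemLp (fun y => e (y - t) - e (t - y)) 2 volume := e1.sub e2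
  rw [← integral_fold_mul hk hk1 (hw.indicator measurableSet_Ioo) e3]
  have i1 : Integrable (fun y => foldW k N w t y * e (y - t)) volume := hM.integrable_mul e1
  have i2 : Integrable (fun y => foldW k N w t y * e (t - y)) volume := hM.integrable_mul e2
  have i3 : Integrable (fun x => foldW k N w t (t + x) * e x) volume := m1.integrable_mul he
  have i4 : Integrable (fun x => foldW k N w t (t - x) * e x) volume := m2.integrable_mul he
  have h1 : ∀ ξ, fold k N ((Ioo 0 t).indicator w) ξ * (e (ξ - t) - e (t - ξ)) =
      foldW k N w t ξ * e (ξ - t) - foldW k N w t ξ * e (t - ξ) := fun ξ => by rw [foldW]; ring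
  have h2 : ∀ x, waveU k N w t x * e x =
      foldW k N w t (t - x) * e x - foldW k N w t (t + x) * e x := fun x => by rw [waveU]; ring
  simp_rw [h2]
  simp_rw [h1]
  rw [integral_sub i4 i3, integral_sub i1 i2, integral_foldW_add_mul (foldW k N w t),
    integral_foldW_sub_mul (foldW k N w t)]
  ring

theorem integral_waveV_mul (hk : 0 < k) (hk1 : k < 1) {w e : ℝ → ℝ} (hw : MemLp w 2 volume)
    (he : MemLp e 2 volume) (t : ℝ) : ∫ x, waveV k N w t x * e x =
      ∫ s, (Ioo 0 t).indicator w s * unfold k N (fun y => e (y - t) + e (t - y)) s := by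
  have hM := memLp_foldW (N := N) hk hk1 hw t
  have e1 := he.comp_measurePreserving (measurePreserving_sub_right volume t)
  have e2 := he.comp_measurePreserving (Measure.measurePreserving_sub_left volume t)
  have m1 := hM.comp_measurePreserving (measurePreserving_add_left volume t)
  have m2 := hM.comp_measurePreserving (Measure.measurePreserving_sub_left volume t)
  have e3 : MemLp (fun y => e (y - t) + e (t - y)) 2 volume := e1.add e2
  rw [← integral_fold_mul hk hk1 (hw.indicator measurableSet_Ioo) e3]
  have i1 : Integrable (fun y => foldW k N w t y * e (y - t)) volume := hM.integrable_mul e1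
  have i2 : Integrable (fun y => foldW k N w t y * e (t - y)) volume := hM.integrable_mul e2
  have i3 : Integrable (fun x => foldW k N w t (t + x) * e x) volume := m1.integrable_mul he
  have i4 : Integrable (fun x => foldW k N w t (t - x) * e x) volume := m2.integrable_mul he
  have h1 : ∀ ξ, fold k N ((Ioo 0 t).indicator w) ξ * (e (ξ - t) + e (t - ξ)) =
      foldW k N w t ξ * e (ξ - t) + foldW k N w t ξ * e (t - ξ) := fun ξ => by rw [foldW]; ring
  have h2 : ∀ x, waveV k N w t x * e x =
      foldW k N w t (t - x) * e x + foldW k N w t (t + x) * e x := fun x => by rw [waveV]; ring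
  simp_rw [h2]
  simp_rw [h1]
  rw [integral_add i4 i3, integral_add i1 i2, integral_foldW_add_mul (foldW k N w t),
    integral_foldW_sub_mul (foldW k N w t)]
  ring

end MovingWave

/-! ### The explicit solution by transposition. -/

namespace MovingWave

variable {k T : ℝ} {N : ℕ}

/-- The class in `L²(0, L)` of a square integrable function. -/
noncomputable def restr (L : ℝ) (f : ℝ → ℝ) : L2 L :=
  ((Lp.memLp (toLR f)).restrict (Ioo 0 L)).toLp

theorem coeFn_restr (L : ℝ) {f : ℝ → ℝ} (hf : MemLp f 2 volume) :
    restr L f =ᵐ[volume.restrict (Ioo 0 L)] f :=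
  (MemLp.coeFn_toLp _).trans (ae_restrict_of_ae (coeFn_toLR hf))

/-- The derivative as a bounded operator. -/
noncomputable def gradL (L : ℝ) : H01 L →L[ℝ] L2 L :=
  (H01.grad L).mkContinuous 1 fun f => by rw [one_mul, H01.norm_eq]

theorem inner_L2 {L : ℝ} (f g : L2 L) : inner ℝ f g = ∫ x in Ioo 0 L, f x * g x := by
  rw [L2.inner_def]
  exact integral_congr_ae (Eventually.of_forall fun x => by simp [mul_comm])

theorem setIntegral_mul_eq {L : ℝ} (f g : ℝ → ℝ) :
    ∫ x in Ioo 0 L, f x * g x = ∫ x, f x * (Ioo 0 L).indicator g x := by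
  rw [← integral_indicator measurableSet_Ioo]
  refine integral_congr_ae (Eventually.of_forall fun x => ?_)
  by_cases hx : x ∈ Ioo 0 L <;> simp [hx]

theorem norm_restr_sub_le (L : ℝ) {f g : ℝ → ℝ} (hf : MemLp f 2 volume) (hg : MemLp g 2 volume) :
    ‖restr L f - restr L g‖ ≤ ‖toLR f - toLR g‖ := by
  rw [norm_toLR_sub hf hg, Lp.norm_def]
  refine ENNReal.toReal_mono (hf.sub hg).2.ne ?_
  refine (eLpNorm_congr_ae ((Lp.coeFn_sub _ _).trans
    ((coeFn_restr L hf).sub (coeFn_restr L hg)))).le.trans ?_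
  exact eLpNorm_mono_measure _ Measure.restrict_le_self

theorem restr_zero (L : ℝ) : restr L (fun _ => 0) = 0 := by
  refine Lp.ext ((coeFn_restr L (MemLp.zero (p := 2))).trans ?_)
  exact (Lp.coeFn_zero _ _ _).symm

/-- The path generated by the boundary signal `w`. -/
noncomputable def wave (k : ℝ) (N : ℕ) (w : ℝ → ℝ) : TranspPath k where
  pos t := restr (endpt k t) (waveU k N w t)
  vel t := (innerSL ℝ (restr (endpt k t) (waveV k N w t))).comp (gradL (endpt k t))

variable {w : ℝ → ℝ}

theorem wave_pos_ae (hk : 0 < k) (hk1 : k < 1) (hw : MemLp w 2 volume) (t : ℝ) :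
    (wave k N w).pos t =ᵐ[volume.restrict (Ioo 0 (endpt k t))] waveU k N w t :=
  coeFn_restr _ ((l2Cont_waveU hk hk1 hw univ).memLp t (mem_univ t))

theorem wave_vel_apply (hk : 0 < k) (hk1 : k < 1) (hw : MemLp w 2 volume) (t : ℝ)
    (f : H01 (endpt k t)) : (wave k N w).vel t f =
      ∫ x, waveV k N w t x * (Ioo 0 (endpt k t)).indicator (H01.grad _ f) x := by
  show inner ℝ (restr (endpt k t) (waveV k N w t)) (H01.grad _ f) = _
  rw [inner_L2, ← setIntegral_mul_eq]
  refine integral_congr_ae ?_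
  filter_upwards [coeFn_restr (endpt k t)
    ((l2Cont_waveV (N := N) hk hk1 hw univ).memLp t (mem_univ t))] with x hx
  rw [hx]

theorem wave_initial_pos : (wave k N w).pos 0 = 0 := by
  have : waveU k N w 0 = fun _ => 0 := by
    ext x; simp [waveU, foldW, fold]
  show restr _ _ = _
  rw [this, restr_zero]

theorem wave_initial_vel : (wave k N w).vel 0 = 0 := by
  have : waveV k N w 0 = fun _ => 0 := by
    ext x; simp [waveV, foldW, fold]
  show (innerSL ℝ (restr _ _)).comp _ = _
  rw [this, restr_zero, map_zero, ContinuousLinearMap.zero_comp]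

theorem wave_continuousOn_pos (hk : 0 < k) (hk1 : k < 1) (hw : MemLp w 2 volume) :
    ContinuousOn (fun t => extZero ((wave k N w).pos t)) (Icc 0 T) :=
  (((l2Cont_waveU (N := N) hk hk1 hw (Icc 0 T)).cut k).cont).congr fun t _ =>
    extZero_eq_of (wave_pos_ae hk hk1 hw t)

/-- After dilation to the section at time `t`, the Jacobian cancels the factor in the derivative of
the dilated test function. Both functionals then act on the gradient of the same function, and their
distance is that of two L² functions, controlled by continuity of dilations. -/
theorem wave_continuousOn_vel (hk : 0 < k) (hk1 : k < 1) (hw : MemLp w 2 volume) {t : ℝ}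
    (ht : t ∈ Icc 0 T) {ε : ℝ} (hε : 0 < ε) : ∃ δ > 0, ∀ s ∈ Icc 0 T, |s - t| < δ →
    ∀ (f : H01 (endpt k s)) (g : H01 (endpt k t)),
      (∀ y : ℝ, f (endpt k s * y) = g (endpt k t * y)) →
        |(wave k N w).vel s f - (wave k N w).vel t g| ≤ ε * ‖g‖ := by
  have hLt := endpt_pos hk.le ht.1
  have h1 : L2Cont (fun s x => waveV k N w s (endpt k s / endpt k t * x)) (Icc 0 T) :=
    (l2Cont_waveV hk hk1 hw (Icc 0 T)).comp_mul ((continuous_endpt k).div_const _)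
      fun s hs => div_pos (endpt_pos hk.le hs.1) hLt
  obtain ⟨δ, hδ, H⟩ := Metric.continuousOn_iff.1 h1.cont t ht ε hε
  refine ⟨δ, hδ, fun s hs hst f g hfg => ?_⟩
  have hLs := endpt_pos hk.le hs.1
  have h2 := (H s hs (by rwa [Real.dist_eq])).le
  have hV := fun s => (l2Cont_waveV (N := N) hk hk1 hw univ).memLp s (mem_univ s)
  set a := endpt k s / endpt k t with ha
  have hapos : 0 < a := div_pos hLs hLt
  have hfun : (f : ℝ → ℝ) = fun x => g (a⁻¹ * x) := by
    ext x
    have := hfg (x / endpt k s)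
    rw [mul_div_cancel₀ _ hLs.ne'] at this
    rw [this, ha]; field_simp
  have hder : deriv (f : ℝ → ℝ) = fun x => a⁻¹ * deriv (g : ℝ → ℝ) (a⁻¹ * x) := by
    rw [hfun]; ext x
    have := deriv_comp_mul_left a⁻¹ (g : ℝ → ℝ) x
    simpa using this
  have e1 : (wave k N w).vel s f =
      ∫ x in Ioo 0 (endpt k t), waveV k N w s (a * x) * H01.grad _ g x := by
    rw [wave_vel_apply hk hk1 hw, ← setIntegral_mul_eq]
    have c1 : ∫ x in Ioo 0 (endpt k s), waveV k N w s x * H01.grad _ f x =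
        ∫ x in (0 : ℝ)..endpt k s, waveV k N w s x * (a⁻¹ * deriv (g : ℝ → ℝ) (a⁻¹ * x)) := by
      rw [intervalIntegral.integral_of_le hLs.le, integral_Ioc_eq_integral_Ioo]
      refine integral_congr_ae ?_
      filter_upwards [f.coeFn_grad] with x hx
      rw [hx, hder]
    have c2 := intervalIntegral.integral_comp_mul_left (a := 0) (b := endpt k t)
      (fun x => waveV k N w s x * (a⁻¹ * deriv (g : ℝ → ℝ) (a⁻¹ * x))) hapos.ne'
    rw [mul_zero, ha, div_mul_cancel₀ _ hLt.ne', ← ha, eq_inv_smul_iff₀ hapos.ne'] at c2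
    rw [c1, ← c2, intervalIntegral.integral_of_le hLt.le, integral_Ioc_eq_integral_Ioo, smul_eq_mul,
      ← integral_const_mul]
    refine integral_congr_ae ?_
    filter_upwards [g.coeFn_grad] with x hx
    rw [hx, inv_mul_cancel_left₀ hapos.ne']
    field_simp
  have e2 : (wave k N w).vel t g = inner ℝ (restr (endpt k t) (waveV k N w t)) (H01.grad _ g) := rfl
  have hVa : MemLp (fun x => waveV k N w s (a * x)) 2 volume := h1.memLp s hs
  have e3 : (wave k N w).vel s f = inner ℝ (restr (endpt k t) (fun x => waveV k N w s (a * x)))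
      (H01.grad _ g) := by
    rw [e1, inner_L2]
    refine integral_congr_ae ?_
    filter_upwards [coeFn_restr (endpt k t) hVa] with x hx
    rw [hx]
  rw [e2, e3, ← inner_sub_left, H01.norm_eq]
  refine (abs_real_inner_le_norm _ _).trans (mul_le_mul_of_nonneg_right ?_ (norm_nonneg _))
  refine (norm_restr_sub_le _ hVa (hV t)).trans ?_
  rw [dist_eq_norm] at h2
  have h3 : (fun x => waveV k N w t (endpt k t / endpt k t * x)) = waveV k N w t := by
    ext x; rw [div_self hLt.ne', one_mul]
  rw [h3] at h2
  exact h2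

/-- The pairing is an integral over emission times `s < r` of the signal against a kernel `K r s`,
Lipschitz in `r` and zero on the diagonal near `t`. Truncation at `s = r` therefore adds no boundary
term, although the signal is only square integrable, and differentiation under the integral is
legitimate. -/
theorem wave_hasDeriv (hk : 0 < k) (hk1 : k < 1) (hw : IsState T w) {t : ℝ} (ht : t ∈ Icc 0 T)
    (f : H01 (endpt k t)) (hf : ContDiff ℝ ∞ (f : ℝ → ℝ))
    (hfs : tsupport (f : ℝ → ℝ) ⊆ Ioo 0 (endpt k t)) :
    HasDerivWithinAt (fun r => ∫ x in Ioo 0 (endpt k r), (wave k N w).pos r x * f x)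
      ((wave k N w).vel t f) (Icc 0 T) t := by
  have hLt := endpt_pos hk.le ht.1
  have hcomp : HasCompactSupport (f : ℝ → ℝ) :=
    IsCompact.of_isClosed_subset isCompact_Icc (isClosed_tsupport _) (hfs.trans Ioo_subset_Icc_self)
  have hf' : ContDiff ℝ ∞ (deriv (f : ℝ → ℝ)) := (contDiff_infty_iff_deriv.1 hf).2
  have hfm : MemLp (f : ℝ → ℝ) 2 volume := hf.continuous.memLp_of_hasCompactSupport hcomp
  have hdm : MemLp (deriv (f : ℝ → ℝ)) 2 volume :=
    hf'.continuous.memLp_of_hasCompactSupport hcomp.deriv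
  obtain ⟨C, hC⟩ : ∃ C, LipschitzWith C (f : ℝ → ℝ) :=
    ContDiff.lipschitzWith_of_hasCompactSupport hcomp hf (by simp)
  -- The margin between the support of `f` and the moving endpoint keeps `f` supported in the
  -- sections at all times near `t`.
  obtain ⟨β, hβ0, hβ, hfβ⟩ : ∃ β, 0 < β ∧ β < endpt k t ∧ ∀ x, β ≤ x → f x = 0 := by
    rcases (tsupport (f : ℝ → ℝ)).eq_empty_or_nonempty with he | hne
    · exact ⟨endpt k t / 2, by linarith, by linarith, fun x _ => by
        by_contra h; have := subset_tsupport (f : ℝ → ℝ) h; rw [he] at this; exact this⟩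
    · obtain ⟨m, hm, hmax⟩ := hcomp.isCompact.exists_isMaxOn hne continuousOn_id
      have h1 := hfs hm
      refine ⟨(m + endpt k t) / 2, by linarith [h1.1], by linarith [h1.2], fun x hx => ?_⟩
      by_contra h
      have h2 : x ≤ m := hmax (subset_tsupport (f : ℝ → ℝ) h)
      linarith [h1.2]
  have hf0 : ∀ x, x ≤ 0 → f x = 0 := fun x hx => f.2.1 x fun h => by linarith [h.1]
  have hd0 : ∀ x, x ∉ Ioo 0 (endpt k t) → deriv (f : ℝ → ℝ) x = 0 := fun x hx => by
    by_contra h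
    exact hx (hfs (tsupport_deriv_subset (f := (f : ℝ → ℝ)) (subset_tsupport _ h)))
  have hwi : Integrable w volume := hw.integrable
  -- the kernel
  set K : ℝ → ℝ → ℝ := fun r s => unfold k N (fun y => f (y - r) - f (r - y)) s with hK
  set D : ℝ := ∑ n ∈ Finset.range (N + 1), lam k ^ n * (2 * C) with hD
  have hKlip : ∀ s r r', |K r s - K r' s| ≤ D * |r - r'| := by
    intro s r r'
    simp only [hK, unfold, hD, ← Finset.sum_sub_distrib, Finset.sum_mul]
    refine (Finset.abs_sum_le_sum_abs _ _).trans (Finset.sum_le_sum fun n _ => ?_)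
    rw [← mul_sub, abs_mul, abs_of_pos (pow_pos (lam_pos hk hk1) n), mul_assoc]
    refine mul_le_mul_of_nonneg_left ?_ (pow_pos (lam_pos hk hk1) n).le
    have h1 := hC.dist_le_mul (dil k n s - r) (dil k n s - r')
    have h2 := hC.dist_le_mul (r - dil k n s) (r' - dil k n s)
    rw [Real.dist_eq, Real.dist_eq] at h1 h2
    rw [show dil k n s - r - (dil k n s - r') = -(r - r') by ring, abs_neg] at h1
    rw [show r - dil k n s - (r' - dil k n s) = r - r' by ring] at h2
    rw [abs_le] at h1 h2 ⊢
    constructor <;> linarith [h1.1, h1.2, h2.1, h2.2]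
  have hDn : 0 ≤ D := Finset.sum_nonneg fun n _ => by
    have := pow_pos (lam_pos hk hk1) n; positivity
  obtain ⟨δ, hδ, hδL⟩ : ∃ δ > 0, ∀ r, |r - t| < δ → β < endpt k r := by
    refine ⟨(endpt k t - β) / k, div_pos (by linarith) hk, fun r hr => ?_⟩
    rw [lt_div_iff₀ hk] at hr
    have h1 := neg_abs_le (r - t)
    simp only [endpt] at hr ⊢
    nlinarith
  -- The copy `n = 0` cancels by oddness, and the others are evaluated beyond the support of `f`.
  have hKdiag : ∀ s, 0 ≤ s → |s - t| < δ → K s s = 0 := by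
    intro s hs hst
    simp only [hK, unfold]
    refine Finset.sum_eq_zero fun n _ => ?_
    rcases eq_or_ne n 0 with rfl | hn
    · simp [dil]
    · have h1 := le_dil hk hk1 (ξ := s) hs (by linarith [endpt_pos hk.le hs]) hn
      have h2 := hδL s hst
      rw [hfβ _ (by linarith), hf0 _ (by linarith), sub_zero, mul_zero]
  have hKc : ∀ r, Continuous (K r) := fun r => by
    simp only [hK]
    unfold unfold
    have := hf.continuous
    have h2 := fun n => continuous_dil k n
    exact continuous_finsetSum _ fun n _ => by have := h2 n; fun_prop
  have hKm : ∀ r, MemLp (K r) 2 volume := fun r =>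
    memLp_unfold hk hk1 ((hfm.comp_measurePreserving (measurePreserving_sub_right volume r)).sub
      (hfm.comp_measurePreserving (Measure.measurePreserving_sub_left volume r)))
  set F : ℝ → ℝ → ℝ := fun r s => -((Ioo 0 r).indicator w s * K r s) with hF
  set F' : ℝ → ℝ := fun s => (Ioo 0 t).indicator w s *
    unfold k N (fun y => deriv (f : ℝ → ℝ) (y - t) + deriv (f : ℝ → ℝ) (t - y)) s with hF'
  have hFint : ∀ r, Integrable (F r) volume := fun r =>
    ((hw.memLp.indicator measurableSet_Ioo).integrable_mul (hKm r)).neg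
  have hF'm : MemLp (unfold k N fun y => deriv (f : ℝ → ℝ) (y - t) + deriv (f : ℝ → ℝ) (t - y)) 2
      volume := memLp_unfold hk hk1
    ((hdm.comp_measurePreserving (measurePreserving_sub_right volume t)).add
      (hdm.comp_measurePreserving (Measure.measurePreserving_sub_left volume t)))
  have key := hasDerivAt_integral_of_dominated_loc_of_lip (μ := volume) (F := F) (F' := F')
    (x₀ := t) (s := Metric.ball t δ) (bound := fun s => |w s| * D) (Metric.ball_mem_nhds t hδ)
    (Eventually.of_forall fun r => (hFint r).1) (hFint t)
    ((hw.memLp.indicator measurableSet_Ioo).integrable_mul hF'm).1 ?_ (hwi.abs.mul_const D) ?_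
  · have hval : ∫ s, F' s = (wave k N w).vel t f := by
      rw [wave_vel_apply hk hk1 hw.memLp]
      have : ∫ x, waveV k N w t x * (Ioo 0 (endpt k t)).indicator (H01.grad _ f) x =
          ∫ x, waveV k N w t x * deriv (f : ℝ → ℝ) x := by
        rw [← setIntegral_mul_eq]
        have h1 : ∫ x in Ioo 0 (endpt k t), waveV k N w t x * H01.grad _ f x =
            ∫ x in Ioo 0 (endpt k t), waveV k N w t x * deriv (f : ℝ → ℝ) x := by
          refine integral_congr_ae ?_
          filter_upwards [f.coeFn_grad] with x hx
          rw [hx]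
        rw [h1]
        exact setIntegral_eq_integral_of_forall_compl_eq_zero fun x hx => by rw [hd0 x hx, mul_zero]
      rw [this, integral_waveV_mul hk hk1 hw.memLp hdm]
    rw [← hval]
    refine (key.2.hasDerivWithinAt).congr_of_eventuallyEq_of_mem ?_ ht
    have : ∀ᶠ r in 𝓝[Icc 0 T] t, |r - t| < δ := by
      filter_upwards [mem_nhdsWithin_of_mem_nhds (Metric.ball_mem_nhds t hδ)] with r hr
      rwa [Metric.mem_ball, Real.dist_eq] at hr
    filter_upwards [this] with r hr
    have h1 : ∫ x in Ioo 0 (endpt k r), (wave k N w).pos r x * f x =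
        ∫ x in Ioo 0 (endpt k r), waveU k N w r x * f x := by
      refine integral_congr_ae ?_
      filter_upwards [wave_pos_ae (N := N) hk hk1 hw.memLp r] with x hx
      rw [hx]
    rw [h1, setIntegral_eq_integral_of_forall_compl_eq_zero, integral_waveU_mul hk hk1 hw.memLp hfm,
      integral_neg]
    intro x hx
    rcases le_or_gt x 0 with hx0 | hx0
    · rw [hf0 x hx0, mul_zero]
    · rw [hfβ x, mul_zero]
      have := hδL r hr
      by_contra hx2
      exact hx ⟨hx0, by linarith⟩
  · refine Eventually.of_forall fun s => LipschitzOnWith.of_dist_le_mul fun r hr r' hr' => ?_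
    have hnn : ((Real.nnabs (|w s| * D) : NNReal) : ℝ) = |w s| * D := by
      rw [Real.coe_nnabs, abs_of_nonneg (by positivity)]
    rw [hnn, Real.dist_eq, Real.dist_eq]
    rw [Metric.mem_ball, Real.dist_eq] at hr hr'
    wlog hrr : r ≤ r' generalizing r r'
    · rw [abs_sub_comm, abs_sub_comm r]
      exact this r' hr' r hr (le_of_not_ge hrr)
    simp only [hF]
    rcases le_or_gt s 0 with hs0 | hs0
    · rw [indicator_of_notMem (fun h => by linarith [h.1]),
        indicator_of_notMem (fun h => by linarith [h.1])]
      simp only [zero_mul, neg_zero, sub_self, abs_zero]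
      positivity
    rcases lt_or_ge s r with hs1 | hs1
    · rw [indicator_of_mem (show s ∈ Ioo 0 r from ⟨hs0, hs1⟩),
        indicator_of_mem (show s ∈ Ioo 0 r' from ⟨hs0, hs1.trans_le hrr⟩),
        show -(w s * K r s) - -(w s * K r' s) = -(w s * (K r s - K r' s)) by ring, abs_neg, abs_mul,
        mul_assoc]
      exact mul_le_mul_of_nonneg_left (hKlip s r r') (abs_nonneg _)
    rw [indicator_of_notMem (fun h : s ∈ Ioo 0 r => by linarith [h.2])]
    rcases lt_or_ge s r' with hs2 | hs2
    · rw [indicator_of_mem (show s ∈ Ioo 0 r' from ⟨hs0, hs2⟩)]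
      -- Here `s` lies between `r` and `r'`, so only `K r' s` survives; its vanishing at `r' = s`
      -- bounds it by `D * |r - r'|`.
      have hss : |s - t| < δ := by
        rw [abs_lt] at hr hr' ⊢
        constructor <;> linarith [hr.1, hr.2, hr'.1, hr'.2]
      have h3 := hKlip s r' s
      rw [hKdiag s hs0.le hss, sub_zero] at h3
      rw [zero_mul, neg_zero, zero_sub, neg_neg, abs_mul, mul_assoc]
      refine mul_le_mul_of_nonneg_left (h3.trans (mul_le_mul_of_nonneg_left ?_ hDn)) (abs_nonneg _)
      rw [abs_of_nonneg (by linarith), abs_sub_comm, abs_of_nonneg (by linarith)]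
      linarith
    · rw [indicator_of_notMem (fun h : s ∈ Ioo 0 r' => by linarith [h.2])]
      simp only [zero_mul, neg_zero, sub_self, abs_zero]
      positivity
  · have hne : ∀ᵐ s : ℝ, s ≠ t := compl_mem_ae_iff.2 (measure_singleton (μ := volume) t)
    filter_upwards [hne] with s hs
    have hKd : HasDerivAt (fun r => K r s) (-(unfold k N
        (fun y => deriv (f : ℝ → ℝ) (y - t) + deriv (f : ℝ → ℝ) (t - y)) s)) t := by
      simp only [hK, unfold, ← Finset.sum_neg_distrib]
      refine HasDerivAt.fun_sum fun n _ => ?_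
      have hfd : ∀ x, HasDerivAt (f : ℝ → ℝ) (deriv (f : ℝ → ℝ) x) x := fun x =>
        (hf.differentiable (by simp) x).hasDerivAt
      have d1 := (hfd (dil k n s - t)).comp t ((hasDerivAt_id t).const_sub (dil k n s))
      have d2 := (hfd (t - dil k n s)).comp t ((hasDerivAt_id t).sub_const (dil k n s))
      exact ((d1.sub d2).const_mul (lam k ^ n)).congr_deriv (by ring)
    rcases lt_or_gt_of_ne hs with h | h
    · have : (fun r => F r s) =ᶠ[𝓝 t] fun r => -((Ioo 0 t).indicator w s * K r s) := by
        filter_upwards [lt_mem_nhds h] with r hr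
        simp only [hF]
        congr 2
        by_cases hs0 : 0 < s
        · rw [indicator_of_mem (show s ∈ Ioo 0 r from ⟨hs0, hr⟩),
            indicator_of_mem (show s ∈ Ioo 0 t from ⟨hs0, h⟩)]
        · rw [indicator_of_notMem (fun h => hs0 h.1), indicator_of_notMem (fun h => hs0 h.1)]
      refine HasDerivAt.congr_of_eventuallyEq ?_ this
      exact ((hKd.const_mul _).neg).congr_deriv (by simp only [hF']; ring)
    · have : (fun r => F r s) =ᶠ[𝓝 t] fun r => 0 := by
        filter_upwards [gt_mem_nhds h] with r hr
        simp only [hF]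
        rw [indicator_of_notMem (fun h => by linarith [h.2])]; simp
      refine HasDerivAt.congr_of_eventuallyEq ?_ this
      have h0 : F' s = 0 := by
        simp only [hF']
        rw [indicator_of_notMem (fun h => by linarith [h.2]), zero_mul]
      rw [h0]
      exact hasDerivAt_const _ _

end MovingWave

/-! ### Duality between waves and finite energy solutions. -/

namespace MovingWave

variable {k T : ℝ} {N : ℕ} {w : ℝ → ℝ} {h : ℝ × ℝ → ℝ}

theorem IsForce.ae_memLp_slice (hh : IsForce k T h) : ∀ᵐ t : ℝ, MemLp
    (fun x => h (t, x)) 2 volume := by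
  have h1 := (memLp_two_iff hh.memLp.1).1 hh.memLp
  rw [Measure.volume_eq_prod, lintegral_prod _ (hh.meas.enorm.pow_const 2).aemeasurable] at h1
  have h2 := ae_lt_top (hh.meas.enorm.pow_const 2).lintegral_prod_right' h1.ne
  filter_upwards [h2] with t ht
  exact (memLp_two_iff (hh.meas.comp_measurable measurable_prodMk_left).aestronglyMeasurable).2 ht

theorem unfold_add (k : ℝ) (N : ℕ) (v v' : ℝ → ℝ) (s : ℝ) :
    unfold k N (fun y => v y + v' y) s = unfold k N v s + unfold k N v' s := by
  simp only [unfold, mul_add, Finset.sum_add_distrib]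

/-- Duality between the waves generated by boundary signals and finite energy solutions. -/
theorem wave_duality (hk : 0 < k) (hk1 : k < 1) (hw : IsState T w) (hh : IsForce k T h)
    (f₀ : H01 (endpt k T)) (f₁ : L2 (endpt k T)) :
    ∫ t in Ioo 0 T, ∫ x in Ioo 0 (endpt k t), (wave k N w).pos t x * h (t, x) =
      (∫ t in Ioo 0 T, w t * gam (dataG k N T ((Ioo 0 (endpt k T)).indicator (H01.grad _ f₀))
            ((Ioo 0 (endpt k T)).indicator f₁)) (srcH k N h) t t) +
        inner ℝ ((wave k N w).pos T) f₁ - (wave k N w).vel T f₀ := by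
  set e := (Ioo 0 (endpt k T)).indicator (H01.grad _ f₀) with he'
  set v := (Ioo 0 (endpt k T)).indicator f₁ with hv'
  have he : IsState (endpt k T) e := isState_indicator _
  have hv : IsState (endpt k T) v := isState_indicator _
  have hwT : (Ioo 0 T).indicator w = w := by
    ext s; by_cases hs : s ∈ Ioo 0 T
    · rw [indicator_of_mem hs]
    · rw [indicator_of_notMem hs, hw.supp s hs]
  have hH0 : ∀ s, s ∉ Ioo 0 T → ∀ ξ, srcH k N h (s, ξ) = 0 := by
    intro s hs ξ
    simp only [srcH, unfold, oddRefl]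
    refine Finset.sum_eq_zero fun n _ => ?_
    rw [hh.supp _ fun hm => hs hm.1, hh.supp _ fun hm => hs hm.1]
    simp
  have hHm : MemLp (srcH k N h) 2 volume := IsForce.memLp_srcH hh.memLp hk hk1
  have hg0 : MemLp (dataG k N T e v) 2 volume := memLp_unfold hk hk1 (memLp_dataRefl he.memLp hv.memLp)
  -- the joint kernel
  set G : ℝ × ℝ → ℝ := fun z => (Ioo 0 z.1).indicator w z.2 * srcH k N h z with hG
  have hGi : Integrable G volume := by
    have h1 : MemLp (fun z : ℝ × ℝ => (Ioo 0 T).indicator (fun _ => (1 : ℝ)) z.1 * w z.2) 2 volume := by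
      have hms : MeasurableSet (Ioo (0 : ℝ) T ×ˢ (univ : Set ℝ)) := measurableSet_Ioo.prod .univ
      have h0 : MemLp (fun z : ℝ × ℝ => w z.2) 2 ((volume.restrict (Ioo 0 T)).prod volume) :=
        hw.memLp.comp_snd (volume.restrict (Ioo 0 T))
      rw [← Measure.restrict_univ (μ := (volume : Measure ℝ)), Measure.restrict_restrict_of_subset
        (subset_univ _), Measure.prod_restrict, ← Measure.volume_eq_prod] at h0
      refine ((memLp_indicator_iff_restrict hms).2 h0).ae_eq (Eventually.of_forall fun z => ?_)
      beta_reduce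
      by_cases hz : z.1 ∈ Ioo 0 T
      · rw [indicator_of_mem (show z ∈ Ioo (0 : ℝ) T ×ˢ (univ : Set ℝ) from ⟨hz, trivial⟩),
          indicator_of_mem hz, one_mul]
      · rw [indicator_of_notMem (fun h : z ∈ Ioo (0 : ℝ) T ×ˢ (univ : Set ℝ) => hz h.1),
          indicator_of_notMem hz, zero_mul]
    have h2 : MemLp (fun z : ℝ × ℝ => (Ioo 0 z.1).indicator w z.2 * (Ioo 0 T).indicator (fun _ => (1 : ℝ)) z.1) 2
        volume := by
      refine h1.mono ?_ (Eventually.of_forall fun z => ?_)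
      · have : (fun z : ℝ × ℝ => (Ioo 0 z.1).indicator w z.2 *
            (Ioo 0 T).indicator (fun _ => (1 : ℝ)) z.1) = fun z =>
            ({z : ℝ × ℝ | z.2 ∈ Ioo 0 z.1}.indicator (fun z => w z.2) z) *
            (Ioo 0 T).indicator (fun _ => (1 : ℝ)) z.1 := by
          ext z; simp [indicator]
        rw [this]
        refine (StronglyMeasurable.mul ?_ ?_).aestronglyMeasurable
        · exact (hw.meas.comp_measurable measurable_snd).indicator
            ((measurableSet_lt measurable_const measurable_snd).inter
              (measurableSet_lt measurable_snd measurable_fst))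
        · exact (stronglyMeasurable_const.indicator measurableSet_Ioo).comp_measurable measurable_fst
      · rw [norm_mul, norm_mul, mul_comm]
        gcongr
        exact norm_indicator_le_norm_self _ _
    refine (h2.integrable_mul hHm).congr (Eventually.of_forall fun z => ?_)
    simp only [hG, Pi.mul_apply]
    by_cases hz : z.1 ∈ Ioo 0 T
    · rw [indicator_of_mem hz]; ring
    · have : srcH k N h z = 0 := hH0 z.1 hz z.2
      rw [this]; ring
  have hL : ∫ t in Ioo 0 T, ∫ x in Ioo 0 (endpt k t), (wave k N w).pos t x * h (t, x) =
      - ∫ t, ∫ s, G (t, s) := by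
    rw [← integral_neg, setIntegral_congr_ae (g := fun t => - ∫ s, G (t, s)) measurableSet_Ioo,
      setIntegral_eq_integral_of_forall_compl_eq_zero]
    · intro t ht
      simp [hG, hH0 t ht]
    · filter_upwards [hh.ae_memLp_slice] with t ht _
      have h1 : ∫ x in Ioo 0 (endpt k t), (wave k N w).pos t x * h (t, x) =
          ∫ x in Ioo 0 (endpt k t), waveU k N w t x * h (t, x) := by
        refine integral_congr_ae ?_
        filter_upwards [wave_pos_ae (N := N) hk hk1 hw.memLp t] with x hx
        rw [hx]
      rw [h1, setIntegral_eq_integral_of_forall_compl_eq_zero fun x hx => by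
        rw [hh.supp (t, x) fun hm => hx hm.2, mul_zero],
        integral_waveU_mul (e := fun x => h (t, x)) hk hk1 hw.memLp ht]
      rfl
  have i0 : Integrable (fun t => w t * dataG k N T e v t) volume := hw.memLp.integrable_mul hg0
  have hR1 : ∫ t in Ioo 0 T, w t * gam (dataG k N T e v) (srcH k N h) t t =
      (∫ t, w t * dataG k N T e v t) - ∫ t, ∫ s, G (s, t) := by
    rw [setIntegral_eq_integral_of_forall_compl_eq_zero fun t ht => by
      rw [hw.supp t ht, zero_mul], ← integral_sub i0 hGi.integral_prod_right]
    refine integral_congr_ae (Eventually.of_forall fun t => ?_)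
    simp only [gam, mul_sub]
    congr 1
    rw [← integral_const_mul, ← integral_indicator measurableSet_Ioi]
    refine integral_congr_ae (Eventually.of_forall fun s => ?_)
    simp only [hG]
    by_cases hst : t < s
    · rw [indicator_of_mem (show s ∈ Ioi t from hst)]
      by_cases ht : 0 < t
      · rw [indicator_of_mem (show t ∈ Ioo 0 s from ⟨ht, hst⟩)]
      · rw [indicator_of_notMem (fun h => ht h.1), hw.supp t (fun h => ht h.1)]
    · rw [indicator_of_notMem (show s ∉ Ioi t from hst),
        indicator_of_notMem (fun h => hst h.2), zero_mul]
  -- The state at a given time collects the signals emitted earlier, and the invariant at an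
  -- emission time collects the sources lying ahead. These are the two orders of integration over
  -- one triangle.
  have hsw : ∫ t, ∫ s, G (s, t) = ∫ t, ∫ s, G (t, s) :=
    (integral_integral_swap (f := fun t s => G (t, s)) hGi).symm
  have hpos : inner ℝ ((wave k N w).pos T) f₁ =
      - ∫ s, w s * unfold k N (fun y => v (y - T) - v (T - y)) s := by
    have h1 := integral_waveU_mul (N := N) hk hk1 hw.memLp hv.memLp T
    rw [hwT] at h1
    rw [← h1, inner_L2, hv', ← setIntegral_mul_eq]
    refine integral_congr_ae ?_
    filter_upwards [wave_pos_ae (N := N) hk hk1 hw.memLp T] with x hx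
    rw [hx]
  have hvel : (wave k N w).vel T f₀ = ∫ s, w s * unfold k N (fun y => e (y - T) + e (T - y)) s := by
    have h1 := integral_waveV_mul (N := N) hk hk1 hw.memLp he.memLp T
    rw [hwT] at h1
    rw [← h1, wave_vel_apply hk hk1 hw.memLp]
  have m1 : MemLp (unfold k N (fun y => e (y - T) + e (T - y))) 2 volume := memLp_unfold hk hk1
    ((he.memLp.comp_measurePreserving (measurePreserving_sub_right volume T)).add
      (he.memLp.comp_measurePreserving (Measure.measurePreserving_sub_left volume T)))
  have m2 : MemLp (unfold k N (fun y => v (y - T) - v (T - y))) 2 volume := memLp_unfold hk hk1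
    ((hv.memLp.comp_measurePreserving (measurePreserving_sub_right volume T)).sub
      (hv.memLp.comp_measurePreserving (Measure.measurePreserving_sub_left volume T)))
  have i1 : Integrable (fun s => w s * unfold k N (fun y => e (y - T) + e (T - y)) s) volume :=
    hw.memLp.integrable_mul m1
  have i2 : Integrable (fun s => w s * unfold k N (fun y => v (y - T) - v (T - y)) s) volume :=
    hw.memLp.integrable_mul m2
  have hsum : ∫ t, w t * dataG k N T e v t =
      (∫ s, w s * unfold k N (fun y => e (y - T) + e (T - y)) s) +
        ∫ s, w s * unfold k N (fun y => v (y - T) - v (T - y)) s := by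
    rw [← integral_add i1 i2]
    refine integral_congr_ae (Eventually.of_forall fun s => ?_)
    simp only [dataG]
    rw [← mul_add, ← unfold_add]
    rfl
  rw [hL, hR1, hpos, hvel, hsw, hsum]
  ring

end MovingWave

namespace MovingWave

/-! ### Test functions -/

theorem exists_Icc_of_isCompact {K : Set ℝ} {a b : ℝ} (hab : a < b) (hK : IsCompact K)
    (hs : K ⊆ Ioo a b) : ∃ c d, a < c ∧ c ≤ d ∧ d < b ∧ K ⊆ Icc c d := by
  rcases K.eq_empty_or_nonempty with rfl | hne
  · exact ⟨(a + b) / 2, (a + b) / 2, by linarith, le_rfl, by linarith, empty_subset _⟩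
  · obtain ⟨c, hc, hmin⟩ := hK.exists_isMinOn hne continuousOn_id
    obtain ⟨d, hd, hmax⟩ := hK.exists_isMaxOn hne continuousOn_id
    exact ⟨c, d, (hs hc).1, hmin hd, (hs hd).2, fun x hx => ⟨hmin hx, hmax hx⟩⟩

/-- The lemma of du Bois-Reymond. -/
theorem ae_const_of_integral_deriv_eq_zero {a b : ℝ} (hab : a < b) {e : ℝ → ℝ}
    (he : IntegrableOn e (Ioo a b))
    (H : ∀ g : ℝ → ℝ, ContDiff ℝ ∞ g → tsupport g ⊆ Ioo a b → ∫ x in Ioo a b, deriv g x * e x = 0) :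
    ∃ c : ℝ, ∀ᵐ x, x ∈ Ioo a b → e x = c := by
  classical
  obtain ⟨ρ, hρ1, hρ2, hρ3, hρ4⟩ : ∃ ρ : ℝ → ℝ, ContDiff ℝ ∞ ρ ∧ HasCompactSupport ρ ∧
      tsupport ρ ⊆ Ioo a b ∧ ∫ x, ρ x = 1 := by
    let B : ContDiffBump ((a + b) / 2) := ⟨(b - a) / 8, (b - a) / 4, by linarith, by linarith⟩
    refine ⟨B.normed volume, B.contDiff_normed, B.hasCompactSupport_normed, ?_, B.integral_normed⟩
    rw [B.tsupport_normed_eq, Real.closedBall_eq_Icc]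
    have hB : B.rOut = (b - a) / 4 := rfl
    rw [hB]
    exact fun x hx => ⟨by linarith [hx.1], by linarith [hx.2]⟩
  have hte : ∀ g : ℝ → ℝ, Continuous g → HasCompactSupport g →
      IntegrableOn (fun x => g x * e x) (Ioo a b) := by
    intro g hg hgc
    obtain ⟨C, hC⟩ := hgc.exists_bound_of_continuous hg
    exact he.bdd_mul hg.aestronglyMeasurable (Eventually.of_forall hC)
  refine ⟨∫ x in Ioo a b, ρ x * e x, ?_⟩
  -- The constant is the average of `e` against the normalized bump.
  set c := ∫ x in Ioo a b, ρ x * e x with hc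
  have hloc : LocallyIntegrableOn (fun x => e x - c) (Ioo a b) volume :=
    (he.sub (integrableOn_const (by simp))).locallyIntegrableOn
  have key := isOpen_Ioo.ae_eq_zero_of_integral_contDiff_smul_eq_zero hloc ?_
  · filter_upwards [key] with x hx hxI
    exact sub_eq_zero.1 (hx hxI)
  intro β hβ1 hβ2 hβ3
  set m := ∫ x, β x with hm
  -- Subtracting the mean of `β` times the bump makes the primitive `g` compactly supported in the
  -- interval, hence an admissible test function.
  set θ : ℝ → ℝ := fun x => β x - m * ρ x with hθ
  have hθs : ContDiff ℝ ∞ θ := hβ1.sub (contDiff_const.mul hρ1)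
  have hθi : Integrable θ volume := (hβ1.continuous.integrable_of_hasCompactSupport hβ2).sub
    ((hρ1.continuous.integrable_of_hasCompactSupport hρ2).const_mul m)
  have hθ0 : ∫ x, θ x = 0 := by
    simp only [hθ]
    rw [integral_sub (hβ1.continuous.integrable_of_hasCompactSupport hβ2)
      ((hρ1.continuous.integrable_of_hasCompactSupport hρ2).const_mul m), integral_const_mul, hρ4]
    ring
  obtain ⟨p, q, hap, hpq, hqb, hsub⟩ := exists_Icc_of_isCompact hab
    (hβ2.isCompact.union hρ2.isCompact) (union_subset hβ3 hρ3)
  have hθz : ∀ x, x ∉ Icc p q → θ x = 0 := by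
    intro x hx
    have h1 : β x = 0 := by
      by_contra h; exact hx (hsub (Or.inl (subset_tsupport _ h)))
    have h2 : ρ x = 0 := by
      by_contra h; exact hx (hsub (Or.inr (subset_tsupport _ h)))
    simp [hθ, h1, h2]
  set g : ℝ → ℝ := fun x => ∫ y in a..x, θ y with hg
  have hgd : deriv g = θ := by
    ext x; exact Continuous.deriv_integral θ hθs.continuous a x
  have hgs : ContDiff ℝ ∞ g := by
    rw [contDiff_infty_iff_deriv, hgd]
    refine ⟨fun x => ?_, hθs⟩
    exact (intervalIntegral.integral_hasDerivAt_right (hθi.intervalIntegrable)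
      (hθs.continuous.stronglyMeasurableAtFilter _ _) hθs.continuous.continuousAt).differentiableAt
  have hgz : ∀ x, x ∉ Icc p q → g x = 0 := by
    intro x hx
    simp only [hg]
    rcases lt_or_ge x p with h | h
    · refine intervalIntegral.integral_zero_ae (Eventually.of_forall fun y hy => hθz y fun hy' => ?_)
      rw [uIoc, mem_Ioc] at hy
      have := hy.2
      have h3 := hy'.1
      rcases le_max_iff.1 this with h4 | h4 <;> linarith
    · have hqx : q < x := by
        by_contra h2; exact hx ⟨h, not_lt.1 h2⟩
      rw [intervalIntegral.integral_of_le (by linarith), ← hθ0]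
      refine setIntegral_eq_integral_of_forall_compl_eq_zero fun y hy => hθz y fun hy' => hy ?_
      exact ⟨by linarith [hy'.1], by linarith [hy'.2]⟩
  have hgt : tsupport g ⊆ Ioo a b := by
    have : tsupport g ⊆ Icc p q := closure_minimal (fun x hx => by
      by_contra h; exact hx (hgz x h)) isClosed_Icc
    exact this.trans fun x hx => ⟨by linarith [hx.1], by linarith [hx.2]⟩
  have h1 := H g hgs hgt
  rw [hgd] at h1
  have h2 : ∫ x, β x • (e x - c) = ∫ x in Ioo a b, β x * (e x - c) := by
    refine (setIntegral_eq_integral_of_forall_compl_eq_zero fun x hx => ?_).symm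
    have : β x = 0 := by
      by_contra h; exact hx (hβ3 (subset_tsupport _ h))
    rw [this, zero_smul]
  have h3 : ∫ x in Ioo a b, β x = m := by
    refine setIntegral_eq_integral_of_forall_compl_eq_zero fun x hx => ?_
    by_contra h; exact hx (hβ3 (subset_tsupport _ h))
  have i1 := hte β hβ1.continuous hβ2
  have i2 := (hte ρ hρ1.continuous hρ2).const_mul m
  have i3 : IntegrableOn (fun x => c * β x) (Ioo a b) :=
    ((hβ1.continuous.integrable_of_hasCompactSupport hβ2).const_mul c).integrableOn
  have h4 : ∫ x in Ioo a b, θ x * e x = (∫ x in Ioo a b, β x * e x) - m * c := by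
    rw [hc, ← integral_const_mul, ← integral_sub i1 i2]
    refine integral_congr_ae (Eventually.of_forall fun x => ?_)
    simp only [hθ]; ring
  have h5 : ∫ x in Ioo a b, β x * (e x - c) = (∫ x in Ioo a b, β x * e x) - c * m := by
    rw [← h3, ← integral_const_mul, ← integral_sub i1 i3]
    refine integral_congr_ae (Eventually.of_forall fun x => ?_)
    ring
  rw [h2, h5]
  linarith

theorem exists_H01_of_test {L : ℝ} {g : ℝ → ℝ} (hg : ContDiff ℝ ∞ g) (hs : tsupport g ⊆ Ioo 0 L) :
    ∃ f : H01 L, (f : ℝ → ℝ) = g := by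
  have hc : HasCompactSupport g :=
    IsCompact.of_isClosed_subset isCompact_Icc (isClosed_tsupport _) (hs.trans Ioo_subset_Icc_self)
  obtain ⟨C, hC⟩ : ∃ C, LipschitzWith C g :=
    ContDiff.lipschitzWith_of_hasCompactSupport hc hg (by simp)
  have hg' : ContDiff ℝ ∞ (deriv g) := (contDiff_infty_iff_deriv.1 hg).2
  exact ⟨⟨g, fun x hx => by_contra fun h => hx (hs (subset_tsupport _ h)),
    (hC.lipschitzOnWith (s := uIcc 0 L)).absolutelyContinuousOnInterval,
    (hg'.continuous.memLp_of_hasCompactSupport hc.deriv).restrict _⟩, rfl⟩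

/-- Test functions are dense in `H¹₀(0, L)`. -/
theorem H01.exists_test_near {L : ℝ} (hL : 0 < L) (f : H01 L) {ε : ℝ} (hε : 0 < ε) :
    ∃ g : H01 L, ContDiff ℝ ∞ (g : ℝ → ℝ) ∧ tsupport (g : ℝ → ℝ) ⊆ Ioo 0 L ∧ ‖f - g‖ < ε := by
  let S : Submodule ℝ (L2 L) :=
    { carrier := {v | ∃ g : H01 L, ContDiff ℝ ∞ (g : ℝ → ℝ) ∧ tsupport (g : ℝ → ℝ) ⊆ Ioo 0 L ∧
        H01.grad L g = v}
      zero_mem' := by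
        refine ⟨0, contDiff_const, ?_, map_zero _⟩
        have : tsupport (fun _ : ℝ => (0 : ℝ)) = ∅ := tsupport_eq_empty_iff.2 rfl
        exact this.subset.trans (empty_subset _)
      add_mem' := by
        rintro _ _ ⟨g, h1, h2, rfl⟩ ⟨g', h1', h2', rfl⟩
        exact ⟨g + g', h1.add h1', (tsupport_add (g : ℝ → ℝ) (g' : ℝ → ℝ)).trans
          (union_subset h2 h2'), map_add _ _ _⟩
      smul_mem' := by
        rintro c _ ⟨g, h1, h2, rfl⟩
        refine ⟨c • g, h1.const_smul c, ?_, map_smul _ _ _⟩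
        exact (tsupport_smul_subset_right (fun _ => c) (g : ℝ → ℝ)).trans h2 }
  -- A function orthogonal to the derivatives of all test functions is constant by du Bois-Reymond,
  -- and constants are orthogonal to gradients because these have mean zero.
  have hmem : H01.grad L f ∈ S.topologicalClosure := by
    rw [← Submodule.orthogonal_orthogonal_eq_closure, Submodule.mem_orthogonal]
    intro e he
    rw [Submodule.mem_orthogonal] at he
    obtain ⟨c, hc⟩ := ae_const_of_integral_deriv_eq_zero hL
      ((Lp.memLp e).integrable (by norm_num)) (fun g hg hgs => by
        obtain ⟨φ, hφ⟩ := exists_H01_of_test hg hgs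
        have h1 := he (H01.grad L φ) ⟨φ, by rwa [hφ], by rwa [hφ], rfl⟩
        rw [inner_L2] at h1
        refine Eq.trans (integral_congr_ae ?_) h1
        filter_upwards [φ.coeFn_grad] with x hx
        rw [hx, hφ])
    rw [inner_L2]
    have h2 : ∫ x in Ioo 0 L, e x * H01.grad L f x = ∫ x in Ioo 0 L, c * H01.grad L f x := by
      refine setIntegral_congr_ae measurableSet_Ioo ?_
      filter_upwards [hc] with x hx hxI
      rw [hx hxI]
    have h3 := f.integral_grad hL.le
    rw [intervalIntegral.integral_of_le hL.le, integral_Ioc_eq_integral_Ioo] at h3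
    rw [h2, integral_const_mul, h3, mul_zero]
  rw [← SetLike.mem_coe, Submodule.topologicalClosure_coe, Metric.mem_closure_iff] at hmem
  obtain ⟨v, ⟨g, h1, h2, rfl⟩, hv⟩ := hmem ε hε
  refine ⟨g, h1, h2, ?_⟩
  rwa [H01.norm_eq, map_sub, ← dist_eq_norm]

end MovingWave

namespace MovingWave

/-! ### Uniqueness of finite energy solutions -/

theorem extZero_add {L : ℝ} (f g : L2 L) : extZero (f + g) = extZero f + extZero g := by
  refine Lp.ext ((coeFn_extZero _).trans (EventuallyEq.trans ?_ (Lp.coeFn_add _ _).symm))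
  have h1 := Lp.coeFn_add f g
  rw [EventuallyEq, ae_restrict_iff' measurableSet_Ioo] at h1
  filter_upwards [h1, coeFn_extZero f, coeFn_extZero g] with x hx hf hg
  rw [Pi.add_apply, hf, hg]
  by_cases hxL : x ∈ Ioo 0 L
  · simp only [indicator_of_mem hxL, hx hxL, Pi.add_apply]
  · simp only [indicator_of_notMem hxL, add_zero]

theorem extZero_smul {L : ℝ} (c : ℝ) (f : L2 L) : extZero (c • f) = c • extZero f := by
  refine Lp.ext ((coeFn_extZero _).trans (EventuallyEq.trans ?_ (Lp.coeFn_smul _ _).symm))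
  have h1 := Lp.coeFn_smul c f
  rw [EventuallyEq, ae_restrict_iff' measurableSet_Ioo] at h1
  filter_upwards [h1, coeFn_extZero f] with x hx hf
  rw [Pi.smul_apply, hf]
  by_cases hxL : x ∈ Ioo 0 L
  · simp only [indicator_of_mem hxL, hx hxL, Pi.smul_apply]
  · simp only [indicator_of_notMem hxL, smul_zero]

theorem norm_extZero {L : ℝ} (f : L2 L) : ‖extZero f‖ = ‖f‖ := by
  rw [Lp.norm_def, Lp.norm_def, eLpNorm_congr_ae (coeFn_extZero f),
    eLpNorm_indicator_eq_eLpNorm_restrict measurableSet_Ioo]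

/-- Extension by zero as a linear isometry. -/
noncomputable def extL (L : ℝ) : L2 L →ₗᵢ[ℝ] Lp ℝ 2 (volume : Measure ℝ) where
  toFun := extZero
  map_add' := extZero_add
  map_smul' := extZero_smul
  norm_map' := norm_extZero

theorem inner_LR (a b : Lp ℝ 2 (volume : Measure ℝ)) : inner ℝ a b = ∫ x, a x * b x := by
  rw [L2.inner_def]
  exact integral_congr_ae (Eventually.of_forall fun x => by simp [mul_comm])

theorem H01.coeFn_toL2 {L : ℝ} (f : H01 L) :
    f.toL2 =ᵐ[volume.restrict (Ioo 0 L)] (f : ℝ → ℝ) := MemLp.coeFn_toLp f.memLp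

theorem H01.coeFn_extZero_toL2 {L : ℝ} (f : H01 L) : extZero f.toL2 =ᵐ[volume] (f : ℝ → ℝ) := by
  have h1 := f.coeFn_toL2
  rw [EventuallyEq, ae_restrict_iff' measurableSet_Ioo] at h1
  filter_upwards [coeFn_extZero f.toL2, h1] with x hx h2
  rw [hx]
  by_cases hxL : x ∈ Ioo 0 L
  · rw [indicator_of_mem hxL, h2 hxL]
  · rw [indicator_of_notMem hxL]; exact (f.2.1 x hxL).symm

theorem H01.coeFn_extZero_grad {L : ℝ} (f : H01 L) :
    extZero (H01.grad L f) =ᵐ[volume] (Ioo 0 L).indicator (deriv (f : ℝ → ℝ)) := by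
  have h1 := f.coeFn_grad
  rw [EventuallyEq, ae_restrict_iff' measurableSet_Ioo] at h1
  filter_upwards [coeFn_extZero (H01.grad L f), h1] with x hx h2
  rw [hx]
  by_cases hxL : x ∈ Ioo 0 L
  · rw [indicator_of_mem hxL, indicator_of_mem hxL, h2 hxL]
  · rw [indicator_of_notMem hxL, indicator_of_notMem hxL]

theorem H01.abs_le {L : ℝ} (hL : 0 ≤ L) (f : H01 L) (x : ℝ) : |f x| ^ 2 ≤ L * ‖f‖ ^ 2 := by
  by_cases hx : x ∈ Ioo 0 L
  swap
  · have : f x = 0 := f.2.1 x hx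
    rw [this, abs_zero, zero_pow two_ne_zero]; positivity
  have h1 := f.eq_integral hL (Ioo_subset_Icc_self hx)
  rw [intervalIntegral.integral_of_le hx.1.le, integral_Ioc_eq_integral_Ioo] at h1
  have hsub : volume.restrict (Ioo 0 x) ≤ volume.restrict (Ioo 0 L) :=
    Measure.restrict_mono (Ioo_subset_Ioo_right hx.2.le) le_rfl
  have h2 := enorm_integral_sq_le (μ := volume.restrict (Ioo 0 x)) (f.2.2.2.1.mono_measure hsub)
  have h3 : ∫⁻ y in Ioo 0 x, ‖deriv (f : ℝ → ℝ) y‖ₑ ^ 2 ≤ ENNReal.ofReal (‖f‖ ^ 2) := by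
    rw [H01.norm_eq, Lp.norm_def, ← ENNReal.toReal_pow, ENNReal.ofReal_toReal
      (ENNReal.pow_ne_top (Lp.memLp _).2.ne), eLpNorm_congr_ae f.coeFn_grad, eLpNorm_two_sq]
    exact lintegral_mono' hsub le_rfl
  have h4 : ENNReal.ofReal (|f x| ^ 2) ≤ ENNReal.ofReal (L * ‖f‖ ^ 2) := by
    rw [ENNReal.ofReal_pow (abs_nonneg _), ENNReal.ofReal_mul hL, ← Real.enorm_eq_ofReal_abs, h1]
    refine h2.trans (mul_le_mul ?_ h3 (zero_le) (zero_le))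
    rw [Measure.restrict_apply_univ, Real.volume_Ioo, sub_zero]
    exact ENNReal.ofReal_le_ofReal hx.2.le
  exact (ENNReal.ofReal_le_ofReal_iff (by positivity)).1 h4

/-- The Poincaré inequality, from the pointwise bound `H01.abs_le`. -/
theorem H01.norm_toL2_le {L : ℝ} (hL : 0 ≤ L) (f : H01 L) : ‖f.toL2‖ ≤ L * ‖f‖ := by
  have h1 : ‖f.toL2‖ ^ 2 ≤ (L * ‖f‖) ^ 2 := by
    rw [← real_inner_self_eq_norm_sq, inner_L2]
    have h2 : ∫ x in Ioo 0 L, f.toL2 x * f.toL2 x ≤ ∫ x in Ioo 0 L, L * ‖f‖ ^ 2 := by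
      refine integral_mono_ae ((Lp.memLp _).integrable_mul (Lp.memLp _)) (integrable_const _) ?_
      filter_upwards [f.coeFn_toL2] with x hx
      rw [hx, ← sq, ← sq_abs]
      exact f.abs_le hL x
    refine h2.trans (le_of_eq ?_)
    rw [setIntegral_const, smul_eq_mul, measureReal_def, Real.volume_Ioo, sub_zero,
      ENNReal.toReal_ofReal hL]
    ring
  exact (pow_le_pow_iff_left₀ (norm_nonneg _) (by positivity) two_ne_zero).1 h1

theorem H01.toL2_sub {L : ℝ} (f g : H01 L) : (f - g).toL2 = f.toL2 - g.toL2 := by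
  refine Lp.ext ((f - g).coeFn_toL2.trans (EventuallyEq.trans ?_ (Lp.coeFn_sub _ _).symm))
  filter_upwards [f.coeFn_toL2, g.coeFn_toL2] with x h1 h2
  rw [Pi.sub_apply, h1, h2]; rfl

theorem H01.toL2_injective {L : ℝ} (hL : 0 < L) {f : H01 L} (h : f.toL2 = 0) : f = 0 := by
  have h1 : (f : ℝ → ℝ) =ᵐ[volume.restrict (Ioo 0 L)] fun _ => 0 := by
    have := f.coeFn_toL2
    rw [h] at this
    exact this.symm.trans (Lp.coeFn_zero _ _ _)
  have hc : ContinuousOn (f : ℝ → ℝ) (Ioo 0 L) :=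
    f.2.2.1.continuousOn.mono (by rw [uIcc_of_le hL.le]; exact Ioo_subset_Icc_self)
  have h2 := Measure.eqOn_open_of_ae_eq h1 isOpen_Ioo hc continuousOn_const
  apply Subtype.ext
  funext x
  by_cases hx : x ∈ Ioo 0 L
  · exact h2 hx
  · exact f.2.1 x hx

variable {k T : ℝ} {h : ℝ → ℝ → ℝ} {φ χ : EnergyPath k}

/-- The wave equation tested with a product of functions of `t` and of `x`. -/
theorem IsEnergySolution.separated (hφ : IsEnergySolution k T h φ) (hk : 0 < k) {s : ℝ}
    (hs : 0 ≤ s) (f : H01 (endpt k s)) (hf : ContDiff ℝ ∞ (f : ℝ → ℝ))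
    (hfs : tsupport (f : ℝ → ℝ) ⊆ Ioo 0 (endpt k s)) {α : ℝ → ℝ} (hα : ContDiff ℝ ∞ α)
    (hαs : tsupport α ⊆ Ioo s T) :
    ∫ t in Ioo 0 T, (deriv (deriv α) t * inner ℝ (extZero (φ.pos t).toL2) (extZero f.toL2) +
      α t * inner ℝ (extZero (H01.grad _ (φ.pos t))) (extZero (H01.grad _ f))) =
    ∫ t in Ioo 0 T, ∫ x in Ioo 0 (endpt k t), h t x * (α t * f x) := by
  have hfc : HasCompactSupport (f : ℝ → ℝ) :=
    IsCompact.of_isClosed_subset isCompact_Icc (isClosed_tsupport _) (hfs.trans Ioo_subset_Icc_self)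
  have hαc : HasCompactSupport α :=
    IsCompact.of_isClosed_subset isCompact_Icc (isClosed_tsupport _) (hαs.trans Ioo_subset_Icc_self)
  have hf' : ContDiff ℝ ∞ (deriv (f : ℝ → ℝ)) := (contDiff_infty_iff_deriv.1 hf).2
  have hf'' : ContDiff ℝ ∞ (deriv (deriv (f : ℝ → ℝ))) := (contDiff_infty_iff_deriv.1 hf').2
  have hα' : ContDiff ℝ ∞ (deriv α) := (contDiff_infty_iff_deriv.1 hα).2
  have hmono : ∀ {a b : ℝ}, a ≤ b → endpt k a ≤ endpt k b := fun {a b} h => by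
    simp only [endpt]; nlinarith
  have hsub : tsupport (Function.uncurry fun t x => α t * f x) ⊆ tsupport α ×ˢ tsupport (f : ℝ → ℝ) := by
    refine closure_minimal ?_ ((isClosed_tsupport _).prod (isClosed_tsupport _))
    rintro ⟨t, x⟩ hx
    have hx' : α t * f x ≠ 0 := hx
    exact ⟨subset_tsupport _ (left_ne_zero_of_mul hx'), subset_tsupport _ (right_ne_zero_of_mul hx')⟩
  have heq := hφ.equation (fun t x => α t * f x) ?_ ?_ ?_
  rotate_left
  · exact (hα.comp contDiff_fst).mul (hf.comp contDiff_snd)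
  · exact (hαc.isCompact.prod hfc.isCompact).of_isClosed_subset (isClosed_tsupport _) hsub
  -- The sections grow with time, so a function supported in the section at time `s` is an
  -- admissible factor at all later times.
  · refine hsub.trans ?_
    rintro ⟨t, x⟩ ⟨h1, h2⟩
    have h3 := hαs h1
    exact ⟨⟨hs.trans_lt h3.1, h3.2⟩, (hfs h2).1, (hfs h2).2.trans_le (hmono h3.1.le)⟩
  rw [← heq]
  refine setIntegral_congr_fun measurableSet_Ioo fun t ht => ?_
  have e1 : ∀ x, iteratedDeriv 2 (fun r => α r * f x) t = deriv (deriv α) t * f x := by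
    intro x
    rw [iteratedDeriv_succ, iteratedDeriv_one]
    have : deriv (fun r => α r * f x) = fun r => deriv α r * f x := by
      ext r; exact deriv_mul_const (hα.differentiable (by simp) r) _
    rw [this, deriv_mul_const (hα'.differentiable (by simp) t)]
  have e2 : ∀ x, iteratedDeriv 2 (fun y => α t * f y) x = α t * deriv (deriv (f : ℝ → ℝ)) x := by
    intro x
    rw [iteratedDeriv_succ, iteratedDeriv_one]
    have : deriv (fun y => α t * f y) = fun y => α t * deriv (f : ℝ → ℝ) y := by
      ext r; exact deriv_const_mul _ (hf.differentiable (by simp) r)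
    rw [this, deriv_const_mul _ (hf'.differentiable (by simp) x)]
  simp only [e1, e2]
  by_cases hts : s < t
  swap
  · have hz : ∀ β : ℝ → ℝ, tsupport β ⊆ Ioo s T → β t = 0 := fun β hβ => by
      by_contra hne
      exact hts (hβ (subset_tsupport β hne)).1
    have z1 := hz α hαs
    have z2 := hz (deriv (deriv α)) ((tsupport_deriv_subset.trans tsupport_deriv_subset).trans hαs)
    simp [z1, z2]
  have hLt := endpt_pos hk.le ht.1.le
  have hle := hmono hts.le
  set p := φ.pos t with hp
  have hd0 : ∀ x, x ∉ Ioo 0 (endpt k s) → deriv (f : ℝ → ℝ) x = 0 := fun x hx => by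
    by_contra h
    exact hx (hfs (tsupport_deriv_subset (f := (f : ℝ → ℝ)) (subset_tsupport _ h)))
  have c1 : inner ℝ (extZero p.toL2) (extZero f.toL2) = ∫ x in Ioo 0 (endpt k t), p x * f x := by
    rw [inner_LR, setIntegral_eq_integral_of_forall_compl_eq_zero fun x hx => by
      rw [show p x = 0 from p.2.1 x hx, zero_mul]]
    refine integral_congr_ae ?_
    filter_upwards [p.coeFn_extZero_toL2, f.coeFn_extZero_toL2] with x h1 h2
    rw [h1, h2]
  have c2 : inner ℝ (extZero (H01.grad _ p)) (extZero (H01.grad _ f)) =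
      - ∫ x in Ioo 0 (endpt k t), p x * deriv (deriv (f : ℝ → ℝ)) x := by
    have hac : AbsolutelyContinuousOnInterval (deriv (f : ℝ → ℝ)) 0 (endpt k t) :=
      (hf'.contDiffOn.of_le (by simp)).absolutelyContinuousOnInterval
    have h3 := p.2.2.1.integral_mul_deriv_eq_deriv_mul hac
    rw [show p.1 0 = 0 from p.2.1 0 (by simp), show p.1 (endpt k t) = 0 from p.2.1 _ (by simp),
      intervalIntegral.integral_of_le hLt.le, intervalIntegral.integral_of_le hLt.le,
      integral_Ioc_eq_integral_Ioo, integral_Ioc_eq_integral_Ioo] at h3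
    simp only [zero_mul, sub_zero, zero_sub] at h3
    rw [h3, neg_neg, inner_LR, ← integral_indicator measurableSet_Ioo]
    refine integral_congr_ae ?_
    filter_upwards [p.coeFn_extZero_grad, f.coeFn_extZero_grad] with x h1 h2
    rw [h1, h2]
    by_cases hx : x ∈ Ioo 0 (endpt k t)
    · rw [indicator_of_mem hx, indicator_of_mem hx]
      by_cases hx2 : x ∈ Ioo 0 (endpt k s)
      · rw [indicator_of_mem hx2]
      · rw [indicator_of_notMem hx2, hd0 x hx2]
    · rw [indicator_of_notMem hx, indicator_of_notMem hx, zero_mul]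
  have hpi : ∀ g : ℝ → ℝ, Continuous g → HasCompactSupport g →
      IntegrableOn (fun x => p x * g x) (Ioo 0 (endpt k t)) := fun g hg hgc =>
    p.memLp.integrable_mul ((hg.memLp_of_hasCompactSupport (p := 2) hgc).restrict _)
  have i1 := (hpi _ hf.continuous hfc).const_mul (deriv (deriv α) t)
  have i2 := (hpi _ hf''.continuous hfc.deriv.deriv).const_mul (α t)
  rw [c1, c2, mul_neg, ← sub_eq_add_neg, ← integral_const_mul, ← integral_const_mul,
    ← integral_sub i1 i2]
  refine integral_congr_ae (Eventually.of_forall fun x => ?_)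
  ring

end MovingWave

/-! ### The conserved quantity behind uniqueness. -/

namespace MovingWave

variable {k T : ℝ} {h : ℝ → ℝ → ℝ} {φ χ : EnergyPath k}

/-- The difference of two solutions, with zero final velocity, in integrated form. -/
theorem IsEnergySolution.inner_vel_sub_of_test (hφ : IsEnergySolution k T h φ)
    (hχ : IsEnergySolution k T h χ) (hk : 0 < k) (hv : φ.vel T = χ.vel T) {s : ℝ} (hs : 0 ≤ s)
    (hsT : s < T) (f : H01 (endpt k s)) (hf : ContDiff ℝ ∞ (f : ℝ → ℝ))
    (hfs : tsupport (f : ℝ → ℝ) ⊆ Ioo 0 (endpt k s)) :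
    inner ℝ (extZero (φ.vel s) - extZero (χ.vel s)) (extZero f.toL2) =
      ∫ t in s..T, inner ℝ (extZero (H01.grad _ (φ.pos t)) - extZero (H01.grad _ (χ.pos t)))
        (extZero (H01.grad _ f)) := by
  set F := extZero f.toL2 with hF
  set GF := extZero (H01.grad _ f) with hGF
  set c : ℝ → ℝ := fun t => inner ℝ (extZero (φ.pos t).toL2 - extZero (χ.pos t).toL2) F with hc
  set v : ℝ → ℝ := fun t => inner ℝ (extZero (φ.vel t) - extZero (χ.vel t)) F with hvdef
  set d : ℝ → ℝ := fun t => inner ℝ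
    (extZero (H01.grad _ (φ.pos t)) - extZero (H01.grad _ (χ.pos t))) GF with hd
  have hIcc : Icc s T ⊆ Icc 0 T := Icc_subset_Icc_left hs
  have hPφ : ContinuousOn (fun t => extZero (φ.pos t).toL2) (Icc 0 T) := fun t ht =>
    (hφ.hasDeriv t ht).continuousWithinAt
  have hPχ : ContinuousOn (fun t => extZero (χ.pos t).toL2) (Icc 0 T) := fun t ht =>
    (hχ.hasDeriv t ht).continuousWithinAt
  have hcc : ContinuousOn c (Icc 0 T) := (hPφ.sub hPχ).inner continuousOn_const
  have hvc : ContinuousOn v (Icc 0 T) :=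
    (hφ.continuousOn_vel.sub hχ.continuousOn_vel).inner continuousOn_const
  have hdc : ContinuousOn d (Icc 0 T) :=
    (hφ.continuousOn_grad.sub hχ.continuousOn_grad).inner continuousOn_const
  have hcd : ∀ t ∈ Ioo s T, HasDerivAt c (v t) t := by
    intro t ht
    have ht' : t ∈ Icc 0 T := hIcc (Ioo_subset_Icc_self ht)
    have h1 := ((hφ.hasDeriv t ht').sub (hχ.hasDeriv t ht')).hasDerivAt
      (Icc_mem_nhds (hs.trans_lt ht.1) ht.2)
    have h2 := h1.inner ℝ (hasDerivAt_const t F)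
    simpa using h2
  set D : ℝ → ℝ := fun t => ∫ r in s..t, d r with hD
  have hdi : IntervalIntegrable d volume s T :=
    (hdc.mono hIcc).intervalIntegrable_of_Icc hsT.le
  have hDc : ContinuousOn D (Icc s T) := by
    have := intervalIntegral.continuousOn_primitive_interval (f := d) (μ := volume) (a := s) (b := T)
      (by rw [uIcc_of_le hsT.le]; exact (hdc.mono hIcc).integrableOn_Icc)
    rwa [uIcc_of_le hsT.le] at this
  have hDd : ∀ t ∈ Ioo s T, HasDerivAt D (d t) t := by
    intro t ht
    have hdt : ContinuousAt d t :=
      (hdc t (hIcc (Ioo_subset_Icc_self ht))).continuousAt (Icc_mem_nhds (hs.trans_lt ht.1) ht.2)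
    refine intervalIntegral.integral_hasDerivAt_right
      (hdi.mono_set (by rw [uIcc_of_le hsT.le,
        uIcc_of_le ht.1.le]; exact Icc_subset_Icc_right ht.2.le))
      ?_ hdt
    exact ContinuousOn.stronglyMeasurableAtFilter isOpen_Ioo
      (hdc.mono (Ioo_subset_Icc_self.trans hIcc)) t ht
  have hec : ContinuousOn (fun t => v t + D t) (Icc s T) := (hvc.mono hIcc).add hDc
  -- The separated equation says that `v' = -d` weakly on `(s, T)`, so `v + D` is constant there.
  -- Continuity extends this to the closed interval, where it is evaluated at both ends.
  obtain ⟨C, hC⟩ := ae_const_of_integral_deriv_eq_zero hsT (e := fun t => v t + D t)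
    (hec.integrableOn_Icc.mono_set Ioo_subset_Icc_self) (fun g hg hgs => by
      have hg' : ContDiff ℝ ∞ (deriv g) := (contDiff_infty_iff_deriv.1 hg).2
      have hg'' : ContDiff ℝ ∞ (deriv (deriv g)) := (contDiff_infty_iff_deriv.1 hg').2
      have e1 := hφ.separated hk hs f hf hfs hg hgs
      have e2 := hχ.separated hk hs f hf hfs hg hgs
      rw [← e2] at e1
      have hcont : ∀ {ψ : EnergyPath k}, IsEnergySolution k T h ψ →
          IntegrableOn (fun t => deriv (deriv g) t * inner ℝ (extZero (ψ.pos t).toL2) F +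
            g t * inner ℝ (extZero (H01.grad _ (ψ.pos t))) GF) (Ioo 0 T) := by
        intro ψ hψ
        have hP : ContinuousOn (fun t => extZero (ψ.pos t).toL2) (Icc 0 T) := fun t ht =>
          (hψ.hasDeriv t ht).continuousWithinAt
        refine (ContinuousOn.integrableOn_Icc ?_).mono_set Ioo_subset_Icc_self
        exact (hg''.continuous.continuousOn.mul (hP.inner continuousOn_const)).add
          (hg.continuous.continuousOn.mul (hψ.continuousOn_grad.inner continuousOn_const))
      have e3 : ∫ t in Ioo 0 T, (deriv (deriv g) t * c t + g t * d t) = 0 := by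
        rw [← sub_eq_zero] at e1
        have e4 := integral_sub (hcont hφ) (hcont hχ)
        rw [e1] at e4
        refine Eq.trans (integral_congr_ae (Eventually.of_forall fun t => ?_)) e4
        simp only [hc, hd, inner_sub_left]
        ring
      have hz : ∀ (β : ℝ → ℝ), tsupport β ⊆ Ioo s T → ∀ t, t ∉ Ioo s T → β t = 0 :=
        fun β hβ t ht => by
          by_contra hne
          exact ht (hβ (subset_tsupport β hne))
      have z0 := hz g hgs
      have z1 := hz (deriv g) (tsupport_deriv_subset.trans hgs)
      have z2 := hz (deriv (deriv g)) ((tsupport_deriv_subset.trans tsupport_deriv_subset).trans hgs)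
      rw [setIntegral_eq_of_subset_of_forall_sdiff_eq_zero measurableSet_Ioo
        (Ioo_subset_Ioo_left hs) (fun t ht => by rw [z0 t ht.2, z2 t ht.2]; ring),
        ← integral_Ioc_eq_integral_Ioo, ← intervalIntegral.integral_of_le hsT.le] at e3
      rw [← integral_Ioc_eq_integral_Ioo, ← intervalIntegral.integral_of_le hsT.le]
      have hgd : ∀ t, HasDerivAt g (deriv g t) t := fun t => (hg.differentiable (by simp) t).hasDerivAt
      have hgd' : ∀ t, HasDerivAt (deriv g) (deriv (deriv g) t) t := fun t =>
        (hg'.differentiable (by simp) t).hasDerivAt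
      have hgc := hg.continuous.continuousOn (s := Icc s T)
      have hgc' := hg'.continuous.continuousOn (s := Icc s T)
      have hgc'' := hg''.continuous.continuousOn (s := Icc s T)
      have i1 : IntervalIntegrable (fun t => deriv (deriv g) t * c t + deriv g t * v t) volume s T :=
        ((hgc''.mul (hcc.mono hIcc)).add (hgc'.mul (hvc.mono hIcc))).intervalIntegrable_of_Icc hsT.le
      have i2 : IntervalIntegrable (fun t => deriv g t * D t + g t * d t) volume s T :=
        ((hgc'.mul hDc).add (hgc.mul (hdc.mono hIcc))).intervalIntegrable_of_Icc hsT.le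
      have i3 : IntervalIntegrable (fun t => deriv (deriv g) t * c t + g t * d t) volume s T :=
        ((hgc''.mul (hcc.mono hIcc)).add (hgc.mul (hdc.mono hIcc))).intervalIntegrable_of_Icc hsT.le
      have f1 := intervalIntegral.integral_eq_sub_of_hasDerivAt_of_le hsT.le
        (hgc'.mul (hcc.mono hIcc)) (fun t ht => (hgd' t).mul (hcd t ht)) i1
      have f2 := intervalIntegral.integral_eq_sub_of_hasDerivAt_of_le hsT.le
        (hgc.mul hDc) (fun t ht => (hgd t).mul (hDd t ht)) i2
      simp only [Pi.mul_apply, z0 s (by simp), z0 T (by simp), z1 s (by simp), z1 T (by simp),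
        zero_mul, sub_zero] at f1 f2
      have f3 : ∫ t in s..T, deriv g t * (v t + D t) =
          (∫ t in s..T, (deriv (deriv g) t * c t + deriv g t * v t)) +
          (∫ t in s..T, (deriv g t * D t + g t * d t)) -
          ∫ t in s..T, (deriv (deriv g) t * c t + g t * d t) := by
        have i12 : IntervalIntegrable (fun t => (deriv (deriv g) t * c t + deriv g t * v t) +
          (deriv g t * D t + g t * d t)) volume s T := i1.add i2
        rw [← intervalIntegral.integral_add i1 i2, ← intervalIntegral.integral_sub i12 i3]
        refine intervalIntegral.integral_congr fun t _ => ?_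
        ring
      rw [f3, f1, f2, e3]; ring)
  have hE : EqOn (fun t => v t + D t) (fun _ => C) (Icc s T) := by
    refine Measure.eqOn_Icc_of_ae_eq volume hsT.ne ?_ hec continuousOn_const
    rw [← Measure.restrict_congr_set Ioo_ae_eq_Icc, EventuallyEq,
      ae_restrict_iff' measurableSet_Ioo]
    exact hC
  have h1 : v s + D s = C := hE (left_mem_Icc.2 hsT.le)
  have h2 : v T + D T = C := hE (right_mem_Icc.2 hsT.le)
  have h3 : v T = 0 := by simp only [hvdef, hv, sub_self, inner_zero_left]
  have h4 : D s = 0 := by simp [hD]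
  rw [h3, zero_add] at h2
  rw [h4, add_zero] at h1
  exact h1.trans h2.symm

/-- Both sides are bounded functionals of `f`, and test functions are dense in H¹₀. The extension is
needed to insert the displacement itself. -/
theorem IsEnergySolution.inner_vel_sub (hφ : IsEnergySolution k T h φ)
    (hχ : IsEnergySolution k T h χ) (hk : 0 < k) (hv : φ.vel T = χ.vel T) {s : ℝ} (hs : 0 ≤ s)
    (hsT : s < T) (f : H01 (endpt k s)) :
    inner ℝ (extZero (φ.vel s) - extZero (χ.vel s)) (extZero f.toL2) =
      inner ℝ (∫ t in s..T, (extZero (H01.grad _ (φ.pos t)) - extZero (H01.grad _ (χ.pos t))))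
        (extZero (H01.grad _ f)) := by
  have hL := endpt_pos hk.le hs
  set a := extZero (φ.vel s) - extZero (χ.vel s) with ha
  set I := ∫ t in s..T, (extZero (H01.grad _ (φ.pos t)) - extZero (H01.grad _ (χ.pos t))) with hI
  have hii : IntervalIntegrable (fun t => extZero (H01.grad _ (φ.pos t)) -
      extZero (H01.grad _ (χ.pos t))) volume s T :=
    ((hφ.continuousOn_grad.sub hχ.continuousOn_grad).mono
      (Icc_subset_Icc_left hs)).intervalIntegrable_of_Icc hsT.le
  have htest : ∀ g : H01 (endpt k s), ContDiff ℝ ∞ (g : ℝ → ℝ) →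
      tsupport (g : ℝ → ℝ) ⊆ Ioo 0 (endpt k s) →
      inner ℝ a (extZero g.toL2) = inner ℝ I (extZero (H01.grad _ g)) := by
    intro g hg hgs
    rw [ha, hφ.inner_vel_sub_of_test hχ hk hv hs hsT g hg hgs, ← real_inner_comm I]
    have := (innerSL ℝ (extZero (H01.grad _ g))).intervalIntegral_comp_comm hii
    simp only [innerSL_apply_apply] at this
    rw [hI, ← this]
    exact intervalIntegral.integral_congr fun t _ => real_inner_comm _ _
  set M := ‖a‖ * endpt k s + ‖I‖ with hM
  have hM0 : 0 ≤ M := by positivity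
  have hbd : ∀ g : H01 (endpt k s),
      |inner ℝ a (extZero g.toL2) - inner ℝ I (extZero (H01.grad _ g))| ≤ M * ‖g‖ := by
    intro g
    have h1 := abs_real_inner_le_norm a (extZero g.toL2)
    have h2 := abs_real_inner_le_norm I (extZero (H01.grad _ g))
    rw [norm_extZero] at h1 h2
    rw [← H01.norm_eq] at h2
    have h3 := mul_le_mul_of_nonneg_left (g.norm_toL2_le hL.le) (norm_nonneg a)
    refine (abs_sub _ _).trans ?_
    rw [hM]; linarith
  rw [← sub_eq_zero, ← abs_eq_zero]
  refine le_antisymm (le_of_forall_pos_le_add fun ε hε => ?_) (abs_nonneg _)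
  obtain ⟨g, hg, hgs, hgn⟩ := f.exists_test_near hL (show 0 < ε / (M + 1) by positivity)
  have h1 := hbd (f - g)
  have e1 : extZero (f - g).toL2 = extZero f.toL2 - extZero g.toL2 := by
    rw [H01.toL2_sub]; exact map_sub (extL _) _ _
  have e2 : extZero (H01.grad _ (f - g)) = extZero (H01.grad _ f) - extZero (H01.grad _ g) := by
    rw [map_sub]; exact map_sub (extL _) _ _
  rw [e1, e2, inner_sub_right, inner_sub_right, htest g hg hgs] at h1
  rw [show ∀ p q r : ℝ, p - q - (r - q) = p - r from fun p q r => by ring] at h1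
  refine h1.trans ?_
  rw [zero_add]
  calc M * ‖f - g‖ ≤ (M + 1) * (ε / (M + 1)) := by
        refine mul_le_mul (by linarith) hgn.le (norm_nonneg _) (by positivity)
    _ = ε := by field_simp

/-- Finite energy solutions are determined by their final data. -/
theorem IsEnergySolution.unique (hφ : IsEnergySolution k T h φ) (hχ : IsEnergySolution k T h χ)
    (hk : 0 < k) (hT : 0 < T) (hp : φ.pos T = χ.pos T) (hv : φ.vel T = χ.vel T) :
    φ.AgreeOn T χ := by
  set P : ℝ → Lp ℝ 2 (volume : Measure ℝ) := fun t =>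
    extZero (φ.pos t).toL2 - extZero (χ.pos t).toL2 with hP
  set V : ℝ → Lp ℝ 2 (volume : Measure ℝ) := fun t => extZero (φ.vel t) - extZero (χ.vel t) with hV
  set G : ℝ → Lp ℝ 2 (volume : Measure ℝ) := fun t =>
    extZero (H01.grad _ (φ.pos t)) - extZero (H01.grad _ (χ.pos t)) with hG
  have hPd : ∀ t ∈ Icc 0 T, HasDerivWithinAt P (V t) (Icc 0 T) t := fun t ht =>
    (hφ.hasDeriv t ht).sub (hχ.hasDeriv t ht)
  have hGc : ContinuousOn G (Icc 0 T) := hφ.continuousOn_grad.sub hχ.continuousOn_grad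
  have hGi : IntervalIntegrable G volume 0 T := hGc.intervalIntegrable_of_Icc hT.le
  set Φ : ℝ → Lp ℝ 2 (volume : Measure ℝ) := fun s => ∫ t in s..T, G t with hΦ
  have hsubi : ∀ s ∈ Icc 0 T, IntervalIntegrable G volume s T := fun s hs =>
    hGi.mono_set (by rw [uIcc_of_le hT.le, uIcc_of_le hs.2]; exact Icc_subset_Icc_left hs.1)
  have hΦd : ∀ s ∈ Icc 0 T, HasDerivWithinAt Φ (-G s) (Icc 0 T) s := by
    intro s hs
    have : Fact (s ∈ Icc 0 T) := ⟨hs⟩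
    exact intervalIntegral.integral_hasDerivWithinAt_left (hsubi s hs)
      (s := Icc 0 T) (t := Icc 0 T)
      (hGc.stronglyMeasurableAtFilter_nhdsWithin measurableSet_Icc s) (hGc s hs)
  have hPe : ∀ t, P t = extZero (φ.pos t - χ.pos t).toL2 := fun t => by
    rw [H01.toL2_sub]; exact (map_sub (extL _) _ _).symm
  have hGe : ∀ t, G t = extZero (H01.grad _ (φ.pos t - χ.pos t)) := fun t => by
    rw [map_sub]; exact (map_sub (extL _) _ _).symm
  -- `P` has derivative `V` and `Φ` has derivative `-G`. Testing the integrated equation with `P s`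
  -- gives equality of the inner products of `V s` with `P s` and of `Φ s` with `G s`, so `E` has
  -- derivative zero.
  set E : ℝ → ℝ := fun s => inner ℝ (P s) (P s) + inner ℝ (Φ s) (Φ s) with hE
  have hEd : ∀ s ∈ Ico 0 T, HasDerivWithinAt E 0 (Icc 0 T) s := by
    intro s hs
    have hs' : s ∈ Icc 0 T := Ico_subset_Icc_self hs
    have h1 := ((hPd s hs').inner ℝ (hPd s hs')).add ((hΦd s hs').inner ℝ (hΦd s hs'))
    refine h1.congr_deriv ?_
    have h2 := hφ.inner_vel_sub hχ hk hv hs.1 hs.2 (φ.pos s - χ.pos s)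
    rw [← hPe, ← hGe] at h2
    have h3 : inner ℝ (V s) (P s) = inner ℝ (Φ s) (G s) := h2
    rw [real_inner_comm (V s) (P s), inner_neg_right, inner_neg_left, real_inner_comm (Φ s) (G s),
      h3]
    ring
  have hEc : ContinuousOn E (Icc 0 T) := by
    have hPc : ContinuousOn P (Icc 0 T) := fun t ht => (hPd t ht).continuousWithinAt
    have hΦc : ContinuousOn Φ (Icc 0 T) := fun t ht => (hΦd t ht).continuousWithinAt
    exact (hPc.inner hPc).add (hΦc.inner hΦc)
  have hconst := constant_of_has_deriv_right_zero hEc fun s hs =>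
    (hEd s hs).mono_of_mem_nhdsWithin (Icc_mem_nhdsGE_of_mem hs)
  have hET : E T = 0 := by
    have h1 : P T = 0 := by simp only [hP, hp, sub_self]
    have h2 : Φ T = 0 := by simp [hΦ]
    simp [hE, h1, h2]
  have hE0 : ∀ s ∈ Icc 0 T, E s = 0 := fun s hs => by
    rw [hconst s hs, ← hconst T (right_mem_Icc.2 hT.le), hET]
  have hP0 : ∀ s ∈ Icc 0 T, P s = 0 := fun s hs => by
    have h1 := hE0 s hs
    simp only [hE] at h1
    have h2 := real_inner_self_nonneg (x := P s)
    have h3 := real_inner_self_nonneg (x := Φ s)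
    exact inner_self_eq_zero (𝕜 := ℝ).1 (by linarith)
  intro t ht
  constructor
  · have h1 := hP0 t ht
    rw [hPe] at h1
    have h2 : (φ.pos t - χ.pos t).toL2 = 0 := (extL _).injective (h1.trans (map_zero (extL _)).symm)
    exact sub_eq_zero.1 (H01.toL2_injective (endpt_pos hk.le ht.1) h2)
  · have h1 : HasDerivWithinAt P 0 (Icc 0 T) t :=
      (hasDerivWithinAt_const t (Icc 0 T) (0 : Lp ℝ 2 (volume : Measure ℝ))).congr
        (fun s hs => hP0 s hs) (hP0 t ht)
    have h2 := ((uniqueDiffOn_Icc hT) t ht).eq_deriv (Icc 0 T) (hPd t ht) h1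
    exact extZero_injective (sub_eq_zero.1 h2)

/-- The value at `x` is the inner product of the extended gradient with the indicator of `(0, x)`,
also when `x` lies beyond the endpoint, because gradients have mean zero. It provides the
measurability in time behind uniqueness of the normal derivative. -/
theorem IsEnergySolution.continuousOn_eval (hφ : IsEnergySolution k T h φ) (hk : 0 < k) (x : ℝ) :
    ContinuousOn (fun t => φ.pos t x) (Icc 0 T) := by
  rcases le_or_gt x 0 with hx | hx
  · refine (continuousOn_const (c := (0 : ℝ))).congr fun t _ => ?_
    exact (φ.pos t).2.1 x fun h => by linarith [h.1]
  have hm : MemLp ((Ioo 0 x).indicator fun _ => (1 : ℝ)) 2 volume :=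
    memLp_indicator_const 2 measurableSet_Ioo 1 (Or.inr (by simp))
  refine (hφ.continuousOn_grad.inner (continuousOn_const (c := toLR ((Ioo 0 x).indicator fun _ =>
    (1 : ℝ))))).congr fun t ht => ?_
  have hL := endpt_pos hk.le ht.1
  beta_reduce
  rw [inner_toLR _ hm]
  have h1 : ∫ y, extZero (H01.grad _ (φ.pos t)) y * (Ioo 0 x).indicator (fun _ => (1 : ℝ)) y =
      ∫ y in Ioo 0 (min x (endpt k t)), deriv (φ.pos t : ℝ → ℝ) y := by
    rw [← integral_indicator measurableSet_Ioo]
    refine integral_congr_ae ?_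
    filter_upwards [(φ.pos t).coeFn_extZero_grad] with y hy
    rw [hy]
    simp only [indicator, mem_Ioo, lt_min_iff]
    by_cases h1 : 0 < y <;> by_cases h2 : y < x <;> by_cases h3 : y < endpt k t <;>
      simp [h1, h2, h3]
  have h0 : 0 ≤ min x (endpt k t) := le_min hx.le hL.le
  have h2 := (φ.pos t).eq_integral hL.le (x := min x (endpt k t)) ⟨h0, min_le_right _ _⟩
  rw [intervalIntegral.integral_of_le h0, integral_Ioc_eq_integral_Ioo] at h2
  rw [h1, ← h2]
  rcases le_total x (endpt k t) with h3 | h3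
  · rw [min_eq_left h3]
  · rw [min_eq_right h3, show φ.pos t x = 0 from (φ.pos t).2.1 x fun h => by linarith [h.2]]
    exact ((φ.pos t).2.1 _ (by simp)).symm

theorem HasNormalDeriv.unique {g g' : L2 T} (hg : HasNormalDeriv k T φ g)
    (hg' : HasNormalDeriv k T χ g') (hφ : IsEnergySolution k T h φ) (hk : 0 < k)
    (hA : φ.AgreeOn T χ) : g = g' := by
  have hm : ∀ x, AEStronglyMeasurable (fun t => φ.pos t x) (volume.restrict (Ioo 0 T)) := fun x =>
    ((hφ.continuousOn_eval hk x).mono Ioo_subset_Icc_self).aestronglyMeasurable measurableSet_Ioo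
  have h1 := hg.add hg'
  rw [add_zero] at h1
  have h2 : eLpNorm (fun t => g t - g' t) 2 (volume.restrict (Ioo 0 T)) ≤ 0 := by
    refine ge_of_tendsto h1 (Eventually.of_forall fun x => ?_)
    have e1 : eLpNorm (fun t => (χ.pos t 0 - χ.pos t x) / x - g' t) 2 (volume.restrict (Ioo 0 T)) =
        eLpNorm (fun t => (φ.pos t 0 - φ.pos t x) / x - g' t) 2 (volume.restrict (Ioo 0 T)) := by
      refine eLpNorm_congr_ae ?_
      filter_upwards [ae_restrict_mem measurableSet_Ioo] with t ht
      rw [(hA t (Ioo_subset_Icc_self ht)).1]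
    rw [e1, add_comm]
    have e2 : (fun t => g t - g' t) = (fun t => (φ.pos t 0 - φ.pos t x) / x - g' t) -
        fun t => (φ.pos t 0 - φ.pos t x) / x - g t := by
      ext t; simp
    have hq : AEStronglyMeasurable (fun t => (φ.pos t 0 - φ.pos t x) / x)
        (volume.restrict (Ioo 0 T)) := by
      simp only [div_eq_mul_inv]
      exact ((hm 0).sub (hm x)).mul_const _
    rw [e2]
    exact eLpNorm_sub_le (hq.sub (Lp.memLp g').1) (hq.sub (Lp.memLp g).1) (by norm_num)
  have h3 := (eLpNorm_eq_zero_iff ((Lp.memLp g).1.sub (Lp.memLp g').1) (by norm_num)).1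
    (le_antisymm h2 (zero_le))
  refine Lp.ext ?_
  filter_upwards [h3] with t ht
  exact sub_eq_zero.1 ht

end MovingWave

namespace MovingWave

/-! ### Solutions by transposition -/

variable {k T : ℝ} {N : ℕ}

theorem ae_slice_of_ae_domainQ {P : ℝ → ℝ → Prop}
    (h : ∀ᵐ z ∂(volume.restrict (domainQ k T)), P z.1 z.2) :
    ∀ᵐ t ∂(volume.restrict (Ioo 0 T)), ∀ᵐ x ∂(volume.restrict (Ioo 0 (endpt k t))), P t x := by
  rw [ae_restrict_iff' (measurableSet_domainQ k T), Measure.volume_eq_prod] at h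
  have h1 := Measure.ae_ae_of_ae_prod h
  rw [ae_restrict_iff' measurableSet_Ioo]
  filter_upwards [h1] with t ht htT
  rw [ae_restrict_iff' measurableSet_Ioo]
  filter_upwards [ht] with x hx hxL
  exact hx ⟨htT, hxL⟩

/-- A square integrable source has a jointly measurable representative, extended by zero. -/
theorem exists_isForce {h : ℝ → ℝ → ℝ}
    (hh : MemLp (Function.uncurry h) 2 (volume.restrict (domainQ k T))) :
    ∃ h' : ℝ × ℝ → ℝ, IsForce k T h' ∧ Function.uncurry h =ᵐ[volume.restrict (domainQ k T)] h' := by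
  have hm := measurableSet_domainQ k T
  have h1 : MemLp (hh.1.mk _) 2 (volume.restrict (domainQ k T)) := hh.ae_eq hh.1.ae_eq_mk
  refine ⟨(domainQ k T).indicator (hh.1.mk _), ⟨hh.1.stronglyMeasurable_mk.indicator hm,
    (memLp_indicator_iff_restrict hm).2 h1, fun z hz => indicator_of_notMem hz _⟩, ?_⟩
  filter_upwards [hh.1.ae_eq_mk, ae_restrict_mem hm] with z hz hz'
  rw [indicator_of_mem hz', hz]

theorem iterated_congr {F G : ℝ → ℝ → ℝ}
    (h : ∀ᵐ t ∂(volume.restrict (Ioo 0 T)), F t =ᵐ[volume.restrict (Ioo 0 (endpt k t))] G t) :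
    ∫ t in Ioo 0 T, ∫ x in Ioo 0 (endpt k t), F t x =
      ∫ t in Ioo 0 T, ∫ x in Ioo 0 (endpt k t), G t x := by
  refine integral_congr_ae ?_
  filter_upwards [h] with t ht
  exact integral_congr_ae ht

/-- The boundary signal, extended by zero. -/
noncomputable def signal {T : ℝ} (w : L2 T) : ℝ → ℝ := (Ioo 0 T).indicator w

theorem isState_signal (w : L2 T) : IsState T (signal w) := isState_indicator w

/-- Duality for the explicit waves. -/
theorem wave_duality' (hk : 0 < k) (hk1 : k < 1) (hT : 0 < T) (hN : Enough k T N) (w : L2 T)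
    {h : ℝ → ℝ → ℝ} (hh : MemLp (Function.uncurry h) 2 (volume.restrict (domainQ k T)))
    {θ : EnergyPath k} (hθ : IsEnergySolution k T h θ) {g : L2 T} (hg : HasNormalDeriv k T θ g) :
    ∫ t in Ioo 0 T, ∫ x in Ioo 0 (endpt k t), (wave k N (signal w)).pos t x * h t x =
      - (∫ t in Ioo 0 T, w t * g t) + inner ℝ ((wave k N (signal w)).pos T) (θ.vel T) -
        (wave k N (signal w)).vel T (θ.pos T) := by
  obtain ⟨h', hf, hae⟩ := exists_isForce hh
  have hsl := ae_slice_of_ae_domainQ (P := fun t x => h t x = h' (t, x)) hae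
  -- By uniqueness `θ` agrees with the explicit solution of the same final data and source, whose
  -- normal derivative is known.
  obtain ⟨φ, g', hφ, hg', hp, hv, hgam⟩ :=
    exists_energySolution_of_force hk hk1 hT hN hf (θ.pos T) (θ.vel T)
  have hθ' : IsEnergySolution k T (fun t x => h' (t, x)) θ := hθ.congr hsl
  have hA := hθ'.unique hφ hk hT hp.symm hv.symm
  have hgg : g = g' := hg.unique hg' hθ' hk hA
  have h1 := wave_duality (N := N) hk hk1 (isState_signal w) hf (θ.pos T) (θ.vel T)
  rw [iterated_congr (G := fun t x => (wave k N (signal w)).pos t x * h' (t, x)), h1]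
  · congr 2
    rw [← integral_neg]
    refine integral_congr_ae ?_
    filter_upwards [hgam, ae_restrict_mem measurableSet_Ioo] with t ht htT
    rw [hgg, ht, signal, indicator_of_mem htT]
    ring
  · filter_upwards [hsl] with t ht
    filter_upwards [ht] with x hx
    rw [hx]

theorem isTranspSolution_wave (hk : 0 < k) (hk1 : k < 1) (hT : 0 < T) (hN : Enough k T N)
    (w : L2 T) : IsTranspSolution k T w (wave k N (signal w)) := by
  have hw := isState_signal w
  refine ⟨wave_continuousOn_pos hk hk1 hw.memLp, fun t ht f hf hfs =>
    wave_hasDeriv hk hk1 hw ht f hf hfs, fun t ht ε hε => wave_continuousOn_vel hk hk1 hw.memLp ht hε,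
    wave_initial_pos, wave_initial_vel, ?_⟩
  intro h hh θ hθ hp hv g hg
  have h1 := wave_duality' hk hk1 hT hN w hh hθ hg
  rw [hp, hv, inner_zero_right, map_zero] at h1
  rw [h1]; ring

theorem setIntegral_mul_coeFn {L : ℝ} (a : L2 L) (χ : Lp ℝ 2 (volume : Measure ℝ)) :
    ∫ x in Ioo 0 L, a x * χ x = inner ℝ (extZero a) χ := by
  rw [inner_LR, ← integral_indicator measurableSet_Ioo]
  refine integral_congr_ae ?_
  filter_upwards [coeFn_extZero a] with x hx
  rw [hx]
  by_cases hxL : x ∈ Ioo 0 L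
  · rw [indicator_of_mem hxL, indicator_of_mem hxL]
  · rw [indicator_of_notMem hxL, indicator_of_notMem hxL, zero_mul]

theorem memLp_mul_domainQ {α : ℝ → ℝ} (hα : ContinuousOn α (Icc 0 T))
    (χ : Lp ℝ 2 (volume : Measure ℝ)) :
    MemLp (Function.uncurry fun t x => α t * χ x) 2 (volume.restrict (domainQ k T)) := by
  have hle : volume.restrict (domainQ k T) ≤ (volume.restrict (Ioo 0 T)).prod volume := by
    rw [← Measure.restrict_univ (μ := (volume : Measure ℝ)), Measure.restrict_restrict_of_subset
        (subset_univ _), Measure.prod_restrict, ← Measure.volume_eq_prod]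
    have hsub : domainQ k T ⊆ Ioo 0 T ×ˢ univ := fun z hz => ⟨hz.1, trivial⟩
    exact Measure.restrict_mono hsub le_rfl
  refine MemLp.mono_measure hle ?_
  obtain ⟨C, hC⟩ := isCompact_Icc.exists_bound_of_continuousOn hα
  have h1 : MemLp (fun z : ℝ × ℝ => χ z.2) 2 ((volume.restrict (Ioo 0 T)).prod volume) :=
    (Lp.memLp χ).comp_snd _
  have h2 : AEStronglyMeasurable α (volume.restrict (Ioo 0 T)) :=
    (hα.mono Ioo_subset_Icc_self).aestronglyMeasurable measurableSet_Ioo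
  have h3 : AEStronglyMeasurable (fun z : ℝ × ℝ => α z.1) ((volume.restrict (Ioo 0 T)).prod volume) :=
    h2.comp_fst
  refine (h1.const_mul C).mono (h3.mul h1.1) ?_
  have h4 : ∀ᵐ z ∂((volume.restrict (Ioo 0 T)).prod (volume : Measure ℝ)), z.1 ∈ Ioo 0 T :=
    Measure.quasiMeasurePreserving_fst.ae (ae_restrict_mem measurableSet_Ioo)
  filter_upwards [h4] with z hz
  have h5 := hC z.1 (Ioo_subset_Icc_self hz)
  have h6 : 0 ≤ C := (norm_nonneg _).trans h5
  simp only [Function.uncurry]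
  rw [norm_mul, norm_mul, Real.norm_of_nonneg h6]
  gcongr

/-- Solutions by transposition are determined by the boundary datum. -/
theorem IsTranspSolution.unique (hk : 0 < k) (hk1 : k < 1) (hT : 0 < T) {w : L2 T}
    {u v : TranspPath k} (hu : IsTranspSolution k T w u) (hv : IsTranspSolution k T w v) :
    u.AgreeOn T v := by
  obtain ⟨N, hN⟩ := exists_enough hk hk1 T
  set d : ℝ → Lp ℝ 2 (volume : Measure ℝ) := fun t => extZero (u.pos t) - extZero (v.pos t) with hd
  have hdc : ContinuousOn d (Icc 0 T) := hu.continuousOn_pos.sub hv.continuousOn_pos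
  have hzero : ∀ t ∈ Icc 0 T, ∀ χ, inner ℝ (d t) χ = 0 := by
    intro t ht χ
    -- With the source `α t * χ x` in the transposition identity, the difference of the two
    -- solutions yields a vanishing integral of `α ^ 2`.
    set α : ℝ → ℝ := fun t => inner ℝ (d t) χ with hα
    have hαc : ContinuousOn α (Icc 0 T) := hdc.inner continuousOn_const
    have hm := memLp_mul_domainQ (k := k) hαc χ
    obtain ⟨h', hf, hae⟩ := exists_isForce hm
    have hsl := ae_slice_of_ae_domainQ (P := fun t x => α t * χ x = h' (t, x)) hae
    obtain ⟨θ, g, hθ, hg, hp0, hv0, -⟩ := exists_energySolution_of_force hk hk1 hT hN hf 0 0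
    have hθ' : IsEnergySolution k T (fun t x => α t * χ x) θ := hθ.congr (by
      filter_upwards [hsl] with t ht
      exact ht.mono fun x hx => hx.symm)
    have e1 := hu.transposition _ hm θ hθ' hp0 hv0 g hg
    have e2 := hv.transposition _ hm θ hθ' hp0 hv0 g hg
    rw [← e2] at e1
    have e3 : ∀ q : TranspPath k, ∫ t in Ioo 0 T, ∫ x in Ioo 0 (endpt k t), q.pos t x * (α t * χ x) =
        ∫ t in Ioo 0 T, α t * inner ℝ (extZero (q.pos t)) χ := by
      intro q
      refine integral_congr_ae (Eventually.of_forall fun t => ?_)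
      beta_reduce
      rw [← setIntegral_mul_coeFn, ← integral_const_mul]
      refine integral_congr_ae (Eventually.of_forall fun x => ?_)
      ring
    rw [e3, e3] at e1
    have hi : ∀ {q : TranspPath k}, IsTranspSolution k T w q →
        IntegrableOn (fun t => α t * inner ℝ (extZero (q.pos t)) χ) (Ioo 0 T) := fun hq =>
      (hαc.mul (hq.continuousOn_pos.inner continuousOn_const)).integrableOn_Icc.mono_set
        Ioo_subset_Icc_self
    have e4 := integral_sub (hi hu) (hi hv)
    rw [e1, sub_self] at e4
    have e5 : ∫ t in Ioo 0 T, α t ^ 2 = 0 := by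
      refine Eq.trans (integral_congr_ae (Eventually.of_forall fun t => ?_)) e4
      simp only [hα, hd, inner_sub_left]
      ring
    have e6 := (integral_eq_zero_iff_of_nonneg (fun t => sq_nonneg (α t))
      ((hαc.pow 2).integrableOn_Icc.mono_set Ioo_subset_Icc_self)).1 e5
    rw [Measure.restrict_congr_set Ioo_ae_eq_Icc] at e6
    have e7 := Measure.eqOn_Icc_of_ae_eq volume hT.ne e6 (hαc.pow 2) continuousOn_const ht
    exact pow_eq_zero_iff two_ne_zero |>.1 e7
  have hpos : ∀ t ∈ Icc 0 T, u.pos t = v.pos t := fun t ht =>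
    extZero_injective (sub_eq_zero.1 (ext_inner_right ℝ fun χ => by
      rw [inner_zero_left]; exact hzero t ht χ))
  refine fun t ht => ⟨hpos t ht, ?_⟩
  have hL := endpt_pos hk.le ht.1
  have htest : ∀ f : H01 (endpt k t), ContDiff ℝ ∞ (f : ℝ → ℝ) →
      tsupport (f : ℝ → ℝ) ⊆ Ioo 0 (endpt k t) → u.vel t f = v.vel t f := by
    intro f hf hfs
    have h1 := hu.hasDeriv t ht f hf hfs
    have h2 : HasDerivWithinAt (fun r => ∫ x in Ioo 0 (endpt k r), u.pos r x * f x) (v.vel t f)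
        (Icc 0 T) t := (hv.hasDeriv t ht f hf hfs).congr (fun r hr => by rw [hpos r hr])
      (by rw [hpos t ht])
    exact ((uniqueDiffOn_Icc hT) t ht).eq_deriv (Icc 0 T) h1 h2
  -- The derivatives at time `t` are known only on test functions, and are compared on all of H¹₀ by
  -- density.
  have hdense : DenseRange (Subtype.val : {f : H01 (endpt k t) // ContDiff ℝ ∞ (f : ℝ → ℝ) ∧
      tsupport (f : ℝ → ℝ) ⊆ Ioo 0 (endpt k t)} → H01 (endpt k t)) := by
    intro f
    rw [Metric.mem_closure_iff]
    intro ε hε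
    obtain ⟨g, h1, h2, h3⟩ := f.exists_test_near hL hε
    exact ⟨g, ⟨⟨g, h1, h2⟩, rfl⟩, by rwa [dist_eq_norm]⟩
  have := hdense.equalizer (u.vel t).continuous (v.vel t).continuous
    (funext fun f => htest f.1 f.2.1 f.2.2)
  exact DFunLike.coe_injective this

theorem IsTranspSolution.agree_wave (hk : 0 < k) (hk1 : k < 1) (hT : 0 < T) (hN : Enough k T N)
    {w : L2 T} {u : TranspPath k} (hu : IsTranspSolution k T w u) :
    u.AgreeOn T (wave k N (signal w)) :=
  hu.unique hk hk1 hT (isTranspSolution_wave hk hk1 hT hN w)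

end MovingWave

namespace MovingWave

/-! ### The operators of the control problem -/

/-- The gradient is an isometry onto the orthogonal complement of the constants in L², a closed
subspace. -/
theorem H01.completeSpace {L : ℝ} (hL : 0 < L) : CompleteSpace (H01 L) := by
  have hiso : Isometry (H01.grad L) := AddMonoidHomClass.isometry_of_norm _ fun f => rfl
  have hone : MemLp (fun _ : ℝ => (1 : ℝ)) 2 (volume.restrict (Ioo 0 L)) := memLp_const 1
  have hrange : range (H01.grad L) = {G : L2 L | inner ℝ G hone.toLp = 0} := by
    ext G
    have e1 : inner ℝ G hone.toLp = ∫ x in (0 : ℝ)..L, G x := by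
      rw [inner_L2, intervalIntegral.integral_of_le hL.le, integral_Ioc_eq_integral_Ioo]
      refine integral_congr_ae ?_
      filter_upwards [hone.coeFn_toLp] with x hx
      rw [hx, mul_one]
    rw [mem_ofPred_eq, e1]
    constructor
    · rintro ⟨f, rfl⟩
      exact f.integral_grad hL.le
    · intro h
      obtain ⟨f, -, hf⟩ := exists_H01_primitive hL (Lp.memLp G) h
      exact ⟨f, hf.trans (Lp.toLp_coeFn G (Lp.memLp G))⟩
  rw [completeSpace_iff_isComplete_range hiso.isUniformInducing, hrange]
  exact (isClosed_eq (continuous_id.inner continuous_const) continuous_const).isComplete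

/-- Automatic continuity of maps with an adjoint. -/
theorem exists_clm_of_adjoint {Y H : Type*} [NormedAddCommGroup Y] [NormedSpace ℝ Y]
    [CompleteSpace Y] [NormedAddCommGroup H] [InnerProductSpace ℝ H] [CompleteSpace H] (D : Y → H)
    (hD : ∀ w, ∃ ℓ : StrongDual ℝ Y, ∀ f, inner ℝ w (D f) = ℓ f) :
    ∃ D' : Y →L[ℝ] H, ∀ f, D' f = D f := by
  let A : Y →ₗ[ℝ] H :=
    { toFun := D
      map_add' := fun f g => ext_inner_left ℝ fun w => by
        obtain ⟨ℓ, hℓ⟩ := hD w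
        rw [inner_add_right, hℓ, hℓ, hℓ, map_add]
      map_smul' := fun c f => ext_inner_left ℝ fun w => by
        obtain ⟨ℓ, hℓ⟩ := hD w
        rw [RingHom.id_apply, real_inner_smul_right, hℓ, hℓ, map_smul, smul_eq_mul] }
  have hA : Continuous A := by
    refine A.continuous_of_seq_closed_graph fun u x y hx hy => ext_inner_left ℝ fun w => ?_
    obtain ⟨ℓ, hℓ⟩ := hD w
    have h1 : Tendsto (fun n => inner ℝ w (A (u n))) atTop (𝓝 (inner ℝ w y)) :=
      tendsto_const_nhds.inner hy
    have h2 : Tendsto (fun n => inner ℝ w (A (u n))) atTop (𝓝 (ℓ x)) :=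
      ((ℓ.continuous.tendsto x).comp hx).congr fun n => (hℓ (u n)).symm
    exact (tendsto_nhds_unique h1 h2).trans (hℓ x).symm
  exact ⟨⟨A, hA⟩, fun _ => rfl⟩

/-- The real Hilbert space `L²` of the non-cylindrical domain. -/
abbrev L2Q (k T : ℝ) : Type := Lp ℝ 2 (volume.restrict (domainQ k T))

theorem inner_L2Q {k T : ℝ} (a b : L2Q k T) :
    inner ℝ a b = ∫ t in Ioo 0 T, ∫ x in Ioo 0 (endpt k t), a (t, x) * b (t, x) := by
  rw [integral_domainQ (F := fun z => a z * b z) ((Lp.memLp a).integrable_mul (Lp.memLp b)),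
    L2.inner_def]
  exact integral_congr_ae (Eventually.of_forall fun x => by simp [mul_comm])

/-- The final data of finite energy solutions. -/
abbrev FinalData (k T : ℝ) : Type := H01 (endpt k T) × L2 (endpt k T)

/-- The control-to-state operator `state`, and the operator `flux` mapping final data to the normal
derivative of the solution of the homogeneous equation. -/
structure Operators (k T : ℝ) where
  state : L2 T →L[ℝ] L2Q k T
  flux : FinalData k T →L[ℝ] L2 T
  state_ae : ∀ (w : L2 T) (u : TranspPath k), IsTranspSolution k T w u →
    ∀ᵐ t ∂(volume.restrict (Ioo 0 T)),
      u.pos t =ᵐ[volume.restrict (Ioo 0 (endpt k t))] fun x => state w (t, x)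
  inner_flux : ∀ (w : L2 T) (u : TranspPath k), IsTranspSolution k T w u → ∀ f : FinalData k T,
    inner ℝ w (flux f) = inner ℝ (u.pos T) f.2 - u.vel T f.1
  normal_eq : ∀ (h : L2Q k T) (θ : EnergyPath k) (g : L2 T),
    IsEnergySolution k T (fun t x => h (t, x)) θ → HasNormalDeriv k T θ g →
      g = flux (θ.pos T, θ.vel T) - state.adjoint h
  observability : 2 / (1 - k) ≤ T → ∃ C, ∀ f, ‖f‖ ≤ C * ‖flux f‖

variable {k T : ℝ} {N : ℕ}

theorem memLp_waveU (hk : 0 < k) (hk1 : k < 1) (w : L2 T) :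
    MemLp (Function.uncurry (waveU k N (signal w))) 2 (volume.restrict (domainQ k T)) := by
  have hw := isState_signal w
  have h1 := memLp_strip (l2Cont_waveU (N := N) hk hk1 hw.memLp (Icc 0 T))
    (stronglyMeasurable_waveU hw.meas)
  rw [← Measure.restrict_univ (μ := (volume : Measure ℝ)), Measure.restrict_restrict_of_subset
    (subset_univ _), Measure.prod_restrict, ← Measure.volume_eq_prod] at h1
  have hsub : domainQ k T ⊆ Ioo 0 T ×ˢ univ := fun z hz => ⟨hz.1, trivial⟩
  exact h1.mono_measure (Measure.restrict_mono hsub le_rfl)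

/-- The trace of the unfolded data determines the data, provided `T` is large enough for the
reflected waves to return. -/
theorem dataG_observe (hk : 0 < k) (hk1 : k < 1) (hT : 2 / (1 - k) ≤ T) {e v : ℝ → ℝ}
    (he : IsState (endpt k T) e) (hv : IsState (endpt k T) v) {x : ℝ} (hx : x ∈ Ioo 0 (endpt k T)) :
    (T - x ∈ Ioo 0 T ∧ dataG k N T e v (T - x) = e x - v x) ∧
      (1 ≤ N → idil k 1 (T + x) ∈ Ioo 0 T ∧
        dataG k N T e v (idil k 1 (T + x)) = lam k * (e x + v x)) := by
  have h1k : 0 < 1 - k := by linarith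
  have hT0 : 0 < T := lt_of_lt_of_le (by positivity) hT
  have hT2 : 2 ≤ T * (1 - k) := by rwa [div_le_iff₀ h1k] at hT
  have hdr : ∀ y, T + endpt k T ≤ y → dataRefl T e v y = 0 := by
    intro y hy
    have := endpt_pos hk.le hT0.le
    rw [dataRefl, he.supp _ (fun hm => by have := hm.2; linarith),
      he.supp _ (fun hm => by have := hm.1; linarith),
      hv.supp _ (fun hm => by have := hm.2; linarith),
      hv.supp _ (fun hm => by have := hm.1; linarith)]
    simp
  have hneg : ∀ (q : ℝ → ℝ), IsState (endpt k T) q → q (-x) = 0 :=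
    fun q hq => hq.supp _ fun hm => by have := hm.1; have := hx.1; linarith
  have hLT : endpt k T < T := by simp only [endpt]; linarith
  refine ⟨⟨⟨by linarith [hx.2], by linarith [hx.1]⟩, ?_⟩, fun hN => ?_⟩
  · rw [dataG, unfold_eq hk hk1 hT0.le (by linarith [hx.2]) hdr, dataRefl,
      show T - x - T = -x by ring, show T - (T - x) = x by ring, hneg e he, hneg v hv]
    ring
  set s := idil k 1 (T + x) with hs
  have hd1 : dil k 1 s = T + x := dil_idil hk hk1 1 _
  have hlam := one_lt_lam hk hk1
  have hlp := lam_pos hk hk1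
  have hadd := dil_add hk 1 s
  rw [hd1, pow_one] at hadd
  have hkk : 0 < 1 / k := by positivity
  have hlm := lam_mul hk1
  -- The condition `lam k * (1 / k) ≤ T + 1 / k` is equivalent to `2 ≤ T * (1 - k)`: a wave leaving
  -- the fixed endpoint at time 0 must have returned by time `T`.
  have hs0 : 0 < s := by
    have h1 : lam k * (1 / k) ≤ T + 1 / k := by
      have h2 : lam k * (1 - k) * (1 / k) ≤ (T + 1 / k) * (1 - k) := by
        rw [hlm]
        have : (1 + k) * (1 / k) = 1 / k + 1 := by field_simp
        have h3 : (T + 1 / k) * (1 - k) = T * (1 - k) + 1 / k - 1 := by field_simp; ring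
        rw [this, h3]; linarith
      have h3 : (lam k * (1 / k)) * (1 - k) ≤ (T + 1 / k) * (1 - k) := by linarith
      exact le_of_mul_le_mul_right h3 h1k
    have h2 : lam k * (1 / k) < lam k * (s + 1 / k) := by rw [← hadd]; linarith [hx.1]
    have := lt_of_mul_lt_mul_left h2 hlp.le
    linarith
  have hsa : s < T - endpt k T := by
    have h1 := left_add hk T
    have h2 := right_add hk T
    have h3 : lam k * (s + 1 / k) < lam k * (T - endpt k T + 1 / k) := by
      rw [← hadd, h1, ← mul_assoc, hlm, ← h2]; linarith [hx.2]
    have := lt_of_mul_lt_mul_left h3 hlp.le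
    linarith
  have hL := endpt_pos hk.le hT0.le
  refine ⟨⟨hs0, by linarith⟩, ?_⟩
  -- The copy of index 0 is evaluated to the left of the support of the reflected data, and copies
  -- of index at least 2 to its right.
  have hsingle : dataG k N T e v s = lam k ^ 1 * dataRefl T e v (dil k 1 s) := by
    rw [dataG, unfold, Finset.sum_eq_single_of_mem 1 (by simp; omega)]
    intro n _ hn
    rcases Nat.lt_or_ge n 1 with h0 | h0
    · have : n = 0 := by omega
      subst this
      have hd0 : dil k 0 s = s := by simp [dil]
      rw [hd0, dataRefl, he.supp _ (fun hm => by have := hm.1; linarith),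
        he.supp _ (fun hm => by have := hm.2; linarith),
        hv.supp _ (fun hm => by have := hm.1; linarith),
        hv.supp _ (fun hm => by have := hm.2; linarith)]
      simp
    · obtain ⟨m, rfl⟩ : ∃ m, n = m + 1 := ⟨n - 1, by omega⟩
      have hm : m ≠ 0 := by omega
      have h1 : dil k (m + 1) s = dil k m (dil k 1 s) := by
        have a1 := dil_add hk (m + 1) s
        have a2 := dil_add hk m (dil k 1 s)
        have a3 := dil_add hk 1 s
        rw [a3, pow_one, ← mul_assoc, ← pow_succ] at a2
        linarith
      rw [hdr, mul_zero]
      rw [h1, hd1]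
      exact le_dil hk hk1 hT0.le (by linarith [hx.1]) hm
  rw [hsingle, hd1, pow_one, dataRefl, show T + x - T = x by ring, show T - (T + x) = -x by ring,
    hneg e he, hneg v hv]
  ring

theorem norm_restr_le {L : ℝ} {p : ℝ → ℝ} (hp : MemLp p 2 volume) : ‖restr L p‖ ≤ ‖toLR p‖ := by
  have h1 := norm_restr_sub_le L hp (MemLp.zero (p := 2))
  have h2 : toLR (0 : ℝ → ℝ) = 0 := by rw [toLR_of MemLp.zero]; rfl
  have h3 : restr L (0 : ℝ → ℝ) = 0 := restr_zero _
  rwa [h2, h3, sub_zero, sub_zero] at h1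

/-- Strain and velocity are the half-sum and half-difference of the two observed components,
selected by the sign `ε`. -/
theorem norm_le_of_combination {L : ℝ} {a b : ℝ → ℝ} (ha : MemLp a 2 volume) (hb : MemLp b 2 volume)
    {α ε : ℝ} (hα : 0 ≤ α) (hε : |ε| = 1) {c : L2 L}
    (hc : ∀ x ∈ Ioo 0 L, (Ioo 0 L).indicator c x = 1 / 2 * (α * a x + ε * b x)) :
    ‖c‖ ≤ ‖toLR a‖ * α + ‖toLR b‖ := by
  have h0 : c = (1 / 2 : ℝ) • (α • restr L a + ε • restr L b) := by
    refine Lp.ext ?_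
    filter_upwards [coeFn_restr L ha, coeFn_restr L hb,
      Lp.coeFn_smul (1 / 2 : ℝ) (α • restr L a + ε • restr L b),
      Lp.coeFn_add (α • restr L a) (ε • restr L b), Lp.coeFn_smul α (restr L a),
      Lp.coeFn_smul ε (restr L b), ae_restrict_mem measurableSet_Ioo] with x h1 h2 h3 h4 h5 h6 hx
    have := hc x hx
    rw [indicator_of_mem hx] at this
    rw [h3, Pi.smul_apply, h4, Pi.add_apply, h5, h6, Pi.smul_apply, Pi.smul_apply, h1, h2, this,
      smul_eq_mul, smul_eq_mul, smul_eq_mul]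
  have h3 := norm_add_le (α • restr L a) (ε • restr L b)
  rw [norm_smul, norm_smul, Real.norm_eq_abs ε, hε, one_mul, Real.norm_of_nonneg hα] at h3
  have h1 := mul_le_mul_of_nonneg_left (norm_restr_le (L := L) ha) hα
  have h2 := norm_restr_le (L := L) hb
  have h5 := norm_nonneg (α • restr L a + ε • restr L b)
  rw [h0, norm_smul, Real.norm_of_nonneg (by norm_num : (0 : ℝ) ≤ 1 / 2)]
  linarith

theorem memLp_comp_idil (hk : 0 < k) (hk1 : k < 1) {q : ℝ → ℝ} (hq : MemLp q 2 volume) (n : ℕ) :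
    MemLp (fun y => q (idil k n y)) 2 volume :=
  memLp_comp_affine hq (inv_ne_zero (pow_pos (lam_pos hk hk1) n).ne') _

theorem eLpNorm_comp_idil (hk : 0 < k) (hk1 : k < 1) {q : ℝ → ℝ} (hq : MemLp q 2 volume) (n : ℕ)
    (t : ℝ) : eLpNorm (fun x => q (idil k n (t + x))) 2 volume =
      ENNReal.ofReal |((lam k ^ n)⁻¹)⁻¹| ^ (1 / 2 : ℝ) * eLpNorm q 2 volume := by
  have h1 := eLpNorm_comp_measurePreserving (p := 2) (memLp_comp_idil hk hk1 hq n).1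
    (measurePreserving_add_left volume t)
  have h2 := eLpNorm_comp_affine hq.1 (inv_ne_zero (pow_pos (lam_pos hk hk1) n).ne')
    (((lam k ^ n)⁻¹ - 1) / k)
  simp only [idil] at h1 ⊢
  rw [← h2, ← h1]
  rfl

theorem eLpNorm_comp_sub_left {q : ℝ → ℝ} (hq : AEStronglyMeasurable q volume) (t : ℝ) :
    eLpNorm (fun x => q (t - x)) 2 volume = eLpNorm q 2 volume :=
  eLpNorm_comp_measurePreserving hq (Measure.measurePreserving_sub_left volume t)

/-- Observability of the data from the trace of the unfolded data. -/
theorem norm_le_of_trace (hk : 0 < k) (hk1 : k < 1) (hT : 2 / (1 - k) ≤ T) (hN : 1 ≤ N)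
    (f₀ : H01 (endpt k T)) (f₁ : L2 (endpt k T)) {g : L2 T}
    (hg : g =ᵐ[volume.restrict (Ioo 0 T)] fun t =>
      - dataG k N T ((Ioo 0 (endpt k T)).indicator (H01.grad _ f₀))
            ((Ioo 0 (endpt k T)).indicator f₁) t) :
    ‖(f₀, f₁)‖ ≤ ((lam k)⁻¹ * (ENNReal.ofReal |((lam k ^ 1)⁻¹)⁻¹| ^ (1 / 2 : ℝ)).toReal + 1) * ‖g‖ := by
  set e := (Ioo 0 (endpt k T)).indicator (H01.grad _ f₀) with he'
  set v := (Ioo 0 (endpt k T)).indicator f₁ with hv'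
  have he : IsState (endpt k T) e := isState_indicator _
  have hv : IsState (endpt k T) v := isState_indicator _
  have hlp := lam_pos hk hk1
  -- Up to sign this is the observed trace. Its values at `T - x` give strain minus velocity, and
  -- those at `idil k 1 (T + x)` give `lam k` times strain plus velocity.
  set q : ℝ → ℝ := (Ioo 0 T).indicator (dataG k N T e v) with hq
  have hqm : MemLp q 2 volume :=
    (memLp_unfold hk hk1 (memLp_dataRefl he.memLp hv.memLp)).indicator measurableSet_Ioo
  have hqg : ‖toLR q‖ = ‖g‖ := by
    rw [toLR_of hqm, Lp.norm_toLp, hq, eLpNorm_indicator_eq_eLpNorm_restrict measurableSet_Ioo,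
      Lp.norm_def, eLpNorm_congr_ae hg]
    exact congrArg _ (eLpNorm_neg _ _ _).symm
  set a : ℝ → ℝ := fun x => q (idil k 1 (T + x)) with ha
  set b : ℝ → ℝ := fun x => q (T - x) with hb
  have ham : MemLp a 2 volume := (memLp_comp_idil hk hk1 hqm 1).comp_measurePreserving (measurePreserving_add_left volume T)
  have hbm : MemLp b 2 volume := hqm.comp_measurePreserving (Measure.measurePreserving_sub_left volume T)
  have hae : eLpNorm a 2 volume = ENNReal.ofReal |((lam k ^ 1)⁻¹)⁻¹| ^ (1 / 2 : ℝ) *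
      eLpNorm q 2 volume := eLpNorm_comp_idil hk hk1 hqm 1 T
  have hbe : eLpNorm b 2 volume = eLpNorm q 2 volume :=
    eLpNorm_comp_sub_left hqm.1 T
  have han : ‖toLR a‖ = (ENNReal.ofReal |((lam k ^ 1)⁻¹)⁻¹| ^ (1 / 2 : ℝ)).toReal * ‖g‖ := by
    rw [← hqg, toLR_of ham, toLR_of hqm, Lp.norm_toLp, Lp.norm_toLp, ← ENNReal.toReal_mul, hae]
  have hbn : ‖toLR b‖ = ‖g‖ := by
    rw [← hqg, toLR_of hbm, toLR_of hqm, Lp.norm_toLp, Lp.norm_toLp, hbe]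
  have hval : ∀ x ∈ Ioo 0 (endpt k T), a x = lam k * (e x + v x) ∧ b x = e x - v x := by
    intro x hx
    obtain ⟨⟨h1, h2⟩, h3⟩ := dataG_observe (N := N) hk hk1 hT he hv hx
    obtain ⟨h4, h5⟩ := h3 hN
    simp only [ha, hb, hq]
    rw [indicator_of_mem h1, indicator_of_mem h4]
    exact ⟨h5, h2⟩
  have hC : ‖toLR a‖ * (lam k)⁻¹ + ‖toLR b‖ =
      ((lam k)⁻¹ * (ENNReal.ofReal |((lam k ^ 1)⁻¹)⁻¹| ^ (1 / 2 : ℝ)).toReal + 1) * ‖g‖ := by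
    rw [han, hbn]; ring
  rw [← hC, Prod.norm_def]
  refine max_le ?_ ?_
  · rw [show ‖(f₀, f₁).1‖ = ‖H01.grad _ f₀‖ from rfl]
    refine norm_le_of_combination ham hbm (inv_pos.2 hlp).le (ε := 1) (by simp) fun x hx => ?_
    obtain ⟨h1, h2⟩ := hval x hx
    rw [h1, h2, inv_mul_cancel_left₀ hlp.ne']
    ring
  · refine norm_le_of_combination ham hbm (inv_pos.2 hlp).le (ε := -1) (by simp) fun x hx => ?_
    obtain ⟨h1, h2⟩ := hval x hx
    rw [h1, h2, inv_mul_cancel_left₀ hlp.ne']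
    ring

end MovingWave

/-! ### Construction of the control operators. -/

namespace MovingWave

variable {k T : ℝ} {N : ℕ}

theorem Enough.succ (hN : Enough k T N) (hk : 0 < k) (hk1 : k < 1) : Enough k T (N + 1) := by
  refine le_trans hN (mul_le_mul_of_nonneg_right ?_ (div_nonneg (by linarith) hk.le))
  exact pow_le_pow_right₀ (one_lt_lam hk hk1).le (by omega)

theorem isForce_zero : IsForce k T (fun _ => 0) :=
  ⟨stronglyMeasurable_const, MemLp.zero, fun _ _ => rfl⟩

/-- Existence of homogeneous solutions, and the trace of their unfolded data. -/
theorem exists_homogeneous (hk : 0 < k) (hk1 : k < 1) (hT : 0 < T) (hN : Enough k T N)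
    (f : FinalData k T) : ∃ (θ : EnergyPath k) (g : L2 T), IsEnergySolution k T (fun _ _ => 0) θ ∧
      HasNormalDeriv k T θ g ∧ θ.pos T = f.1 ∧ θ.vel T = f.2 ∧
      g =ᵐ[volume.restrict (Ioo 0 T)] fun t =>
      - dataG k N T ((Ioo 0 (endpt k T)).indicator (H01.grad _ f.1))
            ((Ioo 0 (endpt k T)).indicator f.2) t := by
  obtain ⟨θ, g, h1, h2, h3, h4, h5⟩ :=
    exists_energySolution_of_force hk hk1 hT hN isForce_zero f.1 f.2
  refine ⟨θ, g, h1, h2, h3, h4, ?_⟩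
  filter_upwards [h5] with t ht
  rw [ht, gam]
  simp [srcH, unfold, oddRefl]

/-- Existence of finite energy solutions with a square integrable source. -/
theorem exists_energySolution (hk : 0 < k) (hk1 : k < 1) (hT : 0 < T) (h : L2Q k T)
    (f : FinalData k T) : ∃ (θ : EnergyPath k) (g : L2 T),
      IsEnergySolution k T (fun t x => h (t, x)) θ ∧ HasNormalDeriv k T θ g ∧
      θ.pos T = f.1 ∧ θ.vel T = f.2 := by
  obtain ⟨N, hN⟩ := exists_enough hk hk1 T
  obtain ⟨h', hf, hae⟩ := exists_isForce (h := fun t x => h (t, x)) (Lp.memLp h)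
  have hsl := ae_slice_of_ae_domainQ (P := fun t x => h (t, x) = h' (t, x)) hae
  obtain ⟨θ, g, h1, h2, h3, h4, -⟩ := exists_energySolution_of_force hk hk1 hT hN hf f.1 f.2
  refine ⟨θ, g, h1.congr ?_, h2, h3, h4⟩
  filter_upwards [hsl] with t ht
  exact ht.mono fun x hx => hx.symm

theorem wave_ae_slice (hk : 0 < k) (hk1 : k < 1) (w : L2 T) :
    ∀ᵐ t ∂(volume.restrict (Ioo 0 T)), (wave k N (signal w)).pos t
      =ᵐ[volume.restrict (Ioo 0 (endpt k t))]
        fun x => ((memLp_waveU (N := N) hk hk1 w).toLp : L2Q k T) (t, x) := by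
  have h1 := ae_slice_of_ae_domainQ
    (P := fun t x => ((memLp_waveU (N := N) hk hk1 w).toLp : L2Q k T) (t, x) =
      waveU k N (signal w) t x) (memLp_waveU (N := N) hk hk1 w).coeFn_toLp
  filter_upwards [h1] with t ht
  filter_upwards [ht, wave_pos_ae (N := N) hk hk1 (isState_signal w).memLp t] with x hx hx'
  rw [hx', hx]

/-- Both maps are defined by choices, and are linear and bounded because they have adjoints. By
duality with the explicit waves, pairing the state of `w` with `h` is minus pairing `w` with the
normal derivative of the solution of source `h` and zero final data. Pairing `w` with the normal
derivative of a homogeneous solution gives the final state of the wave. -/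
theorem Operators.nonempty (hk : 0 < k) (hk1 : k < 1) (hT : 0 < T) : Nonempty (Operators k T) := by
  obtain ⟨N₀, hN₀⟩ := exists_enough hk hk1 T
  -- One extra reflection ensures `1 ≤ N`, so that the once reflected copy used for observability is
  -- present.
  set N := N₀ + 1 with hNdef
  have hN : Enough k T N := hN₀.succ hk hk1
  have hL := endpt_pos hk.le hT.le
  have := H01.completeSpace hL
  set S₀ : L2 T → L2Q k T := fun w => (memLp_waveU (N := N) hk hk1 w).toLp with hS₀
  have hdual : ∀ (w : L2 T) (h : L2Q k T) (θ : EnergyPath k) (g : L2 T),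
      IsEnergySolution k T (fun t x => h (t, x)) θ → HasNormalDeriv k T θ g →
      inner ℝ (S₀ w) h = - inner ℝ w g + inner ℝ ((wave k N (signal w)).pos T) (θ.vel T) -
        (wave k N (signal w)).vel T (θ.pos T) := by
    intro w h θ g hθ hg
    have h1 := wave_duality' hk hk1 hT hN w (h := fun t x => h (t, x)) (Lp.memLp h) hθ hg
    rw [inner_L2 w g, ← h1, inner_L2Q]
    refine iterated_congr ?_
    filter_upwards [wave_ae_slice (N := N) hk hk1 w] with t ht
    filter_upwards [ht] with x hx
    rw [hx]
  obtain ⟨S, hS⟩ := exists_clm_of_adjoint S₀ fun h => by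
    obtain ⟨θ, g, h1, h2, h3, h4⟩ := exists_energySolution hk hk1 hT h 0
    refine ⟨-innerSL ℝ g, fun w => ?_⟩
    have h5 := hdual w h θ g h1 h2
    rw [h3, h4, Prod.fst_zero, Prod.snd_zero, inner_zero_right, map_zero, add_zero, sub_zero] at h5
    rw [real_inner_comm, h5, real_inner_comm]
    rfl
  choose Θ G hΘ hG hΘp hΘv hGae using exists_homogeneous (N := N) hk hk1 hT hN
  have hflux : ∀ (w : L2 T) (f : FinalData k T), inner ℝ w (G f) =
      inner ℝ ((wave k N (signal w)).pos T) f.2 - (wave k N (signal w)).vel T f.1 := by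
    intro w f
    have h0 : IsEnergySolution k T (fun t x => (0 : L2Q k T) (t, x)) (Θ f) := by
      refine (hΘ f).congr ?_
      have h1 : ∀ᵐ z ∂(volume.restrict (domainQ k T)), (0 : L2Q k T) (z.1, z.2) = 0 :=
        Lp.coeFn_zero _ _ _
      filter_upwards [ae_slice_of_ae_domainQ (P := fun t x => (0 : L2Q k T) (t, x) = 0) h1] with t ht
      exact ht.mono fun x hx => hx.symm
    have h1 := hdual w 0 (Θ f) (G f) h0 (hG f)
    rw [inner_zero_right, hΘp, hΘv] at h1
    linarith
  obtain ⟨D, hD⟩ := exists_clm_of_adjoint G fun w =>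
    ⟨(innerSL ℝ ((wave k N (signal w)).pos T)).comp (ContinuousLinearMap.snd ℝ _ _) -
      ((wave k N (signal w)).vel T).comp (ContinuousLinearMap.fst ℝ _ _), fun f => hflux w f⟩
  refine ⟨⟨S, D, ?_, ?_, ?_, ?_⟩⟩
  · intro w u hu
    have hA := hu.agree_wave hk hk1 hT hN
    filter_upwards [wave_ae_slice (N := N) hk hk1 w, ae_restrict_mem measurableSet_Ioo] with t ht htT
    rw [(hA t (Ioo_subset_Icc_self htT)).1, hS]
    exact ht
  · intro w u hu f
    have hA := hu.agree_wave hk hk1 hT hN T ⟨hT.le, le_rfl⟩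
    rw [hD, hflux, hA.1, hA.2]
  · intro h θ g hθ hg
    refine ext_inner_left ℝ fun w => ?_
    have h1 := hdual w h θ g hθ hg
    rw [inner_sub_right, hD, hflux, ContinuousLinearMap.adjoint_inner_right, hS, h1]
    ring
  · intro hT2
    exact ⟨_, fun f => by rw [hD]; exact norm_le_of_trace hk hk1 hT2 (by omega) f.1 f.2 (hGae f)⟩

end MovingWave

namespace MovingWave

/-! ### Abstract optimization -/

section Abstract

variable {Y H G : Type*} [NormedAddCommGroup Y] [NormedSpace ℝ Y]
  [NormedAddCommGroup H] [InnerProductSpace ℝ H] [NormedAddCommGroup G] [InnerProductSpace ℝ G]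

/-- A strictly convex coercive functional attains its minimum. -/
theorem exists_forall_quadratic_le [CompleteSpace Y] (A : Y →L[ℝ] H) {C : ℝ}
    (hA : ∀ f, ‖f‖ ≤ C * ‖A f‖) (ℓ : StrongDual ℝ Y) {R : Y → ℝ} (hRc : Continuous R)
    (hRv : ConvexOn ℝ univ R) (hR : ∀ f, 0 ≤ R f) :
    ∃ f, ∀ e, 1 / 2 * ‖A f‖ ^ 2 + ℓ f + R f ≤ 1 / 2 * ‖A e‖ ^ 2 + ℓ e + R e := by
  set J : Y → ℝ := fun f => 1 / 2 * ‖A f‖ ^ 2 + ℓ f + R f with hJ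
  have hJc : Continuous J :=
    ((continuous_const.mul (A.continuous.norm.pow 2)).add ℓ.continuous).add hRc
  have hbdd : BddBelow (range J) := by
    -- Completing the square in `‖A f‖` after bounding `ℓ f` below by `-‖ℓ‖ * C * ‖A f‖`.
    refine ⟨-(1 / 2 * (‖ℓ‖ * C) ^ 2), ?_⟩
    rintro _ ⟨f, rfl⟩
    have h1 := ℓ.le_opNorm f
    have h2 := mul_le_mul_of_nonneg_left (hA f) (norm_nonneg ℓ)
    rw [Real.norm_eq_abs] at h1
    have h3 := neg_abs_le (ℓ f)
    simp only [hJ]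
    nlinarith [hR f, sq_nonneg (‖A f‖ - ‖ℓ‖ * C)]
  set m := ⨅ f, J f with hm
  have hmle : ∀ f, m ≤ J f := fun f => ciInf_le hbdd f
  have hseq : ∀ n : ℕ, ∃ f, J f < m + 1 / (n + 1) := fun n =>
    exists_lt_of_ciInf_lt (lt_add_of_pos_right _ (by positivity))
  choose u hu using hseq
  -- The parallelogram law at the midpoint together with convexity of `R`. With the lower bound on
  -- `A` it makes minimizing sequences Cauchy.
  have hpar : ∀ a b, ‖A (a - b)‖ ^ 2 ≤ 4 * (J a + J b - 2 * m) := by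
    intro a b
    have h1 := hmle ((1 / 2 : ℝ) • a + (1 / 2 : ℝ) • b)
    have h2 := hRv.2 (mem_univ a) (mem_univ b) (by norm_num : (0 : ℝ) ≤ 1 / 2)
      (by norm_num : (0 : ℝ) ≤ 1 / 2) (by norm_num)
    have h3 := parallelogram_law_with_norm ℝ (A a) (A b)
    have h4 : ‖(1 / 2 : ℝ) • A a + (1 / 2 : ℝ) • A b‖ = 1 / 2 * ‖A a + A b‖ := by
      rw [← smul_add, norm_smul, Real.norm_of_nonneg (by norm_num)]
    simp only [hJ, map_add, map_smul, smul_eq_mul] at h1 h2 ⊢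
    rw [h4] at h1
    rw [map_sub]
    nlinarith
  have hcau : CauchySeq u := by
    refine cauchySeq_of_le_tendsto_0 (fun N : ℕ => |C| * √(8 * (1 / ((N : ℝ) + 1)))) ?_ ?_
    · intro n p N hn hp
      have h1 : ∀ q : ℕ, N ≤ q → J (u q) ≤ m + 1 / ((N : ℝ) + 1) := fun q hq =>
        (hu q).le.trans (by gcongr)
      have h2 := hpar (u n) (u p)
      rw [dist_eq_norm]
      refine (hA _).trans ((mul_le_mul_of_nonneg_right (le_abs_self C) (norm_nonneg _)).trans ?_)
      refine mul_le_mul_of_nonneg_left (Real.le_sqrt_of_sq_le ?_) (abs_nonneg C)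
      linarith [h1 n hn, h1 p hp]
    · have h1 : Tendsto (fun N : ℕ => 8 * (1 / ((N : ℝ) + 1))) atTop (𝓝 (8 * 0)) :=
        tendsto_one_div_add_atTop_nhds_zero_nat.const_mul 8
      have h2 := (h1.sqrt).const_mul |C|
      simpa using h2
  obtain ⟨f, hf⟩ := cauchySeq_tendsto_of_complete hcau
  refine ⟨f, fun e => le_trans (?_ : J f ≤ m) (hmle e)⟩
  have h1 : Tendsto (fun n => J (u n)) atTop (𝓝 (J f)) := (hJc.tendsto f).comp hf
  have h2 : Tendsto (fun n : ℕ => m + 1 / ((n : ℝ) + 1)) atTop (𝓝 (m + 0)) :=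
    tendsto_one_div_add_atTop_nhds_zero_nat.const_add m
  rw [add_zero] at h2
  exact le_of_tendsto_of_tendsto' h1 h2 fun n => (hu n).le

/-- Variational inequalities of the second kind are uniquely solvable. -/
theorem existsUnique_variational [CompleteSpace Y] (A : Y →L[ℝ] H) {C : ℝ}
    (hA : ∀ f, ‖f‖ ≤ C * ‖A f‖) (ℓ : StrongDual ℝ Y) {R : Y → ℝ} (hRc : Continuous R)
    (hRv : ConvexOn ℝ univ R) (hR : ∀ f, 0 ≤ R f) :
    ∃! f, ∀ e, 0 ≤ inner ℝ (A f) (A (e - f)) + ℓ (e - f) + (R e - R f) := by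
  obtain ⟨f, hf⟩ := exists_forall_quadratic_le A hA ℓ hRc hRv hR
  have hvar : ∀ e, 0 ≤ inner ℝ (A f) (A (e - f)) + ℓ (e - f) + (R e - R f) := by
    intro e
    -- Minimality along the segment from `f` to `e`, with `R` bounded by convexity, divided by `t`.
    -- The quadratic remainder then disappears as `t` tends to zero.
    have key : ∀ t : ℝ, 0 < t → t ≤ 1 →
        0 ≤ inner ℝ (A f) (A (e - f)) + ℓ (e - f) + (R e - R f) + t * (1 / 2 * ‖A (e - f)‖ ^ 2) := by
      intro t ht ht1
      have h1 := hf (f + t • (e - f))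
      have h2 := hRv.2 (mem_univ f) (mem_univ e) (by linarith : 0 ≤ 1 - t) ht.le (by ring)
      have h3 : (1 - t) • f + t • e = f + t • (e - f) := by module
      rw [h3] at h2
      rw [map_add A, map_smul A, norm_add_sq_real, real_inner_smul_right, norm_smul, mul_pow,
        Real.norm_eq_abs, sq_abs, map_add ℓ, map_smul ℓ] at h1
      simp only [smul_eq_mul] at h1 h2
      refine nonneg_of_mul_nonneg_right (a := t) ?_ ht
      linarith
    refine le_of_forall_pos_le_add fun ε hε => ?_
    set q := 1 / 2 * ‖A (e - f)‖ ^ 2 with hq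
    have hq0 : 0 ≤ q := by positivity
    have h1 := key (min 1 (ε / (q + 1))) (lt_min one_pos (by positivity)) (min_le_left _ _)
    have h2 : min 1 (ε / (q + 1)) * q ≤ ε := by
      refine (mul_le_mul_of_nonneg_right (min_le_right _ _) hq0).trans ?_
      rw [div_mul_eq_mul_div, div_le_iff₀ (by positivity)]
      linarith
    linarith
  refine ⟨f, hvar, fun g hg => ?_⟩
  have h1 := hvar g
  have h2 := hg f
  -- Each inequality tested with the other solution: in the sum `ℓ` and `R` cancel, leaving `‖A (g -
  -- f)‖ ^ 2 ≤ 0`.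
  have h3 : ‖A (g - f)‖ ^ 2 = inner ℝ (A g) (A (g - f)) - inner ℝ (A f) (A (g - f)) := by
    rw [← inner_sub_left, ← map_sub, real_inner_self_eq_norm_sq]
  rw [← neg_sub g f, map_neg, map_neg, inner_neg_right] at h2
  have h4 : ‖A (g - f)‖ = 0 := by
    rw [← sq_eq_zero_iff]
    exact le_antisymm (by linarith) (sq_nonneg _)
  have h5 := hA (g - f)
  rw [h4, mul_zero, norm_le_zero_iff, sub_eq_zero] at h5
  exact h5

/-- The resolvent of the positive operator `S† S`. -/
theorem exists_resolvent [CompleteSpace H] [CompleteSpace G] (S : H →L[ℝ] G) {c : ℝ} (hc : 0 ≤ c) :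
    ∃ M : H →L[ℝ] H, (∀ u, M u + c • S.adjoint (S (M u)) = u) ∧
      (∀ v, M (v + c • S.adjoint (S v)) = v) ∧ ∀ u v, inner ℝ (M u) v = inner ℝ u (M v) := by
  set b : H →L[ℝ] H := ContinuousLinearMap.id ℝ H + c • (S.adjoint.comp S) with hb
  have hbv : ∀ v, b v = v + c • S.adjoint (S v) := fun v => rfl
  set β : H →L[ℝ] H →L[ℝ] ℝ := isBoundedBilinearMap_inner.toContinuousLinearMap.comp b with hβ
  have hβv : ∀ v w, β v w = inner ℝ (b v) w := fun v w => rfl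
  have hsym : ∀ v w, inner ℝ (b v) w = inner ℝ v (b w) := fun v w => by
    rw [hbv, hbv, inner_add_left, inner_add_right, real_inner_smul_left, real_inner_smul_right,
      ContinuousLinearMap.adjoint_inner_left, ContinuousLinearMap.adjoint_inner_right]
  -- Lax-Milgram inverts `b`, which is bounded below by the identity.
  have hco : IsCoercive β := by
    refine ⟨1, one_pos, fun v => ?_⟩
    rw [hβv, hbv, inner_add_left, real_inner_smul_left, ContinuousLinearMap.adjoint_inner_left,
      real_inner_self_eq_norm_mul_norm, real_inner_self_eq_norm_mul_norm, one_mul]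
    have := mul_nonneg hc (mul_self_nonneg ‖S v‖)
    linarith
  set E := hco.continuousLinearEquivOfBilin with hE
  have hEv : ∀ v, E v = b v := fun v => ext_inner_right ℝ fun w => by
    rw [hE, IsCoercive.continuousLinearEquivOfBilin_apply, hβv]
  have h1 : ∀ u, b (E.symm u) = u := fun u => by rw [← hEv, E.apply_symm_apply]
  refine ⟨E.symm, h1, fun v => ?_, fun u v => ?_⟩
  · rw [← hbv, ← hEv]
    exact E.symm_apply_apply v
  · have h2 := hsym (E.symm u) (E.symm v)
    rw [h1, h1] at h2
    exact h2.symm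

/-- The Euler equation of a linear-quadratic problem. -/
theorem forall_cost_le_iff [CompleteSpace H] [CompleteSpace G] (S : H →L[ℝ] G) (z : G) {σ : ℝ}
    (hσ : 0 < σ) (w₁ w₂ : H) :
    (∀ v, 1 / 2 * ‖S (w₁ + w₂) - z‖ ^ 2 + σ / 2 * ‖w₂‖ ^ 2 ≤
        1 / 2 * ‖S (w₁ + v) - z‖ ^ 2 + σ / 2 * ‖v‖ ^ 2) ↔
      σ • w₂ + S.adjoint (S (w₁ + w₂) - z) = 0 := by
  set g := σ • w₂ + S.adjoint (S (w₁ + w₂) - z) with hg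
  have hexp : ∀ d, 1 / 2 * ‖S (w₁ + (w₂ + d)) - z‖ ^ 2 + σ / 2 * ‖w₂ + d‖ ^ 2 =
      1 / 2 * ‖S (w₁ + w₂) - z‖ ^ 2 + σ / 2 * ‖w₂‖ ^ 2 + inner ℝ g d +
        (1 / 2 * ‖S d‖ ^ 2 + σ / 2 * ‖d‖ ^ 2) := by
    intro d
    have h1 : S (w₁ + (w₂ + d)) - z = (S (w₁ + w₂) - z) + S d := by
      rw [← add_assoc, map_add S (w₁ + w₂)]; abel
    rw [h1, norm_add_sq_real, norm_add_sq_real, hg, inner_add_left, real_inner_smul_left,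
      ContinuousLinearMap.adjoint_inner_left]
    ring
  constructor
  · intro h
    set c := 1 / 2 * ‖S g‖ ^ 2 + σ / 2 * ‖g‖ ^ 2 with hc
    have hc0 : 0 ≤ c := by positivity
    by_contra hne
    have ha : 0 < ‖g‖ ^ 2 := by positivity
    -- A step `-t • g` this short has `t * c < ‖g‖ ^ 2`, so it would lower the cost.
    set t := ‖g‖ ^ 2 / (c + 1) with ht
    have ht0 : 0 < t := by positivity
    have h1 := h (w₂ + (-t) • g)
    rw [hexp, real_inner_smul_right, real_inner_self_eq_norm_sq, map_smul, norm_smul, norm_smul,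
      mul_pow, mul_pow, Real.norm_eq_abs, sq_abs] at h1
    have h2 : 0 ≤ t * (t * c - ‖g‖ ^ 2) := by rw [hc]; linarith
    have h3 : t * (c + 1) = ‖g‖ ^ 2 := div_mul_cancel₀ _ (by positivity)
    have h4 := nonneg_of_mul_nonneg_right h2 ht0
    linarith
  · intro h v
    have h1 := hexp (v - w₂)
    rw [add_sub_cancel, h, inner_zero_left] at h1
    rw [h1]
    have : 0 ≤ 1 / 2 * ‖S (v - w₂)‖ ^ 2 + σ / 2 * ‖v - w₂‖ ^ 2 := by positivity
    linarith

/-- A product of balls in terms of its support function. -/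
theorem norm_le_and_norm_le_iff {Y : Type*} [NormedAddCommGroup Y] [NormedSpace ℝ Y]
    (a : StrongDual ℝ Y) (p : H) {r s : ℝ} (hr : 0 ≤ r) (hs : 0 ≤ s) :
    (‖p‖ ≤ r ∧ ‖a‖ ≤ s) ↔ ∀ e : Y × H, 0 ≤ a e.1 - inner ℝ p e.2 + (s * ‖e.1‖ + r * ‖e.2‖) := by
  constructor
  · rintro ⟨hp, ha⟩ e
    have h1 := (a.le_opNorm e.1).trans (mul_le_mul_of_nonneg_right ha (norm_nonneg _))
    rw [Real.norm_eq_abs] at h1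
    have h2 := (real_inner_le_norm p e.2).trans (mul_le_mul_of_nonneg_right hp (norm_nonneg _))
    linarith [neg_abs_le (a e.1)]
  · intro h
    refine ⟨?_, a.opNorm_le_bound hs fun e => ?_⟩
    -- The test direction `p` itself gives `‖p‖ ^ 2 ≤ r * ‖p‖`.
    · have h1 := h (0, p)
      rw [map_zero, norm_zero, real_inner_self_eq_norm_sq] at h1
      by_contra! hlt
      nlinarith [norm_nonneg p]
    · have h1 := h (e, 0)
      have h2 := h (-e, 0)
      rw [inner_zero_right, norm_zero] at h1 h2
      rw [map_neg, norm_neg] at h2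
      rw [Real.norm_eq_abs, abs_le]
      constructor <;> linarith

/-- The solution of a variational inequality solves a norm minimization problem. -/
theorem norm_le_iff_eq_of_variational {Y : Type*} [NormedAddCommGroup Y] [NormedSpace ℝ Y]
    (A : Y →L[ℝ] H) (ℓ : StrongDual ℝ Y) {R : Y → ℝ} (hR0 : R 0 = 0)
    (hR2 : ∀ e, R ((2 : ℝ) • e) = 2 * R e) {f : Y}
    (hf : ∀ e, 0 ≤ inner ℝ (A f) (A (e - f)) + ℓ (e - f) + (R e - R f)) {K : Set H}
    (hK : ∀ v, v ∈ K ↔ ∀ e, 0 ≤ -inner ℝ v (A e) + ℓ e + R e) (w : H) :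
    (w ∈ K ∧ ∀ v ∈ K, ‖w‖ ≤ ‖v‖) ↔ w = -A f := by
  -- Testing with `0` and with `2 • f`, and using homogeneity of `R`, turns the inequality into an
  -- equality along `f`.
  have h0 := hf 0
  have h2 := hf ((2 : ℝ) • f)
  rw [show (2 : ℝ) • f - f = f by module, hR2] at h2
  rw [zero_sub, map_neg, map_neg, inner_neg_right, hR0] at h0
  have hz : inner ℝ (A f) (A f) + ℓ f + R f = 0 := by linarith
  have hmem : -A f ∈ K := by
    rw [hK]
    intro e
    have h3 := hf e
    rw [map_sub, map_sub, inner_sub_right] at h3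
    rw [inner_neg_left]
    linarith
  -- `K` lies in a half-space whose point closest to the origin is `-A f`, an element of `K`.
  have hle : ∀ v ∈ K, inner ℝ v (A f) ≤ -‖A f‖ ^ 2 := by
    intro v hv
    have h3 := (hK v).1 hv f
    rw [real_inner_self_eq_norm_sq] at hz
    linarith
  constructor
  · rintro ⟨hw, hmin⟩
    have h3 := hmin _ hmem
    rw [norm_neg] at h3
    have h4 := norm_add_sq_real w (A f)
    have h5 := pow_le_pow_left₀ (norm_nonneg w) h3 2
    have h6 : ‖w + A f‖ = 0 := by
      rw [← sq_eq_zero_iff]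
      exact le_antisymm (by linarith [hle w hw]) (sq_nonneg _)
    exact eq_neg_of_add_eq_zero_left (norm_eq_zero.1 h6)
  · rintro rfl
    refine ⟨hmem, fun v hv => ?_⟩
    rw [norm_neg]
    have h3 := hle v hv
    have h4 := real_inner_le_norm v (-A f)
    rw [inner_neg_right, norm_neg] at h4
    by_contra! hlt
    nlinarith [norm_nonneg v]

end Abstract

end MovingWave

namespace MovingWave

/-! ### The control problem in operator form -/

variable {k T σ : ℝ} {z : ℝ → ℝ → ℝ}

theorem exists_transpSolution (hk : 0 < k) (hk1 : k < 1) (hT : 0 < T) (w : L2 T) :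
    ∃ u, IsTranspSolution k T w u := by
  obtain ⟨N, hN⟩ := exists_enough hk hk1 T
  exact ⟨_, isTranspSolution_wave hk hk1 hT hN w⟩

theorem sub_target_ae (O : Operators k T)
    (hz : MemLp (Function.uncurry z) 2 (volume.restrict (domainQ k T))) {w : L2 T} {u : TranspPath k}
    (hu : IsTranspSolution k T w u) : ∀ᵐ t ∂(volume.restrict (Ioo 0 T)),
      (fun x => u.pos t x - z t x) =ᵐ[volume.restrict (Ioo 0 (endpt k t))]
        fun x => (O.state w - hz.toLp : L2Q k T) (t, x) := by
  have h1 := ae_slice_of_ae_domainQ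
    (P := fun t x => (O.state w - hz.toLp : L2Q k T) (t, x) =
      O.state w (t, x) - (hz.toLp : L2Q k T) (t, x)) (Lp.coeFn_sub _ _)
  have h2 := ae_slice_of_ae_domainQ
    (P := fun t x => (hz.toLp : L2Q k T) (t, x) = z t x) hz.coeFn_toLp
  filter_upwards [h1, h2, O.state_ae w u hu] with t ht1 ht2 ht3
  filter_upwards [ht1, ht2, ht3] with x hx1 hx2 hx3
  rw [hx1, hx2, hx3]

theorem norm_sq_L2 (w : L2 T) : ‖w‖ ^ 2 = ∫ t in Ioo 0 T, (w t) ^ 2 := by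
  rw [← real_inner_self_eq_norm_sq, inner_L2]
  simp only [sq]

theorem leaderCost_eq (w : L2 T) : leaderCost w = 1 / 2 * ‖w‖ ^ 2 := by
  rw [leaderCost, norm_sq_L2]

theorem leaderCost_le_iff (v w : L2 T) : leaderCost v ≤ leaderCost w ↔ ‖v‖ ≤ ‖w‖ := by
  rw [leaderCost_eq, leaderCost_eq, mul_le_mul_iff_right₀ (by norm_num),
    pow_le_pow_iff_left₀ (norm_nonneg _) (norm_nonneg _) two_ne_zero]

theorem followerCost_eq (O : Operators k T)
    (hz : MemLp (Function.uncurry z) 2 (volume.restrict (domainQ k T))) {w : L2 T} {u : TranspPath k}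
    (hu : IsTranspSolution k T w u) (v : L2 T) :
    followerCost k T σ z u v = 1 / 2 * ‖O.state w - hz.toLp‖ ^ 2 + σ / 2 * ‖v‖ ^ 2 := by
  rw [followerCost, ← norm_sq_L2, ← real_inner_self_eq_norm_sq (O.state w - hz.toLp), inner_L2Q]
  congr 2
  refine iterated_congr ?_
  filter_upwards [sub_target_ae O hz hu] with t ht
  filter_upwards [ht] with x hx
  rw [hx, sq]

/-- A state exists for every control and the cost depends only on the controls. Minimality over
pairs is therefore minimality of a quadratic functional of the follower control. -/
theorem isNash_iff (hk : 0 < k) (hk1 : k < 1) (hT : 0 < T) (hσ : 0 < σ) (O : Operators k T)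
    (hz : MemLp (Function.uncurry z) 2 (volume.restrict (domainQ k T))) (w₁ w₂ : L2 T)
    (u : TranspPath k) : IsNash k T σ z w₁ w₂ u ↔ IsTranspSolution k T (w₁ + w₂) u ∧
      σ • w₂ + O.state.adjoint (O.state (w₁ + w₂) - hz.toLp) = 0 := by
  refine and_congr_right fun hu => ?_
  rw [← forall_cost_le_iff O.state _ hσ]
  refine ⟨fun h v₂ => ?_, fun h v₂ v hv => ?_⟩
  · obtain ⟨v, hv⟩ := exists_transpSolution hk hk1 hT (w₁ + v₂)
    have h1 := h v₂ v hv
    rwa [followerCost_eq O hz hu, followerCost_eq O hz hv] at h1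
  · rw [followerCost_eq O hz hu, followerCost_eq O hz hv]
    exact h v₂

/-- The equation for the total control. -/
theorem total_control_iff (S : L2 T →L[ℝ] L2Q k T) (ζ : L2Q k T) (a y : L2 T) :
    y = a + σ⁻¹ • (-S.adjoint (S y - ζ)) ↔
      y + σ⁻¹ • S.adjoint (S y) = a + σ⁻¹ • S.adjoint ζ := by
  rw [map_sub, neg_sub, smul_sub, ← add_sub_assoc, eq_sub_iff_add_eq]

/-- `Operators.normal_eq` applied to `φ`, whose source is the state of the control `σ⁻¹ • S.dφ`, and
to `p`, whose final data vanish. The system is thereby reduced to equations between boundary traces.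
-/
theorem IsOptimalitySystem.equations (O : Operators k T)
    (hz : MemLp (Function.uncurry z) 2 (volume.restrict (domainQ k T)))
    {f₀ : H01 (endpt k T)} {f₁ : L2 (endpt k T)} {S : Quadruple k T}
    (hS : IsOptimalitySystem k T σ z f₀ f₁ S) :
    S.dφ + σ⁻¹ • O.state.adjoint (O.state S.dφ) = O.flux (f₀, f₁) ∧
      S.dp = -O.state.adjoint (O.state (-S.dφ + σ⁻¹ • S.dp) - hz.toLp) ∧
      -S.dφ + σ⁻¹ • S.dp + σ⁻¹ • O.state.adjoint (O.state (-S.dφ + σ⁻¹ • S.dp)) =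
        -S.dφ + σ⁻¹ • O.state.adjoint hz.toLp := by
  have h2 : S.dp = -O.state.adjoint (O.state (-S.dφ + σ⁻¹ • S.dp) - hz.toLp) := by
    have h1 := O.normal_eq _ _ _ (hS.p_solution.congr (sub_target_ae O hz hS.u_solution))
      hS.p_normal
    rwa [hS.p_final_pos, hS.p_final_vel, show ((0, 0) : FinalData k T) = 0 from rfl, map_zero,
      zero_sub] at h1
  refine ⟨?_, h2, ?_⟩
  · have h1 := O.normal_eq _ _ _ (hS.phi_solution.congr (O.state_ae _ _ hS.psi_solution))
      hS.phi_normal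
    rw [hS.phi_final_pos, hS.phi_final_vel, map_smul, map_smul] at h1
    exact eq_sub_iff_add_eq.1 h1
  · rw [← total_control_iff, ← h2]

/-- The trace equations are triangular: one resolvent yields the normal derivative of `φ` from the
data, a second yields the total control. The four components are built from these, and
`Operators.normal_eq` shows that the resulting normal derivatives are the required ones, which
closes the coupling. -/
theorem exists_optimalitySystem (hk : 0 < k) (hk1 : k < 1) (hT : 0 < T) (hσ : 0 < σ)
    (hz : MemLp (Function.uncurry z) 2 (volume.restrict (domainQ k T)))
    (f₀ : H01 (endpt k T)) (f₁ : L2 (endpt k T)) :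
    ∃ S : Quadruple k T, IsOptimalitySystem k T σ z f₀ f₁ S := by
  obtain ⟨O⟩ := Operators.nonempty hk hk1 hT
  obtain ⟨M, hM1, -, -⟩ := exists_resolvent O.state (inv_pos.2 hσ).le
  set a := M (O.flux (f₀, f₁)) with ha
  have ha1 := hM1 (O.flux (f₀, f₁))
  rw [← ha] at ha1
  set y := M (-a + σ⁻¹ • O.state.adjoint hz.toLp) with hy
  have hy1 := hM1 (-a + σ⁻¹ • O.state.adjoint hz.toLp)
  rw [← hy] at hy1
  obtain ⟨ψ, hψ⟩ := exists_transpSolution hk hk1 hT (σ⁻¹ • a)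
  obtain ⟨u, hu⟩ := exists_transpSolution hk hk1 hT y
  obtain ⟨φ, dφ, hφ, hdφ, hφp, hφv⟩ :=
    exists_energySolution hk hk1 hT (O.state (σ⁻¹ • a)) (f₀, f₁)
  obtain ⟨p, dp, hp, hdp, hpp, hpv⟩ :=
    exists_energySolution hk hk1 hT (O.state y - hz.toLp) 0
  have hdφ' : dφ = a := by
    rw [O.normal_eq _ _ _ hφ hdφ, hφp, hφv, map_smul, map_smul]
    exact (eq_sub_iff_add_eq.2 ha1).symm
  have hdp' : dp = -O.state.adjoint (O.state y - hz.toLp) := by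
    rw [O.normal_eq _ _ _ hp hdp, hpp, hpv]
    change O.flux 0 - _ = _
    rw [map_zero, zero_sub]
  have hyw : -dφ + σ⁻¹ • dp = y := by
    rw [hdφ', hdp']
    exact ((total_control_iff _ _ _ _).2 hy1).symm
  refine ⟨⟨φ, ψ, u, p, dφ, dp⟩, ⟨hφ.congr ?_, hdφ, hφp, hφv, ?_, ?_, hp.congr ?_, hdp, hpp, hpv⟩⟩
  · filter_upwards [O.state_ae _ _ hψ] with t ht using ht.symm
  · rwa [hdφ']
  · rwa [hyw]
  · filter_upwards [sub_target_ae O hz hu] with t ht using ht.symm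

/-- Injectivity of `1 + σ⁻¹ S†S` determines the normal derivative of `φ`, then the total control,
then the normal derivative of `p`. Uniqueness for each linear problem gives the paths. -/
theorem IsOptimalitySystem.agree (hk : 0 < k) (hk1 : k < 1) (hT : 0 < T) (hσ : 0 < σ)
    (hz : MemLp (Function.uncurry z) 2 (volume.restrict (domainQ k T)))
    {f₀ : H01 (endpt k T)} {f₁ : L2 (endpt k T)} {S S' : Quadruple k T}
    (hS : IsOptimalitySystem k T σ z f₀ f₁ S) (hS' : IsOptimalitySystem k T σ z f₀ f₁ S') :
    S.Agree S' := by
  obtain ⟨O⟩ := Operators.nonempty hk hk1 hT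
  obtain ⟨M, -, hM2, -⟩ := exists_resolvent O.state (inv_pos.2 hσ).le
  obtain ⟨h1, h2, h3⟩ := hS.equations O hz
  obtain ⟨h1', h2', h3'⟩ := hS'.equations O hz
  have hdφ : S.dφ = S'.dφ := by rw [← hM2 S.dφ, h1, ← h1', hM2]
  have hw : -S.dφ + σ⁻¹ • S.dp = -S'.dφ + σ⁻¹ • S'.dp := by
    rw [← hM2 (-S.dφ + σ⁻¹ • S.dp), h3, hdφ, ← h3', hM2]
  have hdp : S.dp = S'.dp := by rw [h2, hw, ← h2']
  have hψ : S.ψ.AgreeOn T S'.ψ := by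
    have h3 := hS.psi_solution
    rw [hdφ] at h3
    exact h3.unique hk hk1 hT hS'.psi_solution
  have hu : S.u.AgreeOn T S'.u := by
    have h3 := hS.u_solution
    rw [hw] at h3
    exact h3.unique hk hk1 hT hS'.u_solution
  have hφ : IsEnergySolution k T (fun t x => S'.ψ.pos t x) S.φ := by
    refine hS.phi_solution.congr ?_
    filter_upwards [ae_restrict_mem measurableSet_Ioo] with t ht
    rw [(hψ t (Ioo_subset_Icc_self ht)).1]
  have hp : IsEnergySolution k T (fun t x => S'.u.pos t x - z t x) S.p := by
    refine hS.p_solution.congr ?_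
    filter_upwards [ae_restrict_mem measurableSet_Ioo] with t ht
    rw [(hu t (Ioo_subset_Icc_self ht)).1]
  exact ⟨hφ.unique hS'.phi_solution hk hT (hS.phi_final_pos.trans hS'.phi_final_pos.symm)
      (hS.phi_final_vel.trans hS'.phi_final_vel.symm), hψ, hu,
    hp.unique hS'.p_solution hk hT (hS.p_final_pos.trans hS'.p_final_pos.symm)
      (hS.p_final_vel.trans hS'.p_final_vel.symm), hdφ, hdp⟩

/-- The variational inequality and the admissible controls in terms of the operator mapping the
final data to the normal derivative. -/
theorem exists_reduction (hk : 0 < k) (hk1 : k < 1) (hT : 2 / (1 - k) ≤ T) (hσ : 0 < σ)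
    {ρ₀ ρ₁ : ℝ} (hρ₀ : 0 ≤ ρ₀) (hρ₁ : 0 ≤ ρ₁)
    (hz : MemLp (Function.uncurry z) 2 (volume.restrict (domainQ k T)))
    (u₀ : L2 (endpt k T)) (u₁ : Hm1 (endpt k T)) :
    ∃ (A : FinalData k T →L[ℝ] L2 T) (ℓ : StrongDual ℝ (FinalData k T)),
      (∃ C, ∀ f, ‖f‖ ≤ C * ‖A f‖) ∧
      (∀ (f : FinalData k T) (S : Quadruple k T), IsOptimalitySystem k T σ z f.1 f.2 S →
        S.dφ = A f ∧ (VariationalInequality k T ρ₀ ρ₁ u₀ u₁ f.1 f.2 S.u ↔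
          ∀ e, 0 ≤ inner ℝ (A f) (A (e - f)) + ℓ (e - f) +
            ((ρ₁ * ‖e.1‖ + ρ₀ * ‖e.2‖) - (ρ₁ * ‖f.1‖ + ρ₀ * ‖f.2‖)))) ∧
      ∀ v, Admissible k T σ ρ₀ ρ₁ z u₀ u₁ v ↔
        ∀ e, 0 ≤ -inner ℝ v (A e) + ℓ e + (ρ₁ * ‖e.1‖ + ρ₀ * ‖e.2‖) := by
  have hT0 : 0 < T := lt_of_lt_of_le (div_pos two_pos (by linarith)) hT
  obtain ⟨O⟩ := Operators.nonempty hk hk1 hT0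
  obtain ⟨M, hM1, hM2, hM3⟩ := exists_resolvent O.state (inv_pos.2 hσ).le
  set b : L2 T := σ⁻¹ • O.state.adjoint hz.toLp with hb
  set A : FinalData k T →L[ℝ] L2 T := M.comp O.flux with hA
  -- `ℓ` collects what does not depend on the leader: the effect of the desired state through `b`,
  -- and the centres of the balls.
  set ℓ : StrongDual ℝ (FinalData k T) := -((innerSL ℝ b).comp A) -
    (u₁.comp (ContinuousLinearMap.fst ℝ _ _) -
      (innerSL ℝ u₀).comp (ContinuousLinearMap.snd ℝ _ _)) with hℓ
  have hℓe : ∀ e, ℓ e = -inner ℝ b (A e) - (u₁ e.1 - inner ℝ u₀ e.2) := fun e => rfl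
  have hfinal : ∀ (a y : L2 T) (u : TranspPath k), y + σ⁻¹ • O.state.adjoint (O.state y) = a + b →
      IsTranspSolution k T y u → ∀ e : FinalData k T,
      (u.vel T - u₁) e.1 - inner ℝ (u.pos T - u₀) e.2 = -inner ℝ a (A e) + ℓ e := by
    intro a y u hy hu e
    have h1 := O.inner_flux y u hu e
    -- The total control is `M (a + b)`; self-adjointness moves `M` onto the flux.
    have h2 : inner ℝ y (O.flux e) = inner ℝ (a + b) (A e) := by
      rw [← hM2 y, hy, hM3]; rfl
    rw [h2, inner_add_left] at h1
    rw [hℓe, sub_apply, inner_sub_left]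
    linarith
  refine ⟨A, ℓ, ?_, fun f S hS => ?_, fun v => ?_⟩
  · obtain ⟨C, hC⟩ := O.observability hT
    set B : L2 T →L[ℝ] L2 T :=
      ContinuousLinearMap.id ℝ _ + σ⁻¹ • (O.state.adjoint.comp O.state) with hB
    refine ⟨|C| * ‖B‖, fun f => (hC f).trans ?_⟩
    -- Observability passes from the flux to `A` because the inverse of `M` is the bounded operator
    -- `B`.
    have h1 : O.flux f = B (A f) := (hM1 (O.flux f)).symm
    rw [mul_assoc]
    refine (mul_le_mul_of_nonneg_right (le_abs_self C) (norm_nonneg _)).trans ?_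
    rw [h1]
    exact mul_le_mul_of_nonneg_left (B.le_opNorm _) (abs_nonneg C)
  · obtain ⟨h1, h2, h3⟩ := hS.equations O hz
    have hdφ : S.dφ = A f := by
      rw [← hM2 S.dφ, h1]; rfl
    refine ⟨hdφ, ?_⟩
    have h4 := hfinal _ _ _ h3 hS.u_solution
    simp only [hdφ, inner_neg_left, neg_neg] at h4
    have h5 : ∀ e : FinalData k T, (S.u.vel T - u₁) (e.1 - f.1) -
        inner ℝ (S.u.pos T - u₀) (e.2 - f.2) + ρ₁ * (‖e.1‖ - ‖f.1‖) + ρ₀ * (‖e.2‖ - ‖f.2‖) =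
        inner ℝ (A f) (A (e - f)) + ℓ (e - f) +
          ((ρ₁ * ‖e.1‖ + ρ₀ * ‖e.2‖) - (ρ₁ * ‖f.1‖ + ρ₀ * ‖f.2‖)) := by
      intro e
      rw [← h4, Prod.fst_sub, Prod.snd_sub]
      ring
    refine ⟨fun h e => ?_, fun h e₀ e₁ => ?_⟩
    · rw [← h5]
      exact h e.1 e.2
    · have := h (e₀, e₁)
      rwa [← h5] at this
  · have hball : ∀ (y : L2 T) (u : TranspPath k),
        y + σ⁻¹ • O.state.adjoint (O.state y) = v + b → IsTranspSolution k T y u →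
        ((u.pos T ∈ Metric.closedBall u₀ ρ₀ ∧ u.vel T ∈ Metric.closedBall u₁ ρ₁) ↔
          ∀ e, 0 ≤ -inner ℝ v (A e) + ℓ e + (ρ₁ * ‖e.1‖ + ρ₀ * ‖e.2‖)) := by
      intro y u hy hu
      rw [mem_closedBall_iff_norm, mem_closedBall_iff_norm, norm_le_and_norm_le_iff _ _ hρ₀ hρ₁]
      simp only [hfinal v y u hy hu]
    have hnash : ∀ w₂ : L2 T, σ • w₂ + O.state.adjoint (O.state (v + w₂) - hz.toLp) = 0 ↔
        v + w₂ + σ⁻¹ • O.state.adjoint (O.state (v + w₂)) = v + b := by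
      intro w₂
      rw [← total_control_iff, add_right_inj, eq_inv_smul_iff₀ hσ.ne', eq_neg_iff_add_eq_zero]
    constructor
    · rintro ⟨w₂, u, hN, hpv⟩
      rw [isNash_iff hk hk1 hT0 hσ O hz, hnash] at hN
      exact (hball _ u hN.2 hN.1).1 hpv
    · intro h
      obtain ⟨u, hu⟩ := exists_transpSolution hk hk1 hT0 (M (v + b))
      have h1 := hM1 (v + b)
      -- The follower control is the total control minus that of the leader.
      refine ⟨M (v + b) - v, u, ?_, (hball _ u h1 hu).2 h⟩
      rw [isNash_iff hk hk1 hT0 hσ O hz, hnash, add_sub_cancel]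
      exact ⟨hu, h1⟩

/-- The final time of the theorem exceeds the time `2 / (1 - k)` needed for observability. -/
theorem two_div_le_of_exp_lt (hk : 0 < k) (hk1 : k < 1)
    (hT : (Real.exp (2 * k * (1 + k) / (1 - k) ^ 3) - 1) / k < T) : 2 / (1 - k) ≤ T := by
  have h1k : 0 < 1 - k := by linarith
  -- The linear lower bound of the exponential gives `T > 2 (1 + k) / (1 - k)³`, and comparison with
  -- `2 / (1 - k)` reduces to `(1 - k)² ≤ 1 + k`.
  have h1 := Real.add_one_le_exp (2 * k * (1 + k) / (1 - k) ^ 3)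
  have h2 : 2 / (1 - k) ≤ 2 * (1 + k) / (1 - k) ^ 3 := by
    rw [div_le_div_iff₀ h1k (by positivity)]
    have h3 : 0 ≤ 2 * (1 - k) * ((1 + k) - (1 - k) ^ 2) := by
      refine mul_nonneg (by linarith) ?_
      nlinarith
    nlinarith
  have h3 : 2 * (1 + k) / (1 - k) ^ 3 = 2 * k * (1 + k) / (1 - k) ^ 3 / k := by
    field_simp
  have h4 : 2 * k * (1 + k) / (1 - k) ^ 3 / k ≤
      (Real.exp (2 * k * (1 + k) / (1 - k) ^ 3) - 1) / k :=
    div_le_div_of_nonneg_right (by linarith) hk.le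
  linarith

end MovingWave

theorem theorem5p1 (k T σ ρ₀ ρ₁ : ℝ) (hk₀ : 0 < k) (hk₁ : k < 1)
    (hT : (Real.exp (2 * k * (1 + k) / (1 - k) ^ 3) - 1) / k < T)
    (hσ : 0 < σ) (hρ₀ : 0 < ρ₀) (hρ₁ : 0 < ρ₁)
    (z : ℝ → ℝ → ℝ)
    (hz : MemLp (Function.uncurry z) 2 (volume.restrict (MovingWave.domainQ k T)))
    (u₀ : MovingWave.L2 (MovingWave.endpt k T)) (u₁ : MovingWave.Hm1 (MovingWave.endpt k T)) :
    -- the optimality system is uniquely solvable for all data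
    (∀ (f₀ : MovingWave.H01 (MovingWave.endpt k T)) (f₁ : MovingWave.L2 (MovingWave.endpt k T)),
      (∃ S : MovingWave.Quadruple k T, MovingWave.IsOptimalitySystem k T σ z f₀ f₁ S) ∧
      ∀ S S' : MovingWave.Quadruple k T, MovingWave.IsOptimalitySystem k T σ z f₀ f₁ S →
        MovingWave.IsOptimalitySystem k T σ z f₀ f₁ S' → S.Agree S') ∧
    -- the variational inequality determines the data uniquely
    (∃! f : MovingWave.H01 (MovingWave.endpt k T) × MovingWave.L2 (MovingWave.endpt k T),
      ∃ S : MovingWave.Quadruple k T, MovingWave.IsOptimalitySystem k T σ z f.1 f.2 S ∧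
        MovingWave.VariationalInequality k T ρ₀ ρ₁ u₀ u₁ f.1 f.2 S.u) ∧
    -- for these data, the optimal leader control is minus the normal derivative of `φ`
    (∀ (f₀ : MovingWave.H01 (MovingWave.endpt k T)) (f₁ : MovingWave.L2 (MovingWave.endpt k T))
      (S : MovingWave.Quadruple k T), MovingWave.IsOptimalitySystem k T σ z f₀ f₁ S →
      MovingWave.VariationalInequality k T ρ₀ ρ₁ u₀ u₁ f₀ f₁ S.u →
      ∀ w₁ : MovingWave.L2 T,
        MovingWave.IsOptimalLeader k T σ ρ₀ ρ₁ z u₀ u₁ w₁ ↔ w₁ = -S.dφ) := by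
  have hT2 := MovingWave.two_div_le_of_exp_lt hk₀ hk₁ hT
  have hT0 : 0 < T := lt_of_lt_of_le (div_pos two_pos (by linarith)) hT2
  have hexist := MovingWave.exists_optimalitySystem hk₀ hk₁ hT0 hσ hz
  have := MovingWave.H01.completeSpace (MovingWave.endpt_pos hk₀.le hT0.le)
  obtain ⟨A, ℓ, ⟨C, hC⟩, hvar, hadm⟩ :=
    MovingWave.exists_reduction hk₀ hk₁ hT2 hσ hρ₀.le hρ₁.le hz u₀ u₁
  refine ⟨fun f₀ f₁ => ⟨hexist f₀ f₁, fun S S' hS hS' => hS.agree hk₀ hk₁ hT0 hσ hz hS'⟩, ?_, ?_⟩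
  -- `R` is the support function of the product of the two balls of admissible final errors, up to
  -- the signs of the pairing.
  · set R : MovingWave.FinalData k T → ℝ := fun e => ρ₁ * ‖e.1‖ + ρ₀ * ‖e.2‖ with hR
    have hRc : Continuous R :=
      (continuous_const.mul continuous_fst.norm).add (continuous_const.mul continuous_snd.norm)
    have hRv : ConvexOn ℝ Set.univ R := by
      refine ⟨convex_univ, fun a _ b _ s t hs ht _ => ?_⟩
      have h1 := norm_add_le (s • a.1) (t • b.1)
      have h2 := norm_add_le (s • a.2) (t • b.2)
      rw [norm_smul, norm_smul, Real.norm_of_nonneg hs, Real.norm_of_nonneg ht] at h1 h2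
      have h3 := mul_le_mul_of_nonneg_left h1 hρ₁.le
      have h4 := mul_le_mul_of_nonneg_left h2 hρ₀.le
      simp only [hR, Prod.fst_add, Prod.snd_add, Prod.smul_fst, Prod.smul_snd, smul_eq_mul]
      linarith
    obtain ⟨f, hf, huniq⟩ := MovingWave.existsUnique_variational A hC ℓ hRc hRv
      fun e => by positivity
    refine ⟨f, ?_, ?_⟩
    · obtain ⟨S, hS⟩ := hexist f.1 f.2
      exact ⟨S, hS, (hvar f S hS).2.2 hf⟩
    · rintro g ⟨S, hS, hg⟩
      exact huniq g ((hvar g S hS).2.1 hg)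
  · intro f₀ f₁ S hS hf w₁
    obtain ⟨hdφ, hiff⟩ := hvar (f₀, f₁) S hS
    have h1 := MovingWave.norm_le_iff_eq_of_variational A ℓ
      (R := fun e => ρ₁ * ‖e.1‖ + ρ₀ * ‖e.2‖) (by simp)
      (fun e => by simp only [Prod.smul_fst, Prod.smul_snd, norm_smul, Real.norm_ofNat]; ring)
      (hiff.1 hf) (K := {v | MovingWave.Admissible k T σ ρ₀ ρ₁ z u₀ u₁ v}) hadm w₁
    rw [hdφ, ← h1]
    simp only [MovingWave.IsOptimalLeader, MovingWave.leaderCost_le_iff, Set.mem_ofPred_eq]
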